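/- **Setting.** Let $q\in\mathbb R^\times$ be not a root of unity, and $n\ge 1$. Let $\mathbb C^{1|1}$ have basis $e_{-1}$ (even), $e_{+1}$ (odd) and matrix superunits $e_{ab}$, with $\deg e_{ab}=(1-ab)/2$; put $\mathbb C^{n|n}=(\mathbb C^{1|1})^{\hat\otimes n}$ (graded tensor product), so that the $k$-th copy of $e_{ab}$, written $(e_{ab})_k$, acts on $e_{i_1}\hat\otimes\cdots\hat\otimes e_{i_n}$ with the sign $(-1)^{\deg(e_{ab})(\deg e_{i_1}+\dots+\deg e_{i_{k-1}})}$. The product $\otimes$ between two copies of $\mathbb C^{n|n}$ is the ordinary one, and for $A_1,A_2\in\mathrm{End}(\mathbb C^{n|n})$ we put $(A_1\otimes A_2)\hat\otimes(e_{ij}\otimes e_{kl})=(A_1\hat\otimes e_{ij})\otimes(A_2\hat\otimes e_{kl})$, extended bilinearly. Let $\gamma$ be the linear map of $\mathrm{End}(\mathbb C^{n|n})$ that multiplies an operator of degree $d$ by $(-1)^d$. For $1\le i\le n$ put $\omega_i=(e_{-1,-1}+q^{-2}e_{1,1})_i$, $a_i=(e_{-1,1})_i$, $a_i^\dagger=(e_{1,-1})_i$,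 and further $\omega_0=q^{-1}$, $a_0=(-1-q^2)^{-1/2}$, $a_0^\dagger=-q\,a_0$, $\omega_{-i}=q^{-2}\omega_i^{-1}$, $a_{-i}=q^{-2}a_i^\dagger$, $a_{-i}^\dagger=q^2a_i$. Define operators $\pi(\ell^\pm_{ij})$, $-n\le i,j\le n$, by $\pi(\ell^\pm_{00})=1$, $\pi(\ell^\pm_{ii})=q^{\pm1}\omega_i^{\pm1}$ and $\pi(\ell^\pm_{-i,-i})=q^{\mp1}\omega_i^{\mp1}$ for $i>0$, and, for $i\neq -j$, $$\pi(\ell^-_{ij})=(-1)^{i+j}q^{2(i-j)-3}(q^2-q^{-2})\,a_i^\dagger\,\omega_{i-1}\cdots\omega_{j+1}\,a_j\,\omega_j^{-1}\quad(i>j),$$ $$\pi(\ell^+_{ij})=-(-1)^{i+j}q^{2(i-j)+3}(q^2-q^{-2})\,\omega_i\,a_i^\dagger\,\omega_{i+1}^{-1}\cdots\omega_{j-1}^{-1}\,a_j\quad(i<j),$$ all the other $\pi(\ell^\pm_{ij})$ being $0$. The spinor representation $\pi_\rho$, $\rho\in\mathbb C^\times$, of the extended quantum loop algebra $U^{ex}_{q^2}(\mathcal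 L\mathfrak{so}_{2n+1})$, with generators $\ell^\pm_{ij}[r]$ ($r\ge0$) and generating series $\ell^\pm_{ij}(w)=\sum_r\ell^\pm_{ij}[r]w^{\pm r}$, is given by $$\pi_\rho(\ell^\pm_{ij}(w))=\frac{q^{\pm1}w^{\pm1}\pi(\ell^\mp_{ij})-q^{\mp1}\rho^{\pm1}\pi(\ell^\pm_{ij})}{w^{\pm1}-\rho^{\pm1}},$$ expanded in powers of $w^{\pm1}$. With $\Delta(\ell^\pm_{ij}(w))=\sum_k\ell^\pm_{ik}(w)\otimes\ell^\pm_{kj}(w)$ and $\Delta'$ the opposite coproduct, an operator $X\in\mathrm{End}(\mathbb C^{n|n}\otimes\mathbb C^{n|n})$ is called an *intertwiner* (at $u,v\in\mathbb C^\times$) if $$(\pi_v\otimes\pi_u)(\Delta'(\ell^\pm_{ij}(w)))\,X=X\,(\pi_v\otimes\pi_u)(\Delta(\ell^\pm_{ij}(w)))\qquad(-n\le i,j\le n).$$ The *spinor–spinor $R$-matrix* $R^{(n,n)}(u,v)$ is the intertwiner that fixes $e_{-1,\dots,-1}\otimes e_{-1,\dots,-1}$, where $e_{-1,\dots,-1}=e_{-1}\hat\otimes\cdots\hat\otimes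 e_{-1}$ is the highest vector. Call $(u,v)\in(\mathbb C^\times)^2$ *$n$-generic* if $u\ne q^{4k+2}v$ for $0\le k<n$. Put $$\alpha(u,v)=\frac{v-u}{qv-q^{-1}u},\qquad \beta(u,v)=\frac{q-q^{-1}}{qv-q^{-1}u}.$$ **Proposition.** (a) For every $n\ge1$ and every $n$-generic $(u,v)$ the $R$-matrix $R^{(n,n)}(u,v)$ exists and is unique; moreover the space of all intertwiners is $\mathbb C\,R^{(n,n)}(u,v)$. (b) For $n=1$ and $1$-generic $(u,v)$, $$R^{(1,1)}(u,v)=e_{-1,-1}\otimes e_{-1,-1}+e_{11}\otimes e_{11}+\alpha(u,v)(e_{-1,-1}\otimes e_{11}+e_{11}\otimes e_{-1,-1})+\beta(u,v)(v\,e_{-1,1}\otimes e_{1,-1}+u\,e_{1,-1}\otimes e_{-1,1}).$$ (c) For $n\ge1$ and $u\neq0$, $P^{(n,n)}:=R^{(n,n)}(u,u)$ is the permutation operator $x\otimes y\mapsto y\otimes x$ of $\mathbb C^{n|n}\otimes\mathbb C^{n|n}$, and $P'^{(n,n)}:=(\gamma\otimes id)(P^{(n,n)})=(id\otimes\gamma)(P^{(n,n)})$.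 (d) For $n\ge2$ and $n$-generic $(u,v)$, $$\begin{aligned}R^{(n,n)}(u,v)={}&R^{(n-1,n-1)}(u,v)\hat\otimes(e_{-1,-1}\otimes e_{-1,-1}+e_{11}\otimes e_{11})\\&+\alpha(u,v)\,R^{(n-1,n-1)}(u,q^4v)\hat\otimes(e_{-1,-1}\otimes e_{11}+e_{11}\otimes e_{-1,-1})\\&+\beta(u,v)\,U^{(n-1,n-1)}(u,q^4v)\hat\otimes(v\,e_{-1,1}\otimes e_{1,-1}+u\,e_{1,-1}\otimes e_{-1,1}),\end{aligned}$$ where $U^{(n-1,n-1)}(u,v):=R^{(n-1,n-1)}(q^4,1)\,P'^{(n-1,n-1)}\,R^{(n-1,n-1)}(u,v)$. -/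

import Mathlib

open scoped Kronecker

noncomputable section

namespace SpinorR

/-! ### The superspace `ℂ^{n|n}` and its operators -/

/-- Multi-indices `𝐢 = (i₁, …, iₙ)` with entries `±1`.  They label the basis
`e_𝐢 = e_{i₁} ⊗̂ ⋯ ⊗̂ e_{iₙ}` of `ℂ^{n|n} = (ℂ^{1|1})^{⊗̂ n}`; the site number `k` (from `1` to `n`)
is the element `k - 1` of `Fin n`. -/
abbrev Idx (n : ℕ) : Type := Fin n → ℤˣ

/-- `End(ℂ^{n|n})`, written in the basis `e_𝐢`. -/
abbrev Op (n : ℕ) : Type := Matrix (Idx n) (Idx n) ℂ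

/-- `End(ℂ^{n|n} ⊗ ℂ^{n|n})`, written in the basis `e_𝐢 ⊗ e_𝐣`; the product `⊗` of the two copies
of `ℂ^{n|n}` is the ordinary (ungraded) tensor product, so that `⊗` of operators is `⊗ₖ`. -/
abbrev Op₂ (n : ℕ) : Type := Matrix (Idx n × Idx n) (Idx n × Idx n) ℂ

/-- Degree of the vector `e_i` of `ℂ^{1|1}`: `e_{-1}` is even, `e_{+1}` is odd. -/
def vecDeg (i : ℤˣ) : ℕ := if i = 1 then 1 else 0

/-- Degree of the matrix superunit `e_{ij}` of `End(ℂ^{1|1})`. -/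
def unitDeg (i j : ℤˣ) : ℕ := if i = j then 0 else 1

/-- Degree of the basis vector `e_𝐢`, as a natural number (only its parity matters). -/
def idxDeg {n : ℕ} (i : Idx n) : ℕ := ∑ k, vecDeg (i k)

/-- `θ_𝐢 = i₁ i₂ ⋯ iₙ`, as a complex number. -/
def theta {n : ℕ} (i : Idx n) : ℂ := ∏ k, ((i k : ℤ) : ℂ)

/-- The superunit `e_{ab}` acting on the `k`-th factor of `(ℂ^{1|1})^{⊗̂ n}`:  it is moved past the
first `k - 1` vectors, `1 ⊗̂ ⋯ ⊗̂ e_{ab} ⊗̂ ⋯ ⊗̂ 1`, which produces the Koszul sign. -/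
def locOp {n : ℕ} (k : Fin n) (a b : ℤˣ) : Op n := Matrix.of fun r c =>
  if c k = b ∧ r = Function.update c k a then
    (-1 : ℂ) ^ (unitDeg a b * ∑ l ∈ Finset.Iio k, vecDeg (c l))
  else 0

/-- The same operator with the site numbered by an integer `i`, `1 ≤ i ≤ n`. -/
def atSite (n : ℕ) (i : ℤ) (a b : ℤˣ) : Op n :=
  if h : 1 ≤ i ∧ i ≤ n then locOp (⟨(i - 1).toNat, by omega⟩ : Fin n) a b else 0

/-- The superunit `e_{ab}` of `End(ℂ^{1|1})`. -/
def eUnit (a b : ℤˣ) : Matrix ℤˣ ℤˣ ℂ := Matrix.single a b 1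

/-- The superunit `e_{ab}` of `End(ℂ^{1|1})`, where `ℂ^{1|1}` is indexed by `Idx 1`. -/
def eUnitOne (a b : ℤˣ) : Op 1 := Matrix.single (fun _ => a) (fun _ => b) 1

/-- The graded product `A ⊗̂ X` of `A ∈ End(ℂ^{n|n} ⊗ ℂ^{n|n})` and `X ∈ End(ℂ^{1|1} ⊗ ℂ^{1|1})`, an
element of `End(ℂ^{n+1|n+1} ⊗ ℂ^{n+1|n+1})`.  It is bilinear and
`(A₁ ⊗ A₂) ⊗̂ (e_{ij} ⊗ e_{kl}) = (A₁ ⊗̂ e_{ij}) ⊗ (A₂ ⊗̂ e_{kl})`, where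
`(A₁ ⊗̂ e_{ij}) (e_𝐜 ⊗̂ e_j) = (-1)^{deg(e_{ij}) deg(e_𝐜)} A₁ e_𝐜 ⊗̂ e_i`. -/
def gradedMul {n : ℕ} (A : Op₂ n) (X : Matrix (ℤˣ × ℤˣ) (ℤˣ × ℤˣ) ℂ) : Op₂ (n + 1) :=
  Matrix.of fun r c =>
    (-1 : ℂ) ^ (unitDeg (r.1 (Fin.last n)) (c.1 (Fin.last n)) *
          idxDeg (fun k : Fin n => c.1 k.castSucc) +
        unitDeg (r.2 (Fin.last n)) (c.2 (Fin.last n)) *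
          idxDeg (fun k : Fin n => c.2 k.castSucc)) *
      A (fun k => r.1 k.castSucc, fun k => r.2 k.castSucc)
        (fun k => c.1 k.castSucc, fun k => c.2 k.castSucc) *
      X (r.1 (Fin.last n), r.2 (Fin.last n)) (c.1 (Fin.last n), c.2 (Fin.last n))

/-- `γ ⊗ id` on `End(ℂ^{n|n}) ⊗ End(ℂ^{n|n})`, where `γ(e_{𝐢𝐣}) = θ_𝐢 θ_𝐣 e_{𝐢𝐣}`. -/
def gammaLeft {n : ℕ} (A : Op₂ n) : Op₂ n :=
  Matrix.of fun r c => theta r.1 * theta c.1 * A r c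

/-- `id ⊗ γ` on `End(ℂ^{n|n}) ⊗ End(ℂ^{n|n})`. -/
def gammaRight {n : ℕ} (A : Op₂ n) : Op₂ n :=
  Matrix.of fun r c => theta r.2 * theta c.2 * A r c

/-- The permutation operator `x ⊗ y ↦ y ⊗ x` on `ℂ^{n|n} ⊗ ℂ^{n|n}`. -/
def permOp (n : ℕ) : Op₂ n := Matrix.of fun r c => if r = c.swap then 1 else 0

/-- The vector `e_{(-1,…,-1)} ⊗ e_{(-1,…,-1)}`, the tensor square of the highest vector. -/
def vacuum (n : ℕ) : Idx n × Idx n → ℂ := Pi.single (fun _ => -1, fun _ => -1) 1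

/-! ### The `q²`-Clifford algebra acting on `ℂ^{n|n}`

Throughout, the deformation parameter is `q²`, and its square root is `q`.  The indices of
`ℂ^{2n+1}` are the integers `-n ≤ i ≤ n`. -/

/-- The image of `ω_i`, `1 ≤ i ≤ n`. -/
def omegaPos (q : ℂ) (n : ℕ) (i : ℤ) : Op n :=
  atSite n i (-1) (-1) + (q ^ 2)⁻¹ • atSite n i 1 1

/-- `ω_i` for `-n ≤ i ≤ n`, with `ω_0 = (q²)^{-1/2}` and `ω_{-i} = q^{-2} ω_i^{-1}`. -/
def omega (q : ℂ) (n : ℕ) (i : ℤ) : Op n :=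
  if 0 < i then omegaPos q n i
  else if i = 0 then q⁻¹ • (1 : Op n)
  else (q ^ 2)⁻¹ • (omegaPos q n (-i))⁻¹

/-- The scalar `a_0 = (-1 - q²)^{-1/2}`. -/
def aZero (q : ℂ) : ℂ := (-1 - q ^ 2) ^ (-(1 / 2) : ℂ)

/-- `a_i` for `-n ≤ i ≤ n`, with `a_{-i} = q^{-2} a_i^†`. -/
def annih (q : ℂ) (n : ℕ) (i : ℤ) : Op n :=
  if 0 < i then atSite n i (-1) 1
  else if i = 0 then aZero q • (1 : Op n)
  else (q ^ 2)⁻¹ • atSite n (-i) 1 (-1)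

/-- `a_i^†` for `-n ≤ i ≤ n`, with `a_0^† = -(q²)^{1/2} a_0` and `a_{-i}^† = q² a_i`. -/
def creat (q : ℂ) (n : ℕ) (i : ℤ) : Op n :=
  if 0 < i then atSite n i 1 (-1)
  else if i = 0 then (-(q * aZero q)) • (1 : Op n)
  else q ^ 2 • atSite n (-i) (-1) 1

/-! ### The spinor representation -/

/-- The image of `ℓ⁺_{ij}[0]` in the spinor representation of `U_{q²}(so_{2n+1})`. -/
def spinPlus (q : ℂ) (n : ℕ) (i j : ℤ) : Op n :=
  if i = j then
    if i = 0 then 1 else if 0 < i then q • omega q n i else q⁻¹ • (omega q n (-i))⁻¹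
  else if i = -j then 0
  else if i < j then
    (-((-1 : ℂ) ^ (i + j) * q ^ (2 * (i - j) + 3) * (q ^ 2 - (q ^ 2)⁻¹))) •
      (omega q n i * creat q n i *
        ((List.range (j - i - 1).toNat).map fun t => (omega q n (i + 1 + t))⁻¹).prod *
        annih q n j)
  else 0

/-- The image of `ℓ⁻_{ij}[0]` in the spinor representation of `U_{q²}(so_{2n+1})`. -/
def spinMinus (q : ℂ) (n : ℕ) (i j : ℤ) : Op n :=
  if i = j then
    if i = 0 then 1 else if 0 < i then q⁻¹ • (omega q n i)⁻¹ else q • omega q n (-i)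
  else if i = -j then 0
  else if j < i then
    ((-1 : ℂ) ^ (i + j) * q ^ (2 * (i - j) - 3) * (q ^ 2 - (q ^ 2)⁻¹)) •
      (creat q n i *
        ((List.range (i - j - 1).toNat).map fun t => omega q n (i - 1 - t)).prod *
        annih q n j * (omega q n j)⁻¹)
  else 0

/-- The image of the generator `ℓ^s_{ij}[r]` of `U^{ex}_{q²}(𝓛so_{2n+1})`, `s = ±`, in the spinor
representation with spectral parameter `ρ`.  In terms of the generating series
`ℓ^±(w) = ∑_r ℓ^±[r] w^{±r}` the representation sends
`L⁺(w) ↦ (q w L⁻ - q⁻¹ ρ L⁺) / (w - ρ)` and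
`L⁻(w) ↦ (q⁻¹ w⁻¹ L⁺ - q ρ⁻¹ L⁻) / (w⁻¹ - ρ⁻¹)`,
where the fractions are expanded in powers of `w` and of `w⁻¹`, respectively, and the letters
`L^±` on the right stand for the matrices of degree zero. -/
def evalRep (q : ℂ) (n : ℕ) (ρ : ℂ) (s : ℤˣ) (i j : ℤ) (r : ℕ) : Op n :=
  if s = 1 then
    if r = 0 then q⁻¹ • spinPlus q n i j
    else (ρ ^ r)⁻¹ • (q⁻¹ • spinPlus q n i j - q • spinMinus q n i j)
  else
    if r = 0 then q • spinMinus q n i j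
    else ρ ^ r • (q • spinMinus q n i j - q⁻¹ • spinPlus q n i j)

/-- The operator of `Δ(ℓ^s_{ij}[r]) = ∑_k ∑_{a+b=r} ℓ^s_{ik}[a] ⊗ ℓ^s_{kj}[b]` on the tensor product
of the spinor representations with parameters `v` and `u`, in this order. -/
def coprodOp (q : ℂ) (n : ℕ) (u v : ℂ) (s : ℤˣ) (i j : ℤ) (r : ℕ) : Op₂ n :=
  ∑ k ∈ Finset.Icc (-(n : ℤ)) n, ∑ ab ∈ Finset.HasAntidiagonal.antidiagonal r,
    evalRep q n v s i k ab.1 ⊗ₖ evalRep q n u s k j ab.2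

/-- The operator of the opposite coproduct
`Δ'(ℓ^s_{ij}[r]) = ∑_k ∑_{a+b=r} ℓ^s_{kj}[b] ⊗ ℓ^s_{ik}[a]` on the same tensor product. -/
def oppCoprodOp (q : ℂ) (n : ℕ) (u v : ℂ) (s : ℤˣ) (i j : ℤ) (r : ℕ) : Op₂ n :=
  ∑ k ∈ Finset.Icc (-(n : ℤ)) n, ∑ ab ∈ Finset.HasAntidiagonal.antidiagonal r,
    evalRep q n v s k j ab.2 ⊗ₖ evalRep q n u s i k ab.1

/-- `X` intertwines the coproduct and the opposite coproduct: the equation holds for all generators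
`ℓ^±_{ij}[r]` of `U^{ex}_{q²}(𝓛so_{2n+1})`. -/
def IsIntertwiner (q : ℂ) (n : ℕ) (u v : ℂ) (X : Op₂ n) : Prop :=
  ∀ (s : ℤˣ) (i j : ℤ), i ∈ Finset.Icc (-(n : ℤ)) n → j ∈ Finset.Icc (-(n : ℤ)) n → ∀ r : ℕ,
    oppCoprodOp q n u v s i j r * X = X * coprodOp q n u v s i j r

open Classical in
/-- The spinor-spinor `R`-matrix `R^{(n,n)}(u,v)` of `U^{ex}_{q²}(𝓛so_{2n+1})`: the intertwiner that
fixes the tensor square of the highest vector.  (It is `0` if there is no such intertwiner.) -/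
def spinorR (q : ℂ) (n : ℕ) (u v : ℂ) : Op₂ n :=
  if h : ∃ X : Op₂ n, IsIntertwiner q n u v X ∧ X.mulVec (vacuum n) = vacuum n
  then h.choose else 0

/-- The generic spectral parameters: `u, v ≠ 0` and `(u,v)` is not a pole, that is,
`u ≠ q^{4k+2} v` for `0 ≤ k < n`. -/
def Generic (q : ℂ) (n : ℕ) (u v : ℂ) : Prop :=
  u ≠ 0 ∧ v ≠ 0 ∧ ∀ k : ℕ, k < n → u ≠ q ^ (4 * k + 2) * v

/-- `α(u,v) = (v - u) / (q v - q⁻¹ u)`. -/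
def alpha (q u v : ℂ) : ℂ := (v - u) / (q * v - q⁻¹ * u)

/-- `β(u,v) = (q - q⁻¹) / (q v - q⁻¹ u)`. -/
def beta (q u v : ℂ) : ℂ := (q - q⁻¹) / (q * v - q⁻¹ * u)

/-- `P'^{(n,n)} = (γ ⊗ id)(P^{(n,n)})`. -/
def permOp' (n : ℕ) : Op₂ n := gammaLeft (permOp n)

/-- `U^{(n,n)}(u,v) = R^{(n,n)}(q⁴,1) P'^{(n,n)} R^{(n,n)}(u,v)`. -/
def spinorU (q : ℂ) (n : ℕ) (u v : ℂ) : Op₂ n :=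
  spinorR q n (q ^ 4) 1 * permOp' n * spinorR q n u v

end SpinorR

end

noncomputable section

namespace SpinorR

section

/-! ### Block decompositions along the last site -/

/-! Splitting off the last site turns an operator on two copies into a matrix of blocks, and the
recurrence prescribes the blocks of the R-matrix. Let `Rrec` be the operator so prescribed, freed of
Koszul signs: its middle off-diagonal blocks are multiples of `M R(u, q⁴v)`, where `M = R(q⁴,1) P`
has a recursion of its own, `Mrec`. The claim is that `Rrec` intertwines and that the intertwiners
form a line.

Reduction. Off the diagonal, `π(ℓ^±_{ij})` is a scalar times `up_i * lo_j` (`spinMinus_eq`,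
`spinPlus_eq`), and `L⁺ - q² L⁻` is a scalar multiple of the matrix `(up_i * lo_j)` of rank one
(`Lp_eq`). Call the defect of a pair of matrices `(f, g)` the failure of `X` to intertwine their
product with the opposite product. The conditions for all modes `ℓ^±[r]` telescope to the vanishing
of three defects: `(L⁻,L⁻)`, `(L⁺,L⁺)` and `v (L⁺,L⁻) + u (L⁻,L⁺)` (`isIntertwiner_iff`).

Existence. Simple root operators shift the vector index of `L^±` by one. If `X` respects their
coproducts (`IsSym`), the defects are covariant, and vanishing of the corner `(n,n)` spreads to
every entry (`defect_eq_zero`). For `(L^±,L^±)` the corner is diagonal; for the mixed defect it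
reduces to `M R = R sig(M)` and scalar identities (`Rrec_corner`). `IsSym` itself is inductive: the
old roots act block by block, and the relations for the new root follow from one entry in column `0`
of each finite-type defect (`IsSym.succ`). These entries are written with the operators `strL`,
`strR`, `vecA`, `vecB`, ..., and they vanish by exchange relations between `R(u,v)` and `R(u,q⁴v)`
(`exchange_aux`). The repeated shift of `v` by `q⁴` is the source of the poles `u = q^{4k+2} v`.

Uniqueness. A Cartan element forces the block shape `wt` (`IsFT.exists_wt`). The `(-1,-1)` block is
an intertwiner on one site fewer, hence a multiple of `R`; subtracting that multiple of `Rrec` kills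
it. Comparing the entries `(n+1,0)` of the finite-type and mixed conditions gives `x (v q² vecB - u
vecBt) = 0` for the blocks `x` in one column of the middle square, and this forces `x = 0` away from
the poles (`eq_zero_of_mul_vec`). The other blocks then vanish as well.

Uniqueness also identifies `R(u,u)` with the permutation `P`, so that `R(q⁴,1) P` does satisfy the
recursion of `Mrec` (`Mrec_eq`). Finally, the Koszul sign `par ⊗ par` produced by the graded product
with two odd units is cancelled by the one contained in `P'` (`spinorR_succ`). -/

/-- The multi-index without its last entry. -/
abbrev idxInit {n : ℕ} (r : Idx (n + 1)) : Idx n := fun k => r k.castSucc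

/-- A multi-index splits into its initial part and its last entry. -/
def idxEquiv (n : ℕ) : Idx (n + 1) ≃ Idx n × ℤˣ where
  toFun r := (idxInit r, r (Fin.last n))
  invFun p := Fin.snoc p.1 p.2
  left_inv r := by
    funext k
    refine Fin.lastCases ?_ (fun k => ?_) k <;> simp
  right_inv p := by
    ext <;> simp

lemma idxInit_symm {n : ℕ} (y : Idx n) (s : ℤˣ) : idxInit ((idxEquiv n).symm (y, s)) = y := by
  funext k; simp [idxEquiv]

lemma last_symm {n : ℕ} (y : Idx n) (s : ℤˣ) : ((idxEquiv n).symm (y, s)) (Fin.last n) = s := by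
  simp [idxEquiv]

lemma idx_ext {n : ℕ} {r c : Idx (n + 1)} :
    r = c ↔ idxInit r = idxInit c ∧ r (Fin.last n) = c (Fin.last n) := by
  rw [← (idxEquiv n).apply_eq_iff_eq]
  simp [idxEquiv, Prod.ext_iff]

lemma sum_units {M : Type*} [AddCommMonoid M] (f : ℤˣ → M) : ∑ s, f s = f (-1) + f 1 := by
  rw [show (Finset.univ : Finset ℤˣ) = {1, -1} from rfl, Finset.sum_pair (by decide), add_comm]

lemma sum_idx {M : Type*} [AddCommMonoid M] {n : ℕ} (f : Idx (n + 1) → M) :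
    ∑ x, f x = ∑ y : Idx n, (f ((idxEquiv n).symm (y, -1)) + f ((idxEquiv n).symm (y, 1))) := by
  rw [← (idxEquiv n).symm.sum_comp, Fintype.sum_prod_type]
  simp only [sum_units]

lemma neg_one_ne_one_units : (-1 : ℤˣ) ≠ 1 := by decide

/-- The operator on `n + 1` sites with the blocks `a, b, c, d` with respect to the last site, in the
order `-1, 1`. -/
def b2 {n : ℕ} (a b c d : Op n) : Op (n + 1) := Matrix.of fun r s =>
  (if r (Fin.last n) = 1 then (if s (Fin.last n) = 1 then d else c)
    else (if s (Fin.last n) = 1 then b else a)) (idxInit r) (idxInit s)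

lemma b2_mul {n : ℕ} (a b c d a' b' c' d' : Op n) :
    b2 a b c d * b2 a' b' c' d' =
      b2 (a * a' + b * c') (a * b' + b * d') (c * a' + d * c') (c * b' + d * d') := by
  ext r s
  rw [Matrix.mul_apply, sum_idx]
  simp only [b2, Matrix.of_apply, idxInit_symm, last_symm, neg_one_ne_one_units, if_false, if_true,
    Finset.sum_add_distrib]
  split_ifs <;> simp [Matrix.mul_apply, Matrix.add_apply]

lemma b2_add {n : ℕ} (a b c d a' b' c' d' : Op n) :
    b2 a b c d + b2 a' b' c' d' = b2 (a + a') (b + b') (c + c') (d + d') := by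
  ext r s
  simp only [b2, Matrix.of_apply, Matrix.add_apply]
  split_ifs <;> simp

lemma b2_sub {n : ℕ} (a b c d a' b' c' d' : Op n) :
    b2 a b c d - b2 a' b' c' d' = b2 (a - a') (b - b') (c - c') (d - d') := by
  ext r s
  simp only [b2, Matrix.of_apply, Matrix.sub_apply]
  split_ifs <;> simp

lemma b2_smul {n : ℕ} (t : ℂ) (a b c d : Op n) :
    t • b2 a b c d = b2 (t • a) (t • b) (t • c) (t • d) := by
  ext r s
  simp only [b2, Matrix.of_apply, Matrix.smul_apply]
  split_ifs <;> simp

lemma b2_neg {n : ℕ} (a b c d : Op n) : -b2 a b c d = b2 (-a) (-b) (-c) (-d) := by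
  ext r s
  simp only [b2, Matrix.of_apply, Matrix.neg_apply]
  split_ifs <;> simp

lemma b2_zero {n : ℕ} : b2 (0 : Op n) 0 0 0 = 0 := by
  ext r s
  simp [b2]

lemma b2_one {n : ℕ} : b2 (1 : Op n) 0 0 1 = 1 := by
  ext r s
  rcases Int.units_eq_one_or (r (Fin.last n)) with h | h <;>
    rcases Int.units_eq_one_or (s (Fin.last n)) with h' | h' <;>
    simp [b2, Matrix.one_apply, idx_ext, h, h']

/-- The operator on two copies of `n + 1` sites that preserves the sum of the last entries, with
blocks ordered as `(-1,-1)`, `(-1,1)`, `(1,-1)`, `(1,1)`. -/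
def wt {n : ℕ} (a x₁₁ x₁₂ x₂₁ x₂₂ d : Op₂ n) : Op₂ (n + 1) := Matrix.of fun r s =>
  (if r.1 (Fin.last n) = 1 then
    (if r.2 (Fin.last n) = 1 then
      (if s.1 (Fin.last n) = 1 then (if s.2 (Fin.last n) = 1 then d else 0) else 0)
    else (if s.1 (Fin.last n) = 1 then (if s.2 (Fin.last n) = 1 then 0 else x₂₂)
      else (if s.2 (Fin.last n) = 1 then x₂₁ else 0)))
  else
    (if r.2 (Fin.last n) = 1 then
      (if s.1 (Fin.last n) = 1 then (if s.2 (Fin.last n) = 1 then 0 else x₁₂)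
      else (if s.2 (Fin.last n) = 1 then x₁₁ else 0))
    else (if s.1 (Fin.last n) = 1 then 0 else (if s.2 (Fin.last n) = 1 then 0 else a))))
    (idxInit r.1, idxInit r.2) (idxInit s.1, idxInit s.2)

/-- The operator on two copies of `n + 1` sites that raises the sum of the last entries; the blocks
are `(-1,-1) → (-1,1)`, `(-1,-1) → (1,-1)`, `(-1,1) → (1,1)`, `(1,-1) → (1,1)`. -/
def rs {n : ℕ} (p p' t t' : Op₂ n) : Op₂ (n + 1) := Matrix.of fun r s =>
  (if r.1 (Fin.last n) = 1 then
    (if r.2 (Fin.last n) = 1 then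
      (if s.1 (Fin.last n) = 1 then (if s.2 (Fin.last n) = 1 then 0 else t')
        else (if s.2 (Fin.last n) = 1 then t else 0))
    else (if s.1 (Fin.last n) = 1 then 0 else (if s.2 (Fin.last n) = 1 then 0 else p')))
  else
    (if r.2 (Fin.last n) = 1 then
      (if s.1 (Fin.last n) = 1 then 0 else (if s.2 (Fin.last n) = 1 then 0 else p))
    else 0))
    (idxInit r.1, idxInit r.2) (idxInit s.1, idxInit s.2)

/-- The operator on two copies of `n + 1` sites that lowers the sum of the last entries; the blocks
are `(-1,1) → (-1,-1)`, `(1,-1) → (-1,-1)`, `(1,1) → (-1,1)`, `(1,1) → (1,-1)`. -/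
def lw {n : ℕ} (p p' t t' : Op₂ n) : Op₂ (n + 1) := Matrix.of fun r s =>
  (if s.1 (Fin.last n) = 1 then
    (if s.2 (Fin.last n) = 1 then
      (if r.1 (Fin.last n) = 1 then (if r.2 (Fin.last n) = 1 then 0 else t')
        else (if r.2 (Fin.last n) = 1 then t else 0))
    else (if r.1 (Fin.last n) = 1 then 0 else (if r.2 (Fin.last n) = 1 then 0 else p')))
  else
    (if s.2 (Fin.last n) = 1 then
      (if r.1 (Fin.last n) = 1 then 0 else (if r.2 (Fin.last n) = 1 then 0 else p))
    else 0))
    (idxInit r.1, idxInit r.2) (idxInit s.1, idxInit s.2)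

lemma sum_idx_prod {M : Type*} [AddCommMonoid M] {n : ℕ} (f : Idx (n + 1) × Idx (n + 1) → M) :
    ∑ x, f x = ∑ y : Idx n × Idx n,
      (f ((idxEquiv n).symm (y.1, -1), (idxEquiv n).symm (y.2, -1)) +
        f ((idxEquiv n).symm (y.1, -1), (idxEquiv n).symm (y.2, 1)) +
        f ((idxEquiv n).symm (y.1, 1), (idxEquiv n).symm (y.2, -1)) +
        f ((idxEquiv n).symm (y.1, 1), (idxEquiv n).symm (y.2, 1))) := by
  rw [Fintype.sum_prod_type, sum_idx, Fintype.sum_prod_type]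
  refine Finset.sum_congr rfl fun y _ => ?_
  rw [sum_idx, sum_idx, ← Finset.sum_add_distrib]
  refine Finset.sum_congr rfl fun y' _ => ?_
  simp only [add_assoc]

section mul
variable {n : ℕ} (a x₁₁ x₁₂ x₂₁ x₂₂ d a' y₁₁ y₁₂ y₂₁ y₂₂ d' p p' t t' : Op₂ n)

lemma wt_mul_wt : wt a x₁₁ x₁₂ x₂₁ x₂₂ d * wt a' y₁₁ y₁₂ y₂₁ y₂₂ d' =
    wt (a * a') (x₁₁ * y₁₁ + x₁₂ * y₂₁) (x₁₁ * y₁₂ + x₁₂ * y₂₂) (x₂₁ * y₁₁ + x₂₂ * y₂₁)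
      (x₂₁ * y₁₂ + x₂₂ * y₂₂) (d * d') := by
  ext r s
  rw [Matrix.mul_apply, sum_idx_prod]
  simp only [wt, Matrix.of_apply, idxInit_symm, last_symm, neg_one_ne_one_units, if_false, if_true,
    Finset.sum_add_distrib]
  split_ifs <;> simp [Matrix.mul_apply, Matrix.add_apply]

lemma wt_mul_rs : wt a x₁₁ x₁₂ x₂₁ x₂₂ d * rs p p' t t' =
    rs (x₁₁ * p + x₁₂ * p') (x₂₁ * p + x₂₂ * p') (d * t) (d * t') := by
  ext r s
  rw [Matrix.mul_apply, sum_idx_prod]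
  simp only [wt, rs, Matrix.of_apply, idxInit_symm, last_symm, neg_one_ne_one_units, if_false,
    if_true, Finset.sum_add_distrib]
  split_ifs <;> simp [Matrix.mul_apply, Matrix.add_apply]

lemma rs_mul_wt : rs p p' t t' * wt a x₁₁ x₁₂ x₂₁ x₂₂ d =
    rs (p * a) (p' * a) (t * x₁₁ + t' * x₂₁) (t * x₁₂ + t' * x₂₂) := by
  ext r s
  rw [Matrix.mul_apply, sum_idx_prod]
  simp only [wt, rs, Matrix.of_apply, idxInit_symm, last_symm, neg_one_ne_one_units, if_false,
    if_true, Finset.sum_add_distrib]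
  split_ifs <;> simp [Matrix.mul_apply, Matrix.add_apply]

lemma wt_mul_lw : wt a x₁₁ x₁₂ x₂₁ x₂₂ d * lw p p' t t' =
    lw (a * p) (a * p') (x₁₁ * t + x₁₂ * t') (x₂₁ * t + x₂₂ * t') := by
  ext r s
  rw [Matrix.mul_apply, sum_idx_prod]
  simp only [wt, lw, Matrix.of_apply, idxInit_symm, last_symm, neg_one_ne_one_units, if_false,
    if_true, Finset.sum_add_distrib]
  split_ifs <;> simp [Matrix.mul_apply, Matrix.add_apply]

lemma lw_mul_wt : lw p p' t t' * wt a x₁₁ x₁₂ x₂₁ x₂₂ d =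
    lw (p * x₁₁ + p' * x₂₁) (p * x₁₂ + p' * x₂₂) (t * d) (t' * d) := by
  ext r s
  rw [Matrix.mul_apply, sum_idx_prod]
  simp only [wt, lw, Matrix.of_apply, idxInit_symm, last_symm, neg_one_ne_one_units, if_false,
    if_true, Finset.sum_add_distrib]
  split_ifs <;> simp [Matrix.mul_apply, Matrix.add_apply]

lemma wt_add : wt a x₁₁ x₁₂ x₂₁ x₂₂ d + wt a' y₁₁ y₁₂ y₂₁ y₂₂ d' =
    wt (a + a') (x₁₁ + y₁₁) (x₁₂ + y₁₂) (x₂₁ + y₂₁) (x₂₂ + y₂₂) (d + d') := by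
  ext r s
  simp only [wt, Matrix.of_apply, Matrix.add_apply]
  split_ifs <;> simp

lemma wt_sub : wt a x₁₁ x₁₂ x₂₁ x₂₂ d - wt a' y₁₁ y₁₂ y₂₁ y₂₂ d' =
    wt (a - a') (x₁₁ - y₁₁) (x₁₂ - y₁₂) (x₂₁ - y₂₁) (x₂₂ - y₂₂) (d - d') := by
  ext r s
  simp only [wt, Matrix.of_apply, Matrix.sub_apply]
  split_ifs <;> simp

lemma wt_smul (z : ℂ) : z • wt a x₁₁ x₁₂ x₂₁ x₂₂ d =
    wt (z • a) (z • x₁₁) (z • x₁₂) (z • x₂₁) (z • x₂₂) (z • d) := by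
  ext r s
  simp only [wt, Matrix.of_apply, Matrix.smul_apply]
  split_ifs <;> simp

lemma rs_add (r r' s s' : Op₂ n) : rs p p' t t' + rs r r' s s' =
    rs (p + r) (p' + r') (t + s) (t' + s') := by
  ext i j
  simp only [rs, Matrix.of_apply, Matrix.add_apply]
  split_ifs <;> simp

lemma rs_smul (z : ℂ) : z • rs p p' t t' = rs (z • p) (z • p') (z • t) (z • t') := by
  ext i j
  simp only [rs, Matrix.of_apply, Matrix.smul_apply]
  split_ifs <;> simp

lemma lw_add (r r' s s' : Op₂ n) : lw p p' t t' + lw r r' s s' =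
    lw (p + r) (p' + r') (t + s) (t' + s') := by
  ext i j
  simp only [lw, Matrix.of_apply, Matrix.add_apply]
  split_ifs <;> simp

lemma lw_smul (z : ℂ) : z • lw p p' t t' = lw (z • p) (z • p') (z • t) (z • t') := by
  ext i j
  simp only [lw, Matrix.of_apply, Matrix.smul_apply]
  split_ifs <;> simp

end mul

lemma wt_zero {n : ℕ} : wt (0 : Op₂ n) 0 0 0 0 0 = 0 := by
  ext r s
  simp [wt]

lemma wt_one {n : ℕ} : wt (1 : Op₂ n) 1 0 0 1 1 = 1 := by
  ext ⟨r, r'⟩ ⟨s, s'⟩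
  rcases Int.units_eq_one_or (r (Fin.last n)) with h | h <;>
    rcases Int.units_eq_one_or (s (Fin.last n)) with h' | h' <;>
    rcases Int.units_eq_one_or (r' (Fin.last n)) with k | k <;>
    rcases Int.units_eq_one_or (s' (Fin.last n)) with k' | k' <;>
    simp [wt, Matrix.one_apply, Prod.ext_iff, idx_ext, h, h', k, k']

/-! ### Reading off and comparing blocks -/

/-- The block of an operator on two copies of `n + 1` sites. -/
def blk {n : ℕ} (X : Op₂ (n + 1)) (p p' : ℤˣ × ℤˣ) : Op₂ n := Matrix.of fun r s =>
  X ((idxEquiv n).symm (r.1, p.1), (idxEquiv n).symm (r.2, p.2))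
    ((idxEquiv n).symm (s.1, p'.1), (idxEquiv n).symm (s.2, p'.2))

lemma ext_blk {n : ℕ} {X Y : Op₂ (n + 1)} (h : ∀ p p', blk X p p' = blk Y p p') : X = Y := by
  ext ⟨r, r'⟩ ⟨s, s'⟩
  have := congrFun (congrFun (h (r (Fin.last n), r' (Fin.last n)) (s (Fin.last n), s' (Fin.last n)))
    (idxInit r, idxInit r')) (idxInit s, idxInit s')
  simp only [blk, Matrix.of_apply] at this
  have e : ∀ x : Idx (n + 1), (idxEquiv n).symm (idxInit x, x (Fin.last n)) = x :=
    fun x => (idxEquiv n).symm_apply_apply x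
  simpa only [e] using this

lemma blk_mul {n : ℕ} (X Y : Op₂ (n + 1)) (p p' : ℤˣ × ℤˣ) :
    blk (X * Y) p p' = blk X p (-1, -1) * blk Y (-1, -1) p' + blk X p (-1, 1) * blk Y (-1, 1) p' +
      blk X p (1, -1) * blk Y (1, -1) p' + blk X p (1, 1) * blk Y (1, 1) p' := by
  ext r s
  simp only [blk, Matrix.of_apply, Matrix.mul_apply, sum_idx_prod, Matrix.add_apply,
    Finset.sum_add_distrib]

lemma blk_wt {n : ℕ} (a x₁₁ x₁₂ x₂₁ x₂₂ d : Op₂ n) (p p' : ℤˣ × ℤˣ) :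
    blk (wt a x₁₁ x₁₂ x₂₁ x₂₂ d) p p' =
    (if p.1 = 1 then
    (if p.2 = 1 then
      (if p'.1 = 1 then (if p'.2 = 1 then d else 0) else 0)
    else (if p'.1 = 1 then (if p'.2 = 1 then 0 else x₂₂)
      else (if p'.2 = 1 then x₂₁ else 0)))
  else
    (if p.2 = 1 then
      (if p'.1 = 1 then (if p'.2 = 1 then 0 else x₁₂)
      else (if p'.2 = 1 then x₁₁ else 0))
    else (if p'.1 = 1 then 0 else (if p'.2 = 1 then 0 else a)))) := by
  ext r s
  simp only [blk, wt, Matrix.of_apply, last_symm, idxInit_symm]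

lemma blk_rs {n : ℕ} (a x b y : Op₂ n) (p p' : ℤˣ × ℤˣ) :
    blk (rs a x b y) p p' =
    (if p.1 = 1 then
    (if p.2 = 1 then
      (if p'.1 = 1 then (if p'.2 = 1 then 0 else y)
        else (if p'.2 = 1 then b else 0))
    else (if p'.1 = 1 then 0 else (if p'.2 = 1 then 0 else x)))
  else
    (if p.2 = 1 then
      (if p'.1 = 1 then 0 else (if p'.2 = 1 then 0 else a))
    else 0)) := by
  ext r s
  simp only [blk, rs, Matrix.of_apply, last_symm, idxInit_symm]

lemma blk_lw {n : ℕ} (a x b y : Op₂ n) (p p' : ℤˣ × ℤˣ) :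
    blk (lw a x b y) p p' =
    (if p'.1 = 1 then
    (if p'.2 = 1 then
      (if p.1 = 1 then (if p.2 = 1 then 0 else y)
        else (if p.2 = 1 then b else 0))
    else (if p.1 = 1 then 0 else (if p.2 = 1 then 0 else x)))
  else
    (if p'.2 = 1 then
      (if p.1 = 1 then 0 else (if p.2 = 1 then 0 else a))
    else 0)) := by
  ext r s
  simp only [blk, lw, Matrix.of_apply, last_symm, idxInit_symm]

lemma wt_inj {n : ℕ} {a x₁₁ x₁₂ x₂₁ x₂₂ d a' y₁₁ y₁₂ y₂₁ y₂₂ d' : Op₂ n} :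
    wt a x₁₁ x₁₂ x₂₁ x₂₂ d = wt a' y₁₁ y₁₂ y₂₁ y₂₂ d' ↔
      a = a' ∧ x₁₁ = y₁₁ ∧ x₁₂ = y₁₂ ∧ x₂₁ = y₂₁ ∧ x₂₂ = y₂₂ ∧ d = d' := by
  constructor
  · intro h
    have key := fun p p' => congrArg (fun X => blk X p p') h
    simp only [blk_wt] at key
    exact ⟨by simpa using key (-1, -1) (-1, -1), by simpa using key (-1, 1) (-1, 1),
      by simpa using key (-1, 1) (1, -1), by simpa using key (1, -1) (-1, 1),
      by simpa using key (1, -1) (1, -1), by simpa using key (1, 1) (1, 1)⟩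
  · rintro ⟨rfl, rfl, rfl, rfl, rfl, rfl⟩; rfl

lemma rs_inj {n : ℕ} {p p' t t' r r' s s' : Op₂ n} :
    rs p p' t t' = rs r r' s s' ↔ p = r ∧ p' = r' ∧ t = s ∧ t' = s' := by
  constructor
  · intro h
    have key := fun p p' => congrArg (fun X => blk X p p') h
    simp only [blk_rs] at key
    exact ⟨by simpa using key (-1, 1) (-1, -1), by simpa using key (1, -1) (-1, -1),
      by simpa using key (1, 1) (-1, 1), by simpa using key (1, 1) (1, -1)⟩
  · rintro ⟨rfl, rfl, rfl, rfl⟩; rfl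

lemma lw_inj {n : ℕ} {p p' t t' r r' s s' : Op₂ n} :
    lw p p' t t' = lw r r' s s' ↔ p = r ∧ p' = r' ∧ t = s ∧ t' = s' := by
  constructor
  · intro h
    have key := fun p p' => congrArg (fun X => blk X p p') h
    simp only [blk_lw] at key
    exact ⟨by simpa using key (-1, -1) (-1, 1), by simpa using key (-1, -1) (1, -1),
      by simpa using key (-1, 1) (1, 1), by simpa using key (1, -1) (1, 1)⟩
  · rintro ⟨rfl, rfl, rfl, rfl⟩; rfl

/-! ### Tensor products of blocks -/

section kron
variable {n : ℕ} (a d a' d' b c : Op n)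

lemma diag_kron_diag : b2 a 0 0 d ⊗ₖ b2 a' 0 0 d' =
    wt (a ⊗ₖ a') (a ⊗ₖ d') 0 0 (d ⊗ₖ a') (d ⊗ₖ d') := by
  ext r s
  simp only [Matrix.kroneckerMap_apply, b2, wt, Matrix.of_apply]
  split_ifs <;> simp

lemma low_kron_diag : b2 0 0 c 0 ⊗ₖ b2 a' 0 0 d' = rs 0 (c ⊗ₖ a') (c ⊗ₖ d') 0 := by
  ext r s
  simp only [Matrix.kroneckerMap_apply, b2, rs, Matrix.of_apply]
  split_ifs <;> simp

lemma diag_kron_low : b2 a 0 0 d ⊗ₖ b2 0 0 c 0 = rs (a ⊗ₖ c) 0 0 (d ⊗ₖ c) := by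
  ext r s
  simp only [Matrix.kroneckerMap_apply, b2, rs, Matrix.of_apply]
  split_ifs <;> simp

lemma upp_kron_diag : b2 0 b 0 0 ⊗ₖ b2 a' 0 0 d' = lw 0 (b ⊗ₖ a') (b ⊗ₖ d') 0 := by
  ext r s
  simp only [Matrix.kroneckerMap_apply, b2, lw, Matrix.of_apply]
  split_ifs <;> simp

lemma diag_kron_upp : b2 a 0 0 d ⊗ₖ b2 0 b 0 0 = lw (a ⊗ₖ b) 0 0 (d ⊗ₖ b) := by
  ext r s
  simp only [Matrix.kroneckerMap_apply, b2, lw, Matrix.of_apply]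
  split_ifs <;> simp

lemma upp_kron_low : b2 0 b 0 0 ⊗ₖ b2 0 0 c 0 = wt 0 0 (b ⊗ₖ c) 0 0 0 := by
  ext r s
  simp only [Matrix.kroneckerMap_apply, b2, wt, Matrix.of_apply]
  split_ifs <;> simp

lemma low_kron_upp : b2 0 0 c 0 ⊗ₖ b2 0 b 0 0 = wt 0 0 0 (c ⊗ₖ b) 0 0 := by
  ext r s
  simp only [Matrix.kroneckerMap_apply, b2, wt, Matrix.of_apply]
  split_ifs <;> simp

end kron

/-! ### The anti-involution `X ↦ P Xᵗ P` -/

/-- The transpose of an operator, conjugated by the permutation of the two copies. -/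
def sig {n : ℕ} (X : Op₂ n) : Op₂ n := Matrix.of fun r s => X s.swap r.swap

lemma sig_mul {n : ℕ} (X Y : Op₂ n) : sig (X * Y) = sig Y * sig X := by
  ext r s
  simp only [sig, Matrix.of_apply, Matrix.mul_apply]
  rw [← (Equiv.prodComm (Idx n) (Idx n)).sum_comp]
  exact Finset.sum_congr rfl fun _ _ => by simp [mul_comm]

lemma sig_add {n : ℕ} (X Y : Op₂ n) : sig (X + Y) = sig X + sig Y := rfl

lemma sig_smul {n : ℕ} (z : ℂ) (X : Op₂ n) : sig (z • X) = z • sig X := rfl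

lemma sig_zero {n : ℕ} : sig (0 : Op₂ n) = 0 := rfl

lemma sig_one {n : ℕ} : sig (1 : Op₂ n) = 1 := by
  ext r s
  simp [sig, Matrix.one_apply, eq_comm]

/-- Swapping the copies interchanges `(-1,1)` and `(1,-1)`, and transposition interchanges rows and
columns. Together they exchange the two diagonal middle blocks and leave the off-diagonal ones in
place. -/
lemma sig_wt {n : ℕ} (a x₁₁ x₁₂ x₂₁ x₂₂ d : Op₂ n) : sig (wt a x₁₁ x₁₂ x₂₁ x₂₂ d) =
    wt (sig a) (sig x₂₂) (sig x₁₂) (sig x₂₁) (sig x₁₁) (sig d) := by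
  ext r s
  simp only [sig, wt, Matrix.of_apply, Prod.fst_swap, Prod.snd_swap]
  split_ifs <;> rfl

lemma permOp_mul_permOp (n : ℕ) : permOp n * permOp n = 1 := by
  ext r s
  simp [permOp, Matrix.mul_apply, Matrix.one_apply]

lemma permOp_succ (n : ℕ) :
    permOp (n + 1) = wt (permOp n) 0 (permOp n) (permOp n) 0 (permOp n) := by
  ext ⟨r, r'⟩ ⟨s, s'⟩
  rcases Int.units_eq_one_or (r (Fin.last n)) with h | h <;>
    rcases Int.units_eq_one_or (s (Fin.last n)) with h' | h' <;>
    rcases Int.units_eq_one_or (r' (Fin.last n)) with k | k <;>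
    rcases Int.units_eq_one_or (s' (Fin.last n)) with k' | k' <;>
    simp [wt, permOp, idx_ext, h, h', k, k']

end

section

/-! ### The recursively defined operators -/

/-- The operator `R^{(n,n)}(q⁴,1) P^{(n,n)}`, in recursive form. -/
def Mrec (q : ℂ) : (n : ℕ) → Op₂ n
  | 0 => 1
  | n + 1 => wt (Mrec q n) (-(q ^ 2)⁻¹ • Mrec q n) ((q + q⁻¹) • (1 : Op₂ n))
      ((q + q⁻¹) • (1 : Op₂ n)) (-q ^ 2 • Mrec q n) (Mrec q n)

/-- The `R`-matrix, in recursive form. -/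
def Rrec (q : ℂ) : (n : ℕ) → ℂ → ℂ → Op₂ n
  | 0, _, _ => 1
  | n + 1, u, v => wt (Rrec q n u v) (alpha q u v • Rrec q n u (q ^ 4 * v))
      ((beta q u v * v) • (Mrec q n * Rrec q n u (q ^ 4 * v)))
      ((beta q u v * u) • (Mrec q n * Rrec q n u (q ^ 4 * v)))
      (alpha q u v • Rrec q n u (q ^ 4 * v)) (Rrec q n u v)

/-- The diagonal string operator in the first copy. -/
def strL (q : ℂ) : (n : ℕ) → Op₂ n
  | 0 => 1
  | n + 1 => wt (strL q n) (strL q n) 0 0 (-(q ^ 2)⁻¹ • strL q n) (-(q ^ 2)⁻¹ • strL q n)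

/-- The diagonal string operator in the second copy. -/
def strR (q : ℂ) : (n : ℕ) → Op₂ n
  | 0 => 1
  | n + 1 => wt (strR q n) (-(q ^ 2)⁻¹ • strR q n) 0 0 (strR q n) (-(q ^ 2)⁻¹ • strR q n)

/-- The operator by which `Δ(ℓ⁻_{n+1,0})` raises the last entry of the first copy. -/
def vecB (q : ℂ) : (n : ℕ) → Op₂ n
  | 0 => 1
  | n + 1 => wt (vecB q n) (vecB q n) ((q - q⁻¹ ^ 3) • strR q n) 0 (-(q ^ 2)⁻¹ • vecB q n)
      (-(q ^ 2)⁻¹ • vecB q n)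

/-- The transpose of `vecB`. -/
def vecBt (q : ℂ) : (n : ℕ) → Op₂ n
  | 0 => 1
  | n + 1 => wt (vecBt q n) (vecBt q n) 0 ((q - q⁻¹ ^ 3) • strR q n) (-(q ^ 2)⁻¹ • vecBt q n)
      (-(q ^ 2)⁻¹ • vecBt q n)

/-- The counterpart of `vecB` for the opposite coproduct. -/
def vecA (q : ℂ) : (n : ℕ) → Op₂ n
  | 0 => 1
  | n + 1 => wt (vecA q n) (-(q ^ 2)⁻¹ • vecA q n) 0 ((q - q⁻¹ ^ 3) • strL q n) (vecA q n)
      (-(q ^ 2)⁻¹ • vecA q n)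

/-- The counterpart of `vecBt` for the opposite coproduct. -/
def vecAt (q : ℂ) : (n : ℕ) → Op₂ n
  | 0 => 1
  | n + 1 => wt (vecAt q n) (-(q ^ 2)⁻¹ • vecAt q n) ((q - q⁻¹ ^ 3) • strL q n) 0 (vecAt q n)
      (-(q ^ 2)⁻¹ • vecAt q n)

variable {q : ℂ}

lemma sig_strR (n : ℕ) : sig (strR q n) = strL q n := by
  induction n with
  | zero => exact sig_one
  | succ n ih => simp only [strL, strR, sig_wt, sig_smul, sig_zero, ih]

lemma sig_strL (n : ℕ) : sig (strL q n) = strR q n := by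
  induction n with
  | zero => exact sig_one
  | succ n ih => simp only [strL, strR, sig_wt, sig_smul, sig_zero, ih]

lemma sig_vecA (n : ℕ) : sig (vecA q n) = vecBt q n := by
  induction n with
  | zero => exact sig_one
  | succ n ih => simp only [vecA, vecBt, sig_wt, sig_smul, sig_zero, ih, sig_strL]

lemma sig_vecAt (n : ℕ) : sig (vecAt q n) = vecB q n := by
  induction n with
  | zero => exact sig_one
  | succ n ih => simp only [vecAt, vecB, sig_wt, sig_smul, sig_zero, ih, sig_strL]

lemma sig_vecB (n : ℕ) : sig (vecB q n) = vecAt q n := by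
  induction n with
  | zero => exact sig_one
  | succ n ih => simp only [vecAt, vecB, sig_wt, sig_smul, sig_zero, ih, sig_strR]

lemma sig_vecBt (n : ℕ) : sig (vecBt q n) = vecA q n := by
  induction n with
  | zero => exact sig_one
  | succ n ih => simp only [vecA, vecBt, sig_wt, sig_smul, sig_zero, ih, sig_strR]

/-! ### Relations between `Mrec` and the vector operators -/

/-- The last two relations are rules that move `Mrec` to the left. They need a joint induction
because the off-diagonal block of `vecA` is a multiple of `strL`, so that the third relation meets
the product `strL * Mrec`. The first relation serves to eliminate `vecAt`. -/
lemma Mrec_relations (hq : q ≠ 0) (n : ℕ) :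
    (q ^ 2 - 1) • (Mrec q n * strL q n) = q ^ 2 • vecA q n - vecAt q n ∧
    strL q n * Mrec q n = (1 + q ^ 2) • vecA q n - q ^ 2 • (Mrec q n * strL q n) ∧
    vecA q n * Mrec q n = (1 + (q ^ 2)⁻¹) • strL q n - (q ^ 2)⁻¹ • (Mrec q n * vecA q n) := by
  induction n with
  | zero => simp [Mrec, strL, vecA, vecAt, sub_smul, add_smul]
  | succ n ih =>
    obtain ⟨h1, h2, h3⟩ := ih
    simp only [Mrec, strL, vecA, vecAt, wt_mul_wt, wt_smul, wt_sub, wt_inj, mul_zero, zero_mul,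
      add_zero, zero_add, smul_zero, smul_mul_assoc, mul_smul_comm, one_mul, mul_one, h2, h3]
    refine ⟨⟨h1, ?_, ?_, ?_, ?_, ?_⟩, ⟨trivial, ?_, ?_, ?_, ?_, ?_⟩, ⟨trivial, ?_, ?_, ?_, ?_, ?_⟩⟩
    · linear_combination (norm := skip) (-(q ^ 2)⁻¹) • h1
      match_scalars <;> (field_simp; try ring)
    · match_scalars; field_simp; ring
    · match_scalars; field_simp; ring
    · linear_combination (norm := skip) h1
      match_scalars <;> (field_simp; try ring)
    · linear_combination (norm := skip) (-(q ^ 2)⁻¹) • h1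
      match_scalars <;> (field_simp; try ring)
    all_goals (match_scalars <;> (field_simp; try ring))

lemma Mrec_mul_strL (hq : q ≠ 0) (n : ℕ) :
    (q ^ 2 - 1) • (Mrec q n * strL q n) = q ^ 2 • vecA q n - vecAt q n :=
  (Mrec_relations hq n).1

lemma strL_mul_Mrec (hq : q ≠ 0) (n : ℕ) :
    strL q n * Mrec q n = (1 + q ^ 2) • vecA q n - q ^ 2 • (Mrec q n * strL q n) :=
  (Mrec_relations hq n).2.1

lemma vecA_mul_Mrec (hq : q ≠ 0) (n : ℕ) :
    vecA q n * Mrec q n = (1 + (q ^ 2)⁻¹) • strL q n - (q ^ 2)⁻¹ • (Mrec q n * vecA q n) :=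
  (Mrec_relations hq n).2.2

lemma vecAt_eq (hq : q ≠ 0) (n : ℕ) :
    vecAt q n = q ^ 2 • vecA q n - (q ^ 2 - 1) • (Mrec q n * strL q n) := by
  rw [Mrec_mul_strL hq]; abel

lemma sig_sub {n : ℕ} (X Y : Op₂ n) : sig (X - Y) = sig X - sig Y := rfl

/-- The mirror image under `sig` of a relation for `strL * Mrec`; it lets `vecB` and `vecBt` be
traded for each other. -/
lemma sig_Mrec_mul_strR (hq : q ≠ 0) (n : ℕ) :
    (q ^ 2 - 1) • (sig (Mrec q n) * strR q n) = q ^ 2 • vecB q n - vecBt q n := by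
  have h : (q ^ 2 - 1) • (strL q n * Mrec q n) = q ^ 2 • vecAt q n - vecA q n := by
    rw [strL_mul_Mrec hq, vecAt_eq hq]
    module
  have h' := congrArg sig h
  simp only [sig_smul, sig_mul, sig_sub, sig_strL, sig_vecAt, sig_vecA] at h'
  exact h'

lemma sig_Mrec_succ (n : ℕ) : sig (Mrec q (n + 1)) =
    wt (sig (Mrec q n)) (-q ^ 2 • sig (Mrec q n)) ((q + q⁻¹) • (1 : Op₂ n))
      ((q + q⁻¹) • (1 : Op₂ n)) (-(q ^ 2)⁻¹ • sig (Mrec q n)) (sig (Mrec q n)) := by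
  simp only [Mrec, sig_wt, sig_smul, sig_one]

/-- `Rrec` carries `Mrec` on the left in its off-diagonal blocks, whereas `sig` would put `sig Mrec`
on the right. That the two agree is the source of the symmetry of `Rrec` under `sig`, and later of
the mixed corner relation. In the middle blocks it comes down to identities between `alpha` and
`beta`. -/
lemma Mrec_mul_Rrec (hq : q ≠ 0) (n : ℕ) (u v : ℂ) :
    Mrec q n * Rrec q n u v = Rrec q n u v * sig (Mrec q n) := by
  induction n generalizing u v with
  | zero => simp [Mrec, Rrec, sig_one]
  | succ n ih =>
    have ih2 : Mrec q n * (Mrec q n * Rrec q n u (q ^ 4 * v)) =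
        Mrec q n * (Rrec q n u (q ^ 4 * v) * sig (Mrec q n)) := by rw [ih]
    rw [sig_Mrec_succ]
    simp only [Mrec, Rrec, wt_mul_wt, wt_inj, smul_mul_assoc, mul_smul_comm, one_mul, mul_one,
      mul_assoc, ← ih]
    refine ⟨trivial, ?_, ?_, ?_, ?_, trivial⟩ <;> match_scalars <;>
      simp only [alpha, beta, div_eq_mul_inv] <;>
      generalize (q * v - q⁻¹ * u)⁻¹ = I <;> field_simp <;> ring

lemma sig_sig {n : ℕ} (X : Op₂ n) : sig (sig X) = X := rfl

lemma sig_Rrec (hq : q ≠ 0) (n : ℕ) (u v : ℂ) : sig (Rrec q n u v) = Rrec q n u v := by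
  induction n generalizing u v with
  | zero => exact sig_one
  | succ n ih => simp only [Rrec, sig_wt, sig_smul, sig_mul, ih, Mrec_mul_Rrec hq, sig_sig]

/-! ### The vector operators and `Rrec` -/

/-- The two relations form a closed system: the blocks for `n + 1` sites at `v` involve only those
for `n` sites at `v` and at `q⁴ v`. The denominators have to be nonzero only on zero sites, after
`v` has been multiplied by powers of `q⁴`; the inductive step is an identity in the formal inverses.
-/
lemma exchange_aux (hq : q ≠ 0) (n : ℕ) (u v : ℂ)
    (huv : ∀ k ≤ n, q * (q ^ (4 * k) * v) - q⁻¹ * u ≠ 0) :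
    vecA q n * Rrec q n u v =
      (alpha q u v * q⁻¹) • (Rrec q n u (q ^ 4 * v) * strR q n) +
        (beta q u v * v) • (Mrec q n * (Rrec q n u (q ^ 4 * v) * vecB q n)) ∧
    strL q n * Rrec q n u v =
      (beta q u v * u) • (Mrec q n * (Rrec q n u (q ^ 4 * v) * strR q n)) +
        (q * alpha q u v) • (Rrec q n u (q ^ 4 * v) * vecB q n) := by
  induction n generalizing v with
  | zero =>
    have h0 : q * v - q⁻¹ * u ≠ 0 := by simpa using huv 0 le_rfl
    have hI := mul_inv_cancel₀ h0
    simp only [vecA, Rrec, strR, Mrec, vecB, strL, mul_one, alpha, beta, div_eq_mul_inv]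
    generalize (q * v - q⁻¹ * u)⁻¹ = I at hI ⊢
    constructor <;> match_scalars <;> linear_combination -hI
  | succ n ih =>
    obtain ⟨k1, k2⟩ := ih v fun k hk => huv k (hk.trans n.le_succ)
    obtain ⟨h1, h2⟩ := ih (q ^ 4 * v) fun k hk => by
      have := huv (k + 1) (by omega)
      rwa [show q ^ (4 * (k + 1)) * v = q ^ (4 * k) * (q ^ 4 * v) by ring] at this
    -- The off-diagonal blocks of `Rrec` start with `Mrec`, which has to be passed before the
    -- inductive hypothesis at `q⁴ v` applies.
    have h3 : vecA q n * (Mrec q n * Rrec q n u (q ^ 4 * v)) =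
        (1 + (q ^ 2)⁻¹) • (strL q n * Rrec q n u (q ^ 4 * v)) -
          (q ^ 2)⁻¹ • (Mrec q n * (vecA q n * Rrec q n u (q ^ 4 * v))) := by
      rw [← mul_assoc, vecA_mul_Mrec hq, sub_mul, smul_mul_assoc, smul_mul_assoc, mul_assoc]
    have h4 : strL q n * (Mrec q n * Rrec q n u (q ^ 4 * v)) =
        (1 + q ^ 2) • (vecA q n * Rrec q n u (q ^ 4 * v)) -
          q ^ 2 • (Mrec q n * (strL q n * Rrec q n u (q ^ 4 * v))) := by
      rw [← mul_assoc, strL_mul_Mrec hq, sub_mul, smul_mul_assoc, smul_mul_assoc, mul_assoc]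
    simp only [Mrec, Rrec, strL, strR, vecA, vecB, wt_mul_wt, wt_add, wt_smul, wt_inj,
      smul_mul_assoc, mul_smul_comm, one_mul, mul_assoc, mul_zero, zero_mul, add_zero,
      zero_add, smul_zero, k1, k2, h3, h4, h1, h2, mul_add, smul_add]
    refine ⟨⟨trivial, ?_, ?_, ?_, ?_, ?_⟩, trivial, ?_, ?_, ?_, ?_, ?_⟩ <;> match_scalars <;>
      simp only [alpha, beta, div_eq_mul_inv] <;>
      generalize (q * v - q⁻¹ * u)⁻¹ = I <;>
      generalize (q * (q ^ 4 * v) - q⁻¹ * u)⁻¹ = J <;> field_simp <;> try ring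

section exchange
variable (hq : q ≠ 0) (n : ℕ) (u v : ℂ)
    (huv : ∀ k ≤ n, q * (q ^ (4 * k) * v) - q⁻¹ * u ≠ 0)
include hq huv

lemma vecA_mul_Rrec : vecA q n * Rrec q n u v =
      (alpha q u v * q⁻¹) • (Rrec q n u (q ^ 4 * v) * strR q n) +
        (beta q u v * v) • (Mrec q n * Rrec q n u (q ^ 4 * v) * vecB q n) := by
  simpa only [mul_assoc] using (exchange_aux hq n u v huv).1

lemma strL_mul_Rrec : strL q n * Rrec q n u v =
      (beta q u v * u) • (Mrec q n * Rrec q n u (q ^ 4 * v) * strR q n) +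
        (q * alpha q u v) • (Rrec q n u (q ^ 4 * v) * vecB q n) := by
  simpa only [mul_assoc] using (exchange_aux hq n u v huv).2

/-- The companion needed for lowering operators: `vecB` is replaced by `vecBt`, and the surplus `sig
Mrec * strR` is carried through `Rrec` as `Mrec`. This turns the coefficient `u` into `v` and `q`
into `q⁻¹`. -/
lemma strL_mul_Rrec' : strL q n * Rrec q n u v =
      (beta q u v * v) • (Mrec q n * Rrec q n u (q ^ 4 * v) * strR q n) +
        (q⁻¹ * alpha q u v) • (Rrec q n u (q ^ 4 * v) * vecBt q n) := by
  have h : vecBt q n = q ^ 2 • vecB q n - (q ^ 2 - 1) • (sig (Mrec q n) * strR q n) := by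
    rw [sig_Mrec_mul_strR hq]; abel
  rw [strL_mul_Rrec hq n u v huv, h, mul_sub, mul_smul_comm, mul_smul_comm, ← mul_assoc,
    ← Mrec_mul_Rrec hq]
  match_scalars <;> simp only [alpha, beta, div_eq_mul_inv] <;>
      generalize (q * v - q⁻¹ * u)⁻¹ = I <;> field_simp <;> ring

lemma vecAt_mul_Rrec : vecAt q n * Rrec q n u v =
      (alpha q u v * q) • (Rrec q n u (q ^ 4 * v) * strR q n) +
        (beta q u v * u) • (Mrec q n * Rrec q n u (q ^ 4 * v) * vecBt q n) := by
  have h : vecBt q n = q ^ 2 • vecB q n - (q ^ 2 - 1) • (sig (Mrec q n) * strR q n) := by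
    rw [sig_Mrec_mul_strR hq]; abel
  have h' : Mrec q n * Rrec q n u (q ^ 4 * v) * (sig (Mrec q n) * strR q n) =
      Mrec q n * (Mrec q n * Rrec q n u (q ^ 4 * v) * strR q n) := by
    rw [← mul_assoc, mul_assoc (Mrec q n) (Rrec q n u _) (sig _), ← Mrec_mul_Rrec hq,
      mul_assoc (Mrec q n)]
  rw [vecAt_eq hq, sub_mul, smul_mul_assoc, smul_mul_assoc, mul_assoc, vecA_mul_Rrec hq n u v huv,
    strL_mul_Rrec hq n u v huv, h, mul_sub, mul_smul_comm, mul_smul_comm, h']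
  simp only [mul_add, mul_smul_comm, smul_add, mul_assoc]
  match_scalars <;> simp only [alpha, beta, div_eq_mul_inv] <;>
      generalize (q * v - q⁻¹ * u)⁻¹ = I <;> field_simp <;> ring

/-- `sig` fixes `Rrec` and reverses products, so each left exchange relation has a right one as its
mirror image; the next three lemmas arise in the same way. -/
lemma Rrec_mul_vecBt : Rrec q n u v * vecBt q n =
      (alpha q u v * q⁻¹) • (strL q n * Rrec q n u (q ^ 4 * v)) +
        (beta q u v * v) • (vecAt q n * (Mrec q n * Rrec q n u (q ^ 4 * v))) := by
  have h := congrArg sig (vecA_mul_Rrec hq n u v huv)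
  simpa only [sig_add, sig_mul, sig_smul, sig_Rrec hq, sig_vecA, sig_strR, sig_vecB,
    ← Mrec_mul_Rrec hq] using h

lemma Rrec_mul_strR : Rrec q n u v * strR q n =
      (beta q u v * u) • (strL q n * (Mrec q n * Rrec q n u (q ^ 4 * v))) +
        (q * alpha q u v) • (vecAt q n * Rrec q n u (q ^ 4 * v)) := by
  have h := congrArg sig (strL_mul_Rrec hq n u v huv)
  simpa only [sig_add, sig_mul, sig_smul, sig_Rrec hq, sig_strL, sig_strR, sig_vecB,
    ← Mrec_mul_Rrec hq] using h

lemma Rrec_mul_strR' : Rrec q n u v * strR q n =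
      (beta q u v * v) • (strL q n * (Mrec q n * Rrec q n u (q ^ 4 * v))) +
        (q⁻¹ * alpha q u v) • (vecA q n * Rrec q n u (q ^ 4 * v)) := by
  have h := congrArg sig (strL_mul_Rrec' hq n u v huv)
  simpa only [sig_add, sig_mul, sig_smul, sig_Rrec hq, sig_strL, sig_strR, sig_vecBt,
    ← Mrec_mul_Rrec hq] using h

lemma Rrec_mul_vecB : Rrec q n u v * vecB q n =
      (alpha q u v * q) • (strL q n * Rrec q n u (q ^ 4 * v)) +
        (beta q u v * u) • (vecA q n * (Mrec q n * Rrec q n u (q ^ 4 * v))) := by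
  have h := congrArg sig (vecAt_mul_Rrec hq n u v huv)
  simpa only [sig_add, sig_mul, sig_smul, sig_Rrec hq, sig_vecAt, sig_strR, sig_vecBt,
    ← Mrec_mul_Rrec hq] using h

end exchange

end

section

/-! ### Site operators in block form -/

/-- The parity operator. -/
def par (n : ℕ) : Op n := Matrix.diagonal fun c => (-1 : ℂ) ^ idxDeg c

lemma idxDeg_succ {n : ℕ} (c : Idx (n + 1)) :
    idxDeg c = idxDeg (idxInit c) + vecDeg (c (Fin.last n)) := by
  simp [idxDeg, Fin.sum_univ_castSucc]

lemma par_zero : par 0 = 1 := by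
  ext r c
  simp [par, Matrix.diagonal_apply, Matrix.one_apply, idxDeg]

lemma par_succ (n : ℕ) : par (n + 1) = b2 (par n) 0 0 (-par n) := by
  ext r s
  rcases Int.units_eq_one_or (r (Fin.last n)) with h | h <;>
    rcases Int.units_eq_one_or (s (Fin.last n)) with h' | h' <;>
    simp [b2, par, Matrix.diagonal_apply, idx_ext, h, h', idxDeg_succ, vecDeg, pow_succ]

lemma par_mul_par (n : ℕ) : par n * par n = 1 := by
  simp [par, ← mul_pow]

/-- The extension of an operator by the identity on a new last site. -/
def emb {n : ℕ} (A : Op n) : Op (n + 1) := b2 A 0 0 A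

lemma emb_mul {n : ℕ} (A B : Op n) : emb (A * B) = emb A * emb B := by
  simp [emb, b2_mul]

lemma emb_one {n : ℕ} : emb (1 : Op n) = 1 := b2_one

lemma emb_zero {n : ℕ} : emb (0 : Op n) = 0 := b2_zero

lemma emb_add {n : ℕ} (A B : Op n) : emb (A + B) = emb A + emb B := by
  simp [emb, b2_add]

lemma emb_smul {n : ℕ} (t : ℂ) (A : Op n) : emb (t • A) = t • emb A := by
  simp [emb, b2_smul]

lemma emb_inv {n : ℕ} {A : Op n} (hA : IsUnit A) : emb A⁻¹ = (emb A)⁻¹ := by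
  symm
  apply Matrix.inv_eq_right_inv
  rw [← emb_mul, Matrix.mul_nonsing_inv _ ((Matrix.isUnit_iff_isUnit_det A).1 hA), emb_one]

/-- The Koszul sign counts only the sites before `k`, so a new site at the end is not seen. -/
lemma locOp_castSucc {n : ℕ} (k : Fin n) (a b : ℤˣ) : locOp k.castSucc a b = emb (locOp k a b) := by
  ext r c
  have h1 : ∑ l ∈ Finset.Iio k.castSucc, vecDeg (c l) =
      ∑ l ∈ Finset.Iio k, vecDeg (idxInit c l) := by
    rw [← Fin.map_castSuccEmb_Iio, Finset.sum_map]; rfl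
  have h2 : r = Function.update c k.castSucc a ↔
      idxInit r = Function.update (idxInit c) k a ∧ r (Fin.last n) = c (Fin.last n) := by
    rw [idx_ext]
    have e1 : idxInit (Function.update c k.castSucc a) = Function.update (idxInit c) k a := by
      funext l
      by_cases h : l = k
      · subst h; simp [idxInit]
      · simp [idxInit, Function.update_of_ne h,
          Function.update_of_ne (fun h' => h (Fin.castSucc_injective _ h'))]
    have e2 : Function.update c k.castSucc a (Fin.last n) = c (Fin.last n) :=
      Function.update_of_ne (Fin.castSucc_lt_last k).ne' _ _
    rw [e1, e2]
  simp only [locOp, Matrix.of_apply, h1, h2, emb, b2]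
  rcases Int.units_eq_one_or (r (Fin.last n)) with h | h <;>
    rcases Int.units_eq_one_or (c (Fin.last n)) with h' | h' <;>
    simp [h, h']

lemma locOp_last {n : ℕ} (a b : ℤˣ) (r c : Idx (n + 1)) :
    locOp (Fin.last n) a b r c = if c (Fin.last n) = b ∧ r (Fin.last n) = a ∧
      idxInit r = idxInit c then (-1 : ℂ) ^ (unitDeg a b * idxDeg (idxInit c)) else 0 := by
  have h1 : ∑ l ∈ Finset.Iio (Fin.last n), vecDeg (c l) = idxDeg (idxInit c) := by
    rw [Fin.Iio_last_eq_map, Finset.sum_map]; rfl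
  have h2 : r = Function.update c (Fin.last n) a ↔
      r (Fin.last n) = a ∧ idxInit r = idxInit c := by
    rw [idx_ext]
    have e1 : idxInit (Function.update c (Fin.last n) a) = idxInit c := by
      funext l
      exact Function.update_of_ne (Fin.castSucc_lt_last l).ne _ _
    rw [e1, Function.update_self, and_comm]
  simp only [locOp, Matrix.of_apply, h1, h2]

section last
variable {n : ℕ}

lemma locOp_last_neg_neg : locOp (Fin.last n) (-1) (-1) = b2 1 0 0 0 := by
  ext r c
  rw [locOp_last]
  rcases Int.units_eq_one_or (r (Fin.last n)) with h | h <;>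
    rcases Int.units_eq_one_or (c (Fin.last n)) with h' | h' <;>
    simp [h, h', b2, unitDeg, Matrix.one_apply]

lemma locOp_last_one_one : locOp (Fin.last n) 1 1 = b2 0 0 0 1 := by
  ext r c
  rw [locOp_last]
  rcases Int.units_eq_one_or (r (Fin.last n)) with h | h <;>
    rcases Int.units_eq_one_or (c (Fin.last n)) with h' | h' <;>
    simp [h, h', b2, unitDeg, Matrix.one_apply]

/-- An odd unit on the last site passes all the earlier vectors; its Koszul sign is the parity
operator on those sites. -/
lemma locOp_last_neg_one : locOp (Fin.last n) (-1) 1 = b2 0 (par n) 0 0 := by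
  ext r c
  rw [locOp_last]
  rcases Int.units_eq_one_or (r (Fin.last n)) with h | h <;>
    rcases Int.units_eq_one_or (c (Fin.last n)) with h' | h' <;>
    simp +contextual [h, h', b2, unitDeg, par, Matrix.diagonal_apply]

lemma locOp_last_one_neg : locOp (Fin.last n) 1 (-1) = b2 0 0 (par n) 0 := by
  ext r c
  rw [locOp_last]
  rcases Int.units_eq_one_or (r (Fin.last n)) with h | h <;>
    rcases Int.units_eq_one_or (c (Fin.last n)) with h' | h' <;>
    simp +contextual [h, h', b2, unitDeg, par, Matrix.diagonal_apply]

lemma atSite_succ {i : ℤ} (hi : i ≠ n + 1) (a b : ℤˣ) :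
    atSite (n + 1) i a b = emb (atSite n i a b) := by
  by_cases h : 1 ≤ i ∧ i ≤ n
  · have h' : 1 ≤ i ∧ i ≤ ((n + 1 : ℕ) : ℤ) := by push_cast; omega
    rw [atSite, dif_pos h', atSite, dif_pos h, ← locOp_castSucc]
    rfl
  · have h' : ¬ (1 ≤ i ∧ i ≤ ((n + 1 : ℕ) : ℤ)) := by push_cast; omega
    rw [atSite, dif_neg h', atSite, dif_neg h, emb_zero]

lemma atSite_last (a b : ℤˣ) : atSite (n + 1) (n + 1) a b = locOp (Fin.last n) a b := by
  have h' : 1 ≤ ((n : ℤ) + 1) ∧ ((n : ℤ) + 1) ≤ ((n + 1 : ℕ) : ℤ) := by push_cast; omega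
  rw [atSite, dif_pos h']
  congr 1
  ext
  simp

end last

variable {q : ℂ} {n : ℕ}

lemma omegaPos_succ {i : ℤ} (hi : i ≠ n + 1) : omegaPos q (n + 1) i = emb (omegaPos q n i) := by
  simp only [omegaPos, atSite_succ hi, emb_add, emb_smul]

lemma omegaPos_last : omegaPos q (n + 1) (n + 1) = b2 1 0 0 ((q ^ 2)⁻¹ • 1) := by
  simp [omegaPos, atSite_last, locOp_last_neg_neg, locOp_last_one_one, b2_smul, b2_add]

lemma omegaPos_last_inv (hq : q ≠ 0) :
    (omegaPos q (n + 1) (n + 1))⁻¹ = b2 1 0 0 (q ^ 2 • 1) := by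
  apply Matrix.inv_eq_right_inv
  rw [omegaPos_last, b2_mul]
  simp [smul_smul, hq, b2_one]

lemma isUnit_omegaPos (hq : q ≠ 0) {i : ℤ} (h1 : 1 ≤ i) (h2 : i ≤ n) :
    IsUnit (omegaPos q n i) := by
  induction n with
  | zero => simp at h2; omega
  | succ n ih =>
    by_cases hi : i = n + 1
    · subst hi
      refine IsUnit.of_mul_eq_one (b2 1 0 0 (q ^ 2 • 1)) ?_
      rw [omegaPos_last, b2_mul]
      simp [smul_smul, hq, b2_one]
    · rw [omegaPos_succ hi]
      obtain ⟨y, hy⟩ := (ih (by push_cast at h2; omega)).exists_right_inv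
      refine IsUnit.of_mul_eq_one (emb y) ?_
      rw [← emb_mul, hy, emb_one]

lemma omegaPos_inv_succ (hq : q ≠ 0) {i : ℤ} (h1 : 1 ≤ i) (h2 : i ≤ n) :
    (omegaPos q (n + 1) i)⁻¹ = emb (omegaPos q n i)⁻¹ := by
  rw [omegaPos_succ (by omega), emb_inv (isUnit_omegaPos hq h1 h2)]

lemma omega_succ (hq : q ≠ 0) {i : ℤ} (h1 : -n ≤ i) (h2 : i ≤ n) :
    omega q (n + 1) i = emb (omega q n i) := by
  unfold omega
  split_ifs with h h'
  · rw [omegaPos_succ (by omega)]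
  · rw [emb_smul, emb_one]
  · rw [emb_smul, omegaPos_inv_succ hq (by omega) (by omega)]

lemma omega_last : omega q (n + 1) (n + 1) = b2 1 0 0 ((q ^ 2)⁻¹ • 1) := by
  rw [omega, if_pos (by omega), omegaPos_last]

lemma omega_neg_last (hq : q ≠ 0) :
    omega q (n + 1) (-(n + 1)) = b2 ((q ^ 2)⁻¹ • 1) 0 0 1 := by
  rw [omega, if_neg (by omega), if_neg (by omega), neg_neg, omegaPos_last_inv hq, b2_smul]
  simp [smul_smul, hq]

lemma isUnit_omega (hq : q ≠ 0) {i : ℤ} (h1 : -n ≤ i) (h2 : i ≤ n) : IsUnit (omega q n i) := by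
  unfold omega
  split_ifs with h h'
  · exact isUnit_omegaPos hq (by omega) h2
  · exact isUnit_one.smul (Units.mk0 q⁻¹ (inv_ne_zero hq))
  · have h3 := (isUnit_omegaPos (n := n) hq (i := -i) (by omega) (by omega))
    rw [Matrix.isUnit_iff_isUnit_det] at h3
    have : IsUnit (omegaPos q n (-i))⁻¹ := by
      rw [Matrix.isUnit_iff_isUnit_det]
      exact Matrix.isUnit_nonsing_inv_det _ h3
    exact this.smul (Units.mk0 (q ^ 2)⁻¹ (inv_ne_zero (pow_ne_zero 2 hq)))

lemma annih_succ {i : ℤ} (h1 : -n ≤ i) (h2 : i ≤ n) :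
    annih q (n + 1) i = emb (annih q n i) := by
  unfold annih
  split_ifs with h h'
  · rw [atSite_succ (by omega)]
  · rw [emb_smul, emb_one]
  · rw [emb_smul, atSite_succ (by omega)]

lemma creat_succ {i : ℤ} (h1 : -n ≤ i) (h2 : i ≤ n) :
    creat q (n + 1) i = emb (creat q n i) := by
  unfold creat
  split_ifs with h h'
  · rw [atSite_succ (by omega)]
  · rw [emb_smul, emb_one]
  · rw [emb_smul, atSite_succ (by omega)]

lemma annih_last : annih q (n + 1) (n + 1) = b2 0 (par n) 0 0 := by
  rw [annih, if_pos (by omega), atSite_last, locOp_last_neg_one]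

lemma creat_last : creat q (n + 1) (n + 1) = b2 0 0 (par n) 0 := by
  rw [creat, if_pos (by omega), atSite_last, locOp_last_one_neg]

lemma annih_neg_last : annih q (n + 1) (-(n + 1)) = b2 0 0 ((q ^ 2)⁻¹ • par n) 0 := by
  rw [annih, if_neg (by omega), if_neg (by omega), neg_neg, atSite_last, locOp_last_one_neg,
    b2_smul]
  simp

lemma creat_neg_last : creat q (n + 1) (-(n + 1)) = b2 0 (q ^ 2 • par n) 0 0 := by
  rw [creat, if_neg (by omega), if_neg (by omega), neg_neg, atSite_last, locOp_last_neg_one,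
    b2_smul]
  simp

end

section

/-! ### Factorization of the spinor representation -/

/-- The right factor of `π(ℓ^±_{ij})`. -/
def lo (q : ℂ) : (n : ℕ) → ℤ → Op n
  | 0, _ => (aZero q * q) • 1
  | n + 1, j => if j = n + 1 then b2 0 ((q ^ 2 * ((-q ^ 2) ^ (n + 1))⁻¹) • par n) 0 0
      else if j = -(n + 1) then b2 0 0 (((-1) ^ (n + 1) * q⁻¹) • par n) 0
      else b2 (lo q n j) 0 0 ((q ^ 2)⁻¹ • lo q n j)

/-- The left factor of `π(ℓ^±_{ij})`. -/
def up (q : ℂ) : (n : ℕ) → ℤ → Op n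
  | 0, _ => (-(aZero q * q ^ 2)) • 1
  | n + 1, i => if i = n + 1 then b2 0 0 ((-q ^ 2) ^ (n + 1) • par n) 0
      else if i = -(n + 1) then b2 0 (((-1) ^ (n + 1) * q ^ 3) • par n) 0 0
      else b2 (up q n i) 0 0 (q ^ 2 • up q n i)

/-- The ordered product of the `ω_t` with `t ≤ m`, up to normalization. -/
def gam (q : ℂ) : (n : ℕ) → ℤ → Op n
  | 0, m => if 0 ≤ m then 1 else q ^ (-2 * m - 1) • 1
  | n + 1, m => if -(n + 1) ≤ m ∧ m ≤ n then b2 (gam q n m) 0 0 (q ^ 2 • gam q n m)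
      else emb (gam q n m)

variable {q : ℂ} {n : ℕ}

lemma lo_last : lo q (n + 1) (n + 1) = b2 0 ((q ^ 2 * ((-q ^ 2) ^ (n + 1))⁻¹) • par n) 0 0 := by
  rw [lo, if_pos rfl]

lemma lo_neg_last : lo q (n + 1) (-(n + 1)) = b2 0 0 (((-1) ^ (n + 1) * q⁻¹) • par n) 0 := by
  rw [lo, if_neg (by omega), if_pos rfl]

lemma lo_succ {j : ℤ} (h1 : -n ≤ j) (h2 : j ≤ n) :
    lo q (n + 1) j = b2 (lo q n j) 0 0 ((q ^ 2)⁻¹ • lo q n j) := by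
  rw [lo, if_neg (by omega), if_neg (by omega)]

lemma up_last : up q (n + 1) (n + 1) = b2 0 0 ((-q ^ 2) ^ (n + 1) • par n) 0 := by
  rw [up, if_pos rfl]

lemma up_neg_last : up q (n + 1) (-(n + 1)) = b2 0 (((-1) ^ (n + 1) * q ^ 3) • par n) 0 0 := by
  rw [up, if_neg (by omega), if_pos rfl]

lemma up_succ {i : ℤ} (h1 : -n ≤ i) (h2 : i ≤ n) :
    up q (n + 1) i = b2 (up q n i) 0 0 (q ^ 2 • up q n i) := by
  rw [up, if_neg (by omega), if_neg (by omega)]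

lemma gam_succ {m : ℤ} (h1 : -(n + 1) ≤ m) (h2 : m ≤ n) :
    gam q (n + 1) m = b2 (gam q n m) 0 0 (q ^ 2 • gam q n m) := by
  rw [gam, if_pos ⟨h1, h2⟩]

lemma gam_of_ge {m : ℤ} (h : (n : ℤ) ≤ m) : gam q n m = 1 := by
  induction n with
  | zero => rw [gam, if_pos (by simpa using h)]
  | succ n ih =>
    push_cast at h
    rw [gam, if_neg (by omega), ih (by omega), emb_one]

/-- The normalization is forced: `ω_i ω_{-i} = q⁻²` and `ω_0 = q⁻¹` give the product of all `ω_t`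
with `-n ≤ t ≤ n` the value `q^{-(2n+1)}`. Starting from `q^{2n+1}` just below `-n`, the partial
products therefore end at `1`. -/
lemma gam_of_lt {m : ℤ} (h : m < -n) : gam q n m = q ^ (-2 * m - 1) • 1 := by
  induction n with
  | zero => rw [gam, if_neg (by simpa using h)]
  | succ n ih =>
    push_cast at h
    rw [gam, if_neg (by omega), ih (by omega), emb_smul, emb_one]

lemma gam_step (hq : q ≠ 0) {m : ℤ} (h1 : -n ≤ m) (h2 : m ≤ n) :
    gam q n m = omega q n m * gam q n (m - 1) := by
  induction n with
  | zero =>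
    obtain rfl : m = 0 := by simp at h1 h2; omega
    rw [gam_of_ge (by simp), gam_of_lt (by simp), omega]
    simp [smul_smul, hq]
  | succ n ih =>
    push_cast at h1 h2
    rcases lt_trichotomy m (n + 1) with h | rfl | h
    · rcases lt_trichotomy m (-(n + 1)) with h' | rfl | h'
      · omega
      · rw [gam_succ le_rfl (by omega), gam_of_lt (m := -((n : ℤ) + 1)) (by omega),
          gam_of_lt (by push_cast; omega), omega_neg_last hq, ← b2_one, b2_smul, b2_mul]
        simp only [smul_zero, mul_zero, zero_mul, add_zero, zero_add, smul_mul_assoc, one_mul,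
          smul_smul]
        have e : q ^ (-2 * (-((n : ℤ) + 1) - 1) - 1) = q ^ 2 * q ^ (-2 * -((n : ℤ) + 1) - 1) := by
          rw [← zpow_natCast q 2, ← zpow_add₀ hq]; congr 1; push_cast; ring
        rw [e, inv_mul_cancel_left₀ (pow_ne_zero 2 hq)]
      · rw [gam_succ (by omega) (by omega), gam_succ (by omega) (by omega),
          omega_succ hq (by omega) (by omega), emb, b2_mul, ih (by omega) (by omega)]
        simp
    · rw [gam_of_ge (by simp), add_sub_cancel_right, gam_succ (by omega) le_rfl,
        gam_of_ge le_rfl, omega_last, b2_mul]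
      simp [smul_smul, hq, b2_one]
    · omega

/-- The string `ω_{i-1} ⋯ ω_{j+1}` is `gam (i-1)` times the inverse of `gam j`. Absorbing the first
into the creation operator and the second into the annihilation operator separates the dependence on
`i` from that on `j`. The power of `-q²` takes up the prefactor of `π(ℓ^±_{ij})`. -/
lemma up_gam (hq : q ≠ 0) {i : ℤ} (h1 : -n ≤ i) (h2 : i ≤ n) :
    creat q n i * gam q n (i - 1) = (-q ^ 2) ^ (-i) • up q n i := by
  have hq2 : -q ^ 2 ≠ 0 := neg_ne_zero.2 (pow_ne_zero 2 hq)
  induction n with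
  | zero =>
    obtain rfl : i = 0 := by simp at h1 h2; omega
    rw [gam_of_lt (by simp), creat, up]
    simp [smul_smul]
    ring_nf
  | succ n ih =>
    push_cast at h1 h2
    rcases lt_trichotomy i (n + 1) with h | rfl | h
    · rcases lt_trichotomy i (-(n + 1)) with h' | rfl | h'
      · omega
      · rw [up_neg_last, gam_of_lt (by push_cast; omega), creat_neg_last, mul_smul_comm, mul_one,
          b2_smul, b2_smul]
        simp only [smul_zero, smul_smul]
        congr 2
        rw [neg_neg, show ((n : ℤ) + 1) = ((n + 1 : ℕ) : ℤ) by push_cast; rfl, zpow_natCast,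
          show -2 * (-((n + 1 : ℕ) : ℤ) - 1) - 1 = ((2 * n + 3 : ℕ) : ℤ) by push_cast; ring,
          zpow_natCast, neg_pow (q ^ 2), mul_mul_mul_comm, ← mul_pow]
        norm_num
        ring
      · rw [gam_succ (by omega) (by omega), creat_succ (by omega) (by omega),
          up_succ (by omega) (by omega), emb, b2_mul, b2_smul]
        simp only [ih (by omega) (by omega), mul_zero, zero_mul, add_zero, zero_add, smul_zero,
          mul_smul_comm, smul_comm (q ^ 2)]
    · rw [add_sub_cancel_right, gam_succ (by omega) le_rfl, gam_of_ge le_rfl, creat_last, up_last,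
        b2_mul, b2_smul]
      rw [zpow_neg, show ((n : ℤ) + 1) = ((n + 1 : ℕ) : ℤ) by push_cast; rfl, zpow_natCast]
      simp [smul_smul, hq]
    · omega

lemma up_gam' (hq : q ≠ 0) {i : ℤ} (h1 : -n ≤ i) (h2 : i ≤ n) :
    omega q n i * creat q n i * gam q n i = ((q ^ 2)⁻¹ * (-q ^ 2) ^ (-i)) • up q n i := by
  have hq2 : -q ^ 2 ≠ 0 := neg_ne_zero.2 (pow_ne_zero 2 hq)
  -- A relation on a single site. It trades the two outer `ω_i` for a scalar and so reduces the
  -- claim to `up_gam`.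
  have key : omega q n i * creat q n i * omega q n i = (q ^ 2)⁻¹ • creat q n i := by
    clear hq2
    induction n with
    | zero =>
      obtain rfl : i = 0 := by simp at h1 h2; omega
      simp [omega, creat, smul_smul]
      ring_nf
    | succ n ih =>
      push_cast at h1 h2
      rcases lt_trichotomy i (n + 1) with h | rfl | h
      · rcases lt_trichotomy i (-(n + 1)) with h' | rfl | h'
        · omega
        · rw [omega_neg_last hq, creat_neg_last, b2_mul, b2_mul, b2_smul]
          simp [smul_smul, mul_comm]
        · rw [omega_succ hq (by omega) (by omega), creat_succ (by omega) (by omega), ← emb_mul,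
            ← emb_mul, ih (by omega) (by omega), emb_smul]
      · rw [omega_last, creat_last, b2_mul, b2_mul, b2_smul]
        simp
      · omega
  rw [gam_step hq h1 h2, ← mul_assoc, key, smul_mul_assoc, up_gam hq h1 h2, smul_smul]

lemma gam_lo (hq : q ≠ 0) {j : ℤ} (h1 : -n ≤ j) (h2 : j ≤ n) :
    gam q n (j - 1) * lo q n j = (q ^ 2 * (-q ^ 2) ^ (-j)) • annih q n j := by
  have hq2 : -q ^ 2 ≠ 0 := neg_ne_zero.2 (pow_ne_zero 2 hq)
  induction n with
  | zero =>
    obtain rfl : j = 0 := by simp at h1 h2; omega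
    rw [gam_of_lt (by simp), annih, lo]
    simp [smul_smul]
    ring_nf
  | succ n ih =>
    push_cast at h1 h2
    rcases lt_trichotomy j (n + 1) with h | rfl | h
    · rcases lt_trichotomy j (-(n + 1)) with h' | rfl | h'
      · omega
      · rw [lo_neg_last, gam_of_lt (by push_cast; omega), annih_neg_last, smul_mul_assoc, one_mul,
          b2_smul, b2_smul]
        simp only [smul_zero, smul_smul]
        congr 2
        rw [neg_neg, show ((n : ℤ) + 1) = ((n + 1 : ℕ) : ℤ) by push_cast; rfl, zpow_natCast,
          show -2 * (-((n + 1 : ℕ) : ℤ) - 1) - 1 = ((2 * n + 3 : ℕ) : ℤ) by push_cast; ring,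
          zpow_natCast, neg_pow (q ^ 2)]
        field_simp
        ring
      · rw [gam_succ (by omega) (by omega), annih_succ (by omega) (by omega),
          lo_succ (by omega) (by omega), emb, b2_mul, b2_smul]
        simp [ih (by omega) (by omega), smul_smul, hq]
    · rw [add_sub_cancel_right, gam_succ (by omega) le_rfl, gam_of_ge le_rfl, annih_last, lo_last,
        b2_mul, b2_smul]
      rw [zpow_neg, show ((n : ℤ) + 1) = ((n + 1 : ℕ) : ℤ) by push_cast; rfl, zpow_natCast]
      simp
    · omega

lemma gam_lo' (hq : q ≠ 0) {j : ℤ} (h1 : -n ≤ j) (h2 : j ≤ n) :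
    gam q n j * lo q n j = (-q ^ 2) ^ (-j) • (annih q n j * (omega q n j)⁻¹) := by
  have key : omega q n j * annih q n j * omega q n j = (q ^ 2)⁻¹ • annih q n j := by
    induction n with
    | zero =>
      obtain rfl : j = 0 := by simp at h1 h2; omega
      simp [omega, annih, smul_smul]
      ring_nf
    | succ n ih =>
      push_cast at h1 h2
      rcases lt_trichotomy j (n + 1) with h | rfl | h
      · rcases lt_trichotomy j (-(n + 1)) with h' | rfl | h'
        · omega
        · rw [omega_neg_last hq, annih_neg_last, b2_mul, b2_mul, b2_smul]
          simp
        · rw [omega_succ hq (by omega) (by omega), annih_succ (by omega) (by omega), ← emb_mul,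
            ← emb_mul, ih (by omega) (by omega), emb_smul]
      · rw [omega_last, annih_last, b2_mul, b2_mul, b2_smul]
        simp
      · omega
  have hu := (Matrix.isUnit_iff_isUnit_det _).1 (isUnit_omega hq h1 h2)
  have key' : omega q n j * annih q n j = (q ^ 2)⁻¹ • (annih q n j * (omega q n j)⁻¹) := by
    rw [← smul_mul_assoc, ← key, Matrix.mul_nonsing_inv_cancel_right _ _ hu]
  rw [gam_step hq h1 h2, mul_assoc, gam_lo hq h1 h2, mul_smul_comm, key', smul_smul]
  congr 1
  field_simp

/-- Each `ω` of the string moves the partial product up by one index. -/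
lemma string_gam (hq : q ≠ 0) {i : ℤ} (h2 : i - 1 ≤ n) (m : ℕ) (h1 : -n ≤ i - m) :
    ((List.range m).map fun t : ℕ => omega q n (i - 1 - t)).prod * gam q n (i - 1 - m) =
      gam q n (i - 1) := by
  induction m with
  | zero => simp
  | succ m ih =>
    push_cast at h1
    rw [List.range_succ, List.map_append, List.prod_append, List.map_singleton,
      List.prod_singleton, mul_assoc, show i - 1 - ((m + 1 : ℕ) : ℤ) = i - 1 - m - 1 by
        push_cast; ring, ← gam_step hq (by omega) (by omega), ih (by omega)]

lemma string_gam' (hq : q ≠ 0) {i : ℤ} (h1 : -n ≤ i) (m : ℕ) (h2 : i + m ≤ n) :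
    ((List.range m).map fun t : ℕ => (omega q n (i + 1 + t))⁻¹).prod * gam q n (i + m) =
      gam q n i := by
  induction m with
  | zero => simp
  | succ m ih =>
    push_cast at h2
    have hu := (Matrix.isUnit_iff_isUnit_det _).1
      (isUnit_omega (q := q) (n := n) hq (i := i + 1 + m) (by omega) (by omega))
    rw [List.range_succ, List.map_append, List.prod_append, List.map_singleton,
      List.prod_singleton, mul_assoc, show i + ((m + 1 : ℕ) : ℤ) = i + 1 + m by
        push_cast; ring, gam_step hq (by omega) (by omega), Matrix.nonsing_inv_mul_cancel_left _ _ hu,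
        show i + 1 + (m : ℤ) - 1 = i + m by ring, ih (by omega)]

/-- The scalar in the factorization of `π(ℓ⁻_{ij})`. -/
def kap (q : ℂ) : ℂ := (q ^ 3)⁻¹ * (q ^ 2 - (q ^ 2)⁻¹)

/-- The prefactor of `π(ℓ^±_{ij})` is the inverse of the normalizations of `up_i` and `lo_j`, so
only a constant independent of `i` and `j` survives. -/
lemma neg_one_zpow_mul (hq : q ≠ 0) (i j : ℤ) :
    (-1 : ℂ) ^ (i + j) * q ^ (2 * (i - j)) * (-q ^ 2) ^ j * (-q ^ 2) ^ (-i) = 1 := by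
  have h : (-q ^ 2 : ℂ) = (-1) * q ^ (2 : ℤ) := by rw [neg_one_mul]; norm_cast
  have e1 : (-1 : ℂ) ^ (i + j) * (-1) ^ j * (-1) ^ (-i) = 1 := by
    rw [← zpow_add₀ (by norm_num), ← zpow_add₀ (by norm_num),
      show i + j + j + -i = 2 * j by ring, zpow_mul]
    norm_num
  have e2 : q ^ (2 * (i - j)) * (q ^ (2 : ℤ)) ^ j * (q ^ (2 : ℤ)) ^ (-i) = 1 := by
    rw [← zpow_mul, ← zpow_mul, ← zpow_add₀ hq, ← zpow_add₀ hq]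
    rw [show 2 * (i - j) + 2 * j + 2 * -i = 0 by ring, zpow_zero]
  rw [h, mul_zpow, mul_zpow]
  linear_combination (q ^ (2 * (i - j)) * (q ^ (2 : ℤ)) ^ j * (q ^ (2 : ℤ)) ^ (-i)) * e1 + e2

lemma spinMinus_eq (hq : q ≠ 0) {i j : ℤ} (hi : i ≤ n) (hj : -n ≤ j) (hij : j < i)
    (hne : i ≠ -j) : spinMinus q n i j = kap q • (up q n i * lo q n j) := by
  have hq2 : -q ^ 2 ≠ 0 := neg_ne_zero.2 (pow_ne_zero 2 hq)
  have h1 := gam_lo' (q := q) (n := n) hq (j := j) hj (by omega)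
  have h1' : annih q n j * (omega q n j)⁻¹ = (-q ^ 2) ^ j • (gam q n j * lo q n j) := by
    rw [h1, smul_smul, zpow_neg, mul_inv_cancel₀ (zpow_ne_zero _ hq2), one_smul]
  have h2 := string_gam (q := q) (n := n) hq (i := i) (by omega) (i - j - 1).toNat (by omega)
  rw [show i - 1 - ((i - j - 1).toNat : ℤ) = j by omega] at h2
  rw [spinMinus, if_neg hij.ne', if_neg hne, if_pos hij, mul_assoc (_ * _) (annih q n j), h1']
  -- The string runs over a list of naturals read as integers; here it becomes a map over naturals,
  -- the form used in `string_gam`.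
  simp only [bind_pure_comp, List.map_eq_map, List.map_map, Function.comp_def]
  rw [mul_smul_comm, mul_assoc (creat q n i), ← mul_assoc (List.prod _), h2, ← mul_assoc,
    up_gam hq (by omega) hi, smul_mul_assoc, smul_smul, smul_smul]
  congr 1
  have h3 : q ^ (2 * (i - j) - 3) = q ^ (2 * (i - j)) * (q ^ 3)⁻¹ := by
    rw [zpow_sub₀ hq, div_eq_mul_inv]; norm_cast
  rw [h3]
  linear_combination (norm := skip) kap q * neg_one_zpow_mul hq i j
  rw [kap]
  ring

lemma spinPlus_eq (hq : q ≠ 0) {i j : ℤ} (hi : -n ≤ i) (hj : j ≤ n) (hij : i < j)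
    (hne : i ≠ -j) : spinPlus q n i j = (-q ^ 2 * kap q) • (up q n i * lo q n j) := by
  have hq2 : -q ^ 2 ≠ 0 := neg_ne_zero.2 (pow_ne_zero 2 hq)
  have h1 := gam_lo (q := q) (n := n) hq (j := j) (by omega) (by omega)
  have h1' : annih q n j = ((q ^ 2)⁻¹ * (-q ^ 2) ^ j) • (gam q n (j - 1) * lo q n j) := by
    rw [h1, smul_smul, zpow_neg, mul_mul_mul_comm, inv_mul_cancel₀ (pow_ne_zero 2 hq),
      mul_inv_cancel₀ (zpow_ne_zero _ hq2), one_mul, one_smul]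
  have h2 := string_gam' (q := q) (n := n) hq (i := i) (by omega) (j - i - 1).toNat (by omega)
  rw [show i + ((j - i - 1).toNat : ℤ) = j - 1 by omega] at h2
  rw [spinPlus, if_neg hij.ne, if_neg hne, if_pos hij, h1']
  simp only [bind_pure_comp, List.map_eq_map, List.map_map, Function.comp_def]
  rw [mul_smul_comm, mul_assoc (_ * creat q n i), ← mul_assoc (List.prod _), h2, ← mul_assoc,
    up_gam' hq (by omega) (by omega), smul_mul_assoc, smul_smul, smul_smul]
  congr 1
  have h3 : q ^ (2 * (i - j) + 3) = q ^ (2 * (i - j)) * q ^ 3 := by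
    rw [zpow_add₀ hq]; norm_cast
  rw [h3]
  linear_combination (norm := skip) (-q ^ 2 * kap q) * neg_one_zpow_mul hq i j
  rw [kap]
  field_simp
  ring

end

section

/-! ### The matrices `L^±` of the spinor representation -/

/-- The diagonal operators `π(ℓ⁻_{ii})`. -/
def dgm (q : ℂ) : (n : ℕ) → ℤ → Op n
  | 0, _ => 1
  | n + 1, i => if i = n + 1 then b2 (q⁻¹ • 1) 0 0 (q • 1)
      else if i = -(n + 1) then b2 (q • 1) 0 0 (q⁻¹ • 1) else emb (dgm q n i)

/-- The diagonal operators `π(ℓ⁺_{ii})`. -/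
def dgp (q : ℂ) : (n : ℕ) → ℤ → Op n
  | 0, _ => 1
  | n + 1, i => if i = n + 1 then b2 (q • 1) 0 0 (q⁻¹ • 1)
      else if i = -(n + 1) then b2 (q⁻¹ • 1) 0 0 (q • 1) else emb (dgp q n i)

/-- The matrix of the `π(ℓ⁻_{ij})`. -/
def Lm (q : ℂ) (n : ℕ) (i j : ℤ) : Op n :=
  if i = j then dgm q n i else if j < i then kap q • (up q n i * lo q n j) else 0

/-- The matrix of the `π(ℓ⁺_{ij})`. -/
def Lp (q : ℂ) (n : ℕ) (i j : ℤ) : Op n :=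
  if i = j then dgp q n i else if i < j then (-q ^ 2 * kap q) • (up q n i * lo q n j) else 0

variable {q : ℂ} {n : ℕ}

lemma dgm_last : dgm q (n + 1) (n + 1) = b2 (q⁻¹ • 1) 0 0 (q • 1) := by rw [dgm, if_pos rfl]

lemma dgm_neg_last : dgm q (n + 1) (-(n + 1)) = b2 (q • 1) 0 0 (q⁻¹ • 1) := by
  rw [dgm, if_neg (by omega), if_pos rfl]

lemma dgm_succ {i : ℤ} (h1 : -n ≤ i) (h2 : i ≤ n) : dgm q (n + 1) i = emb (dgm q n i) := by
  rw [dgm, if_neg (by omega), if_neg (by omega)]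

lemma dgp_last : dgp q (n + 1) (n + 1) = b2 (q • 1) 0 0 (q⁻¹ • 1) := by rw [dgp, if_pos rfl]

lemma dgp_neg_last : dgp q (n + 1) (-(n + 1)) = b2 (q⁻¹ • 1) 0 0 (q • 1) := by
  rw [dgp, if_neg (by omega), if_pos rfl]

lemma dgp_succ {i : ℤ} (h1 : -n ≤ i) (h2 : i ≤ n) : dgp q (n + 1) i = emb (dgp q n i) := by
  rw [dgp, if_neg (by omega), if_neg (by omega)]

lemma dgm_zero (n : ℕ) : dgm q n 0 = 1 := by
  induction n with
  | zero => rfl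
  | succ n ih => rw [dgm_succ (by omega) (by omega), ih, emb_one]

lemma dgp_zero (n : ℕ) : dgp q n 0 = 1 := by
  induction n with
  | zero => rfl
  | succ n ih => rw [dgp_succ (by omega) (by omega), ih, emb_one]

lemma dgm_mul_dgp (hq : q ≠ 0) (n : ℕ) (i : ℤ) : dgm q n i * dgp q n i = 1 := by
  induction n with
  | zero => exact one_mul 1
  | succ n ih =>
    unfold dgm dgp
    split_ifs
    · simp [b2_mul, smul_smul, hq, b2_one]
    · simp [b2_mul, smul_smul, hq, b2_one]
    · rw [← emb_mul, ih, emb_one]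

lemma dgp_mul_dgm (hq : q ≠ 0) (n : ℕ) (i : ℤ) : dgp q n i * dgm q n i = 1 :=
  mul_eq_one_comm.1 (dgm_mul_dgp hq n i)

lemma spinMinus_diag (hq : q ≠ 0) {i : ℤ} (h1 : -n ≤ i) (h2 : i ≤ n) :
    spinMinus q n i i = dgm q n i := by
  rw [spinMinus, if_pos rfl]
  induction n with
  | zero =>
    obtain rfl : i = 0 := by simp at h1 h2; omega
    simp [dgm]
  | succ n ih =>
    push_cast at h1 h2
    rcases lt_trichotomy i (n + 1) with h | rfl | h
    · rcases lt_trichotomy i (-(n + 1)) with h' | rfl | h'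
      · omega
      · rw [if_neg (by omega), if_neg (by omega), neg_neg, omega_last, dgm_neg_last, b2_smul]
        simp only [smul_zero, smul_smul]
        congr 2
        field_simp
      · rw [dgm_succ (by omega) (by omega), ← ih (by omega) (by omega)]
        split_ifs with h0 h3
        · exact emb_one.symm
        · rw [omega_succ hq (by omega) (by omega), emb_smul,
            emb_inv (isUnit_omega hq (by omega) (by omega))]
        · rw [omega_succ hq (by omega) (by omega), emb_smul]
    · rw [if_neg (by omega), if_pos (by omega), omega, if_pos (by omega), omegaPos_last_inv hq,
        dgm_last, b2_smul]
      simp only [smul_zero, smul_smul]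
      congr 2
      field_simp
    · omega

lemma spinPlus_diag (hq : q ≠ 0) {i : ℤ} (h1 : -n ≤ i) (h2 : i ≤ n) :
    spinPlus q n i i = dgp q n i := by
  rw [spinPlus, if_pos rfl]
  induction n with
  | zero =>
    obtain rfl : i = 0 := by simp at h1 h2; omega
    simp [dgp]
  | succ n ih =>
    push_cast at h1 h2
    rcases lt_trichotomy i (n + 1) with h | rfl | h
    · rcases lt_trichotomy i (-(n + 1)) with h' | rfl | h'
      · omega
      · rw [if_neg (by omega), if_neg (by omega), neg_neg, omega, if_pos (by omega),
          omegaPos_last_inv hq, dgp_neg_last, b2_smul]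
        simp only [smul_zero, smul_smul]
        congr 2
        field_simp
      · rw [dgp_succ (by omega) (by omega), ← ih (by omega) (by omega)]
        split_ifs with h0 h3
        · exact emb_one.symm
        · rw [omega_succ hq (by omega) (by omega), emb_smul]
        · rw [omega_succ hq (by omega) (by omega), emb_smul,
            emb_inv (isUnit_omega hq (by omega) (by omega))]
    · rw [if_neg (by omega), if_pos (by omega), omega_last, dgp_last, b2_smul]
      simp only [smul_zero, smul_smul]
      congr 2
      field_simp
    · omega

/-- Both factors change the entry of the same site in the same direction. Hence the convention
`π(ℓ^±_{i,-i}) = 0` for `i ≠ 0` agrees with the factorized formula and needs no separate treatment.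
-/
lemma up_mul_lo_neg {i : ℤ} (hi : i ≠ 0) (h1 : -n ≤ i) (h2 : i ≤ n) :
    up q n i * lo q n (-i) = 0 := by
  induction n with
  | zero => simp at h1 h2; omega
  | succ n ih =>
    push_cast at h1 h2
    rcases lt_trichotomy i (n + 1) with h | rfl | h
    · rcases lt_trichotomy i (-(n + 1)) with h' | rfl | h'
      · omega
      · rw [neg_neg, up_neg_last, lo_last, b2_mul]
        simp [b2_zero]
      · rw [up_succ (by omega) (by omega), lo_succ (by omega) (by omega), b2_mul]
        simp [ih (by omega) (by omega), b2_zero]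
    · rw [up_last, lo_neg_last, b2_mul]
      simp [b2_zero]
    · omega

lemma spinMinus_eq_Lm (hq : q ≠ 0) {i j : ℤ} (hi1 : -n ≤ i) (hi2 : i ≤ n) (hj1 : -n ≤ j)
    (hj2 : j ≤ n) : spinMinus q n i j = Lm q n i j := by
  rw [Lm]
  split_ifs with h h'
  · subst h; exact spinMinus_diag hq hi1 hi2
  · by_cases hne : i = -j
    · obtain rfl : j = -i := by omega
      rw [up_mul_lo_neg (by omega) hi1 hi2, smul_zero, spinMinus, if_neg h, if_pos hne]
    · exact spinMinus_eq hq hi2 hj1 h' hne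
  · rw [spinMinus, if_neg h, if_neg h']
    split_ifs <;> rfl

lemma spinPlus_eq_Lp (hq : q ≠ 0) {i j : ℤ} (hi1 : -n ≤ i) (hi2 : i ≤ n) (hj1 : -n ≤ j)
    (hj2 : j ≤ n) : spinPlus q n i j = Lp q n i j := by
  rw [Lp]
  split_ifs with h h'
  · subst h; exact spinPlus_diag hq hi1 hi2
  · by_cases hne : i = -j
    · obtain rfl : j = -i := by omega
      rw [up_mul_lo_neg (by omega) hi1 hi2, smul_zero, spinPlus, if_neg h, if_pos hne]
    · exact spinPlus_eq hq hi1 hj2 h' hne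
  · rw [spinPlus, if_neg h, if_neg h']
    split_ifs <;> rfl

/-- The factors `up_0` and `lo_0` both contain `a_0`; through its square, the choice of the root
drops out of this relation. -/
lemma aZero_sq (h : 1 + q ^ 2 ≠ 0) : aZero q ^ 2 * (1 + q ^ 2) = -1 := by
  have h' : -1 - q ^ 2 ≠ 0 := fun h0 => h (by linear_combination -h0)
  have e : aZero q ^ 2 = (-1 - q ^ 2)⁻¹ := by
    rw [aZero, ← Complex.cpow_nat_mul]
    norm_num
    rw [Complex.cpow_neg_one]
  rw [e]
  field_simp
  ring

/-- The diagonal case of the rank-one relation between `L⁺` and `L⁻`. At `i = 0` both diagonal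
operators are `1`, and the relation holds because of the value of `a_0²`. -/
lemma dgp_eq (hq : q ≠ 0) (h1q : 1 + q ^ 2 ≠ 0) {i : ℤ} (h1 : -n ≤ i) (h2 : i ≤ n) :
    dgp q n i = q ^ 2 • dgm q n i - (q ^ 2 * kap q) • (up q n i * lo q n i) := by
  induction n with
  | zero =>
    have h := aZero_sq h1q
    simp only [dgp, dgm, up, lo, kap, smul_mul_smul_comm, mul_one, smul_smul]
    rw [← sub_smul]
    nth_rewrite 1 [← one_smul ℂ (1 : Op 0)]
    congr 1
    field_simp
    linear_combination -(q ^ 2 - 1) * h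
  | succ n ih =>
    push_cast at h1 h2
    rcases lt_trichotomy i (n + 1) with h | rfl | h
    · rcases lt_trichotomy i (-(n + 1)) with h' | rfl | h'
      · omega
      · rw [up_neg_last, lo_neg_last, dgp_neg_last, dgm_neg_last, b2_mul, b2_smul, b2_smul, b2_sub]
        simp only [smul_mul_smul_comm, par_mul_par, smul_zero, mul_zero, zero_mul, add_zero,
          sub_zero, kap]
        have e : ((-1 : ℂ) ^ (n + 1) * q ^ 3) * ((-1) ^ (n + 1) * q⁻¹) = q ^ 2 := by
          have : ((-1 : ℂ) ^ (n + 1)) * (-1) ^ (n + 1) = 1 := by rw [← mul_pow]; norm_num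
          field_simp
          linear_combination this
        rw [e]
        congr 1 <;> match_scalars <;> field_simp <;> ring
      · rw [dgp_succ (by omega) (by omega), dgm_succ (by omega) (by omega),
          up_succ (by omega) (by omega), lo_succ (by omega) (by omega), b2_mul, b2_smul,
          ih (by omega) (by omega), emb, emb, b2_smul, b2_sub]
        simp [smul_smul, hq]
    · rw [up_last, lo_last, dgp_last, dgm_last, b2_mul, b2_smul, b2_smul, b2_sub]
      simp only [smul_mul_smul_comm, par_mul_par, smul_zero, mul_zero, zero_mul, add_zero,
          sub_zero, kap]
      have e : (-q ^ 2 : ℂ) ^ (n + 1) * (q ^ 2 * ((-q ^ 2) ^ (n + 1))⁻¹) = q ^ 2 := by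
        have : (-q ^ 2 : ℂ) ^ (n + 1) ≠ 0 := pow_ne_zero _ (neg_ne_zero.2 (pow_ne_zero 2 hq))
        field_simp
      rw [e]
      congr 1 <;> match_scalars <;> field_simp <;> ring
    · omega

/-- Off the diagonal one of the two matrices vanishes and the other is the factorized term; on the
diagonal this is `dgp_eq`. The relation transfers covariance between the two triangular matrices. -/
lemma Lp_eq (hq : q ≠ 0) (h1q : 1 + q ^ 2 ≠ 0) {i : ℤ} (h1 : -n ≤ i) (h2 : i ≤ n) (j : ℤ) :
    Lp q n i j = q ^ 2 • Lm q n i j - (q ^ 2 * kap q) • (up q n i * lo q n j) := by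
  rw [Lp, Lm]
  split_ifs with h h' h'' h''
  · subst h; exact dgp_eq hq h1q h1 h2
  · omega
  · module
  · rw [smul_smul, sub_self]
  · omega

/-! ### Products and their defects -/

/-- The sum over the range of the indices of the vector representation. -/
def pr {n : ℕ} (f g : ℤ → ℤ → Op n) (i j : ℤ) : Op₂ n :=
  ∑ k ∈ Finset.Icc (-(n : ℤ)) n, f i k ⊗ₖ g k j

/-- The opposite product. -/
def opr {n : ℕ} (f g : ℤ → ℤ → Op n) (i j : ℤ) : Op₂ n :=
  ∑ k ∈ Finset.Icc (-(n : ℤ)) n, f k j ⊗ₖ g i k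

/-- The failure of `X` to intertwine `pr f g i j` and `opr f g i j`, bilinear in `f` and `g`. -/
def dfct {n : ℕ} (X : Op₂ n) (i j : ℤ) :
    (ℤ → ℤ → Op n) →ₗ[ℂ] (ℤ → ℤ → Op n) →ₗ[ℂ] Op₂ n :=
  LinearMap.mk₂ ℂ (fun f g => opr f g i j * X - X * pr f g i j)
    (fun f f' g => by
      simp only [opr, pr, Pi.add_apply, Matrix.add_kronecker, Finset.sum_add_distrib, mul_add,
        add_mul]; abel)
    (fun c f g => by
      simp only [opr, pr, Pi.smul_apply, Matrix.smul_kronecker, ← Finset.smul_sum,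
        mul_smul_comm, smul_mul_assoc, smul_sub])
    (fun f g g' => by
      simp only [opr, pr, Pi.add_apply, Matrix.kronecker_add, Finset.sum_add_distrib, mul_add,
        add_mul]; abel)
    (fun c f g => by
      simp only [opr, pr, Pi.smul_apply, Matrix.kronecker_smul, ← Finset.smul_sum,
        mul_smul_comm, smul_mul_assoc, smul_sub])

lemma dfct_apply {X : Op₂ n} {i j : ℤ} (f g : ℤ → ℤ → Op n) :
    dfct X i j f g = opr f g i j * X - X * pr f g i j := rfl

lemma dfct_congr {X : Op₂ n} {i j : ℤ} (hi : i ∈ Finset.Icc (-(n : ℤ)) n)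
    (hj : j ∈ Finset.Icc (-(n : ℤ)) n) {f f' g g' : ℤ → ℤ → Op n}
    (hf : ∀ i ∈ Finset.Icc (-(n : ℤ)) n, ∀ j ∈ Finset.Icc (-(n : ℤ)) n, f i j = f' i j)
    (hg : ∀ i ∈ Finset.Icc (-(n : ℤ)) n, ∀ j ∈ Finset.Icc (-(n : ℤ)) n, g i j = g' i j) :
    dfct X i j f g = dfct X i j f' g' := by
  rw [dfct_apply, dfct_apply, opr, opr, pr, pr,
    Finset.sum_congr rfl fun k hk => by rw [hf k hk j hj, hg i hi k hk],
    Finset.sum_congr (f := fun k => f i k ⊗ₖ g k j) rfl fun k hk => by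
      rw [hf i hi k hk, hg k hk j hj]]

/-- Since `B P P` and `B M M` vanish and `B M P` is a multiple of `B P M`, every summand is a scalar
multiple of `B P M`, and these scalars telescope along the antidiagonal. -/
lemma sum_antidiagonal_eq_zero {F V : Type*} [AddCommGroup F] [Module ℂ F] [AddCommGroup V]
    [Module ℂ V] (B : F →ₗ[ℂ] F →ₗ[ℂ] V) (P M : F) {u v : ℂ} (hu : u ≠ 0) (hv : v ≠ 0)
    (hP : B P P = 0) (hM : B M M = 0) (h : v • B P M + u • B M P = 0) (e : ℂ → ℕ → F)
    (he0 : ∀ ρ, e ρ 0 = P) (he : ∀ ρ r, e ρ (r + 1) = (ρ ^ (r + 1))⁻¹ • (P - M)) (r : ℕ) :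
    ∑ ab ∈ Finset.HasAntidiagonal.antidiagonal r, B (e v ab.1) (e u ab.2) = 0 := by
  have hMP : B M P = (-(v * u⁻¹)) • B P M := by
    have : u⁻¹ • (v • B P M + u • B M P) = 0 := by rw [h, smul_zero]
    rw [smul_add, smul_smul, smul_smul, inv_mul_cancel₀ hu, one_smul] at this
    rw [eq_neg_of_add_eq_zero_right this, neg_smul, mul_comm]
  -- The two halves of the telescoping coefficient: `F' (a+1, b) = G' (a, b+1)`, while `F'` vanishes
  -- for `a = 0` and `G'` for `b = 0`.
  set F' : ℕ × ℕ → ℂ := fun ab => if ab.1 = 0 then 0 else (v ^ (ab.1 - 1))⁻¹ * (u ^ (ab.2 + 1))⁻¹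
  set G' : ℕ × ℕ → ℂ := fun ab => if ab.2 = 0 then 0 else (v ^ ab.1)⁻¹ * (u ^ ab.2)⁻¹
  have key : ∀ ab : ℕ × ℕ, B (e v ab.1) (e u ab.2) = (F' ab - G' ab) • B P M := by
    rintro ⟨a, b⟩
    rcases a with _ | a <;> rcases b with _ | b
    · simp [he0, hP, F', G']
    · simp only [he0, he, map_smul, map_sub, hP, zero_sub, F', G', if_true, if_neg b.succ_ne_zero]
      simp
    · simp only [he0, he, map_smul, map_sub, hP, zero_sub, F', G', if_true, if_neg a.succ_ne_zero,
        LinearMap.smul_apply, LinearMap.sub_apply, hMP]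
      match_scalars
      simp only [Nat.add_sub_cancel]
      field_simp
      ring
    · simp only [he, map_smul, map_sub, hP, hM, zero_sub, F', G', if_neg b.succ_ne_zero,
        if_neg a.succ_ne_zero, LinearMap.smul_apply, LinearMap.sub_apply, hMP]
      match_scalars
      simp only [Nat.add_sub_cancel]
      field_simp
      ring
  rw [Finset.sum_congr rfl fun ab _ => key ab, ← Finset.sum_smul]
  suffices h0 : ∑ ab ∈ Finset.HasAntidiagonal.antidiagonal r, (F' ab - G' ab) = 0 by
    rw [h0, zero_smul]
  rcases r with _ | r
  · simp [F', G']
  · rw [Finset.sum_sub_distrib, Finset.Nat.sum_antidiagonal_succ,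
      Finset.Nat.sum_antidiagonal_succ']
    simp [F', G']

/-- Compatibility with the finite-type generators `ℓ^±_{ij}[0]`. -/
def IsFT (q : ℂ) (n : ℕ) (X : Op₂ n) : Prop :=
  ∀ i ∈ Finset.Icc (-(n : ℤ)) n, ∀ j ∈ Finset.Icc (-(n : ℤ)) n,
    dfct X i j (Lm q n) (Lm q n) = 0 ∧ dfct X i j (Lp q n) (Lp q n) = 0

/-- Compatibility with the mixed products of the `ℓ^±_{ij}`. -/
def IsAff (q : ℂ) (n : ℕ) (u v : ℂ) (X : Op₂ n) : Prop :=
  ∀ i ∈ Finset.Icc (-(n : ℤ)) n, ∀ j ∈ Finset.Icc (-(n : ℤ)) n,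
    v • dfct X i j (Lp q n) (Lm q n) + u • dfct X i j (Lm q n) (Lp q n) = 0

lemma coprod_sub {u v : ℂ} {X : Op₂ n} {s : ℤˣ} {i j : ℤ} {r : ℕ} :
    oppCoprodOp q n u v s i j r * X - X * coprodOp q n u v s i j r =
      ∑ ab ∈ Finset.HasAntidiagonal.antidiagonal r,
        dfct X i j (fun i j => evalRep q n v s i j ab.1) (fun i j => evalRep q n u s i j ab.2) := by
  simp only [dfct_apply, Finset.sum_sub_distrib, ← Finset.sum_mul, ← Finset.mul_sum]
  congr 2
  -- The opposite coproduct carries the two mode numbers in the other order, which the symmetry of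
  -- the antidiagonal repairs.
  · rw [oppCoprodOp, Finset.sum_comm]
    simp only [opr]
    exact Finset.Nat.sum_antidiagonal_swap (n := r)
      (f := fun ab => ∑ k ∈ Finset.Icc (-(n : ℤ)) n, evalRep q n v s k j ab.1 ⊗ₖ evalRep q n u s i k ab.2)
  · rw [coprodOp, Finset.sum_comm]
    rfl

/-- The zero modes of both signs give the finite-type conditions, and the first mode of `ℓ⁺` gives
the mixed one. Conversely, all modes follow from these three by telescoping, because the positive
modes in the evaluation representation are geometric in `r`. -/
lemma isIntertwiner_iff (hq : q ≠ 0) {u v : ℂ} (hu : u ≠ 0) (hv : v ≠ 0) (X : Op₂ n) :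
    IsIntertwiner q n u v X ↔ IsFT q n X ∧ IsAff q n u v X := by
  have hm : ∀ i ∈ Finset.Icc (-(n : ℤ)) n, ∀ j ∈ Finset.Icc (-(n : ℤ)) n,
      (q • spinMinus q n) i j = (q • Lm q n) i j := fun i hi j hj => by
    rw [Finset.mem_Icc] at hi hj
    simp only [Pi.smul_apply, spinMinus_eq_Lm hq hi.1 hi.2 hj.1 hj.2]
  have hp : ∀ i ∈ Finset.Icc (-(n : ℤ)) n, ∀ j ∈ Finset.Icc (-(n : ℤ)) n,
      (q⁻¹ • spinPlus q n) i j = (q⁻¹ • Lp q n) i j := fun i hi j hj => by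
    rw [Finset.mem_Icc] at hi hj
    simp only [Pi.smul_apply, spinPlus_eq_Lp hq hi.1 hi.2 hj.1 hj.2]
  have e1 : ∀ (ρ : ℂ), (fun i j => evalRep q n ρ 1 i j 0) = q⁻¹ • spinPlus q n := fun ρ => by
    funext i j; simp [evalRep]
  have e2 : ∀ (ρ : ℂ) (r : ℕ), (fun i j => evalRep q n ρ 1 i j (r + 1)) =
      (ρ ^ (r + 1))⁻¹ • (q⁻¹ • spinPlus q n - q • spinMinus q n) := fun ρ r => by
    funext i j; simp [evalRep]
  have e3 : ∀ (ρ : ℂ), (fun i j => evalRep q n ρ (-1) i j 0) = q • spinMinus q n := fun ρ => by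
    funext i j; simp [evalRep]
  have e4 : ∀ (ρ : ℂ) (r : ℕ), (fun i j => evalRep q n ρ (-1) i j (r + 1)) =
      ρ ^ (r + 1) • (q • spinMinus q n - q⁻¹ • spinPlus q n) := fun ρ r => by
    funext i j; simp [evalRep]
  have hq1 := inv_ne_zero hq
  constructor
  · intro h
    have h' : ∀ (s : ℤˣ) (r : ℕ), ∀ i ∈ Finset.Icc (-(n : ℤ)) n, ∀ j ∈ Finset.Icc (-(n : ℤ)) n,
        ∑ ab ∈ Finset.HasAntidiagonal.antidiagonal r, dfct X i j
          (fun i j => evalRep q n v s i j ab.1) (fun i j => evalRep q n u s i j ab.2) = 0 := by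
      intro s r i hi j hj
      rw [← coprod_sub, h s i j hi hj r, sub_self]
    have hPP : ∀ i ∈ Finset.Icc (-(n : ℤ)) n, ∀ j ∈ Finset.Icc (-(n : ℤ)) n,
        dfct X i j (Lp q n) (Lp q n) = 0 := by
      intro i hi j hj
      have := h' 1 0 i hi j hj
      simp only [Finset.Nat.antidiagonal_zero, Finset.sum_singleton, e1] at this
      rw [dfct_congr hi hj hp hp] at this
      simpa [hq] using this
    refine ⟨fun i hi j hj => ⟨?_, hPP i hi j hj⟩, fun i hi j hj => ?_⟩
    · have := h' (-1) 0 i hi j hj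
      simp only [Finset.Nat.antidiagonal_zero, Finset.sum_singleton, e3] at this
      rw [dfct_congr hi hj hm hm] at this
      simpa [hq] using this
    · have := h' 1 1 i hi j hj
      rw [Finset.Nat.sum_antidiagonal_succ, Finset.Nat.antidiagonal_zero, Finset.sum_singleton]
        at this
      have e2' : ∀ ρ : ℂ, (fun i j => evalRep q n ρ 1 i j (0 + 1)) =
          ρ⁻¹ • (q⁻¹ • spinPlus q n - q • spinMinus q n) := fun ρ => by
        rw [e2, zero_add, pow_one]
      have hPP' : dfct X i j (q⁻¹ • spinPlus q n) (q⁻¹ • spinPlus q n) = 0 := by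
        rw [dfct_congr hi hj hp hp]; simp [hPP i hi j hj]
      have hPM : dfct X i j (q⁻¹ • spinPlus q n) (q • spinMinus q n) =
          dfct X i j (Lp q n) (Lm q n) := by
        rw [dfct_congr hi hj hp hm]; simp [hq]
      have hMP : dfct X i j (q • spinMinus q n) (q⁻¹ • spinPlus q n) =
          dfct X i j (Lm q n) (Lp q n) := by
        rw [dfct_congr hi hj hm hp]; simp [hq]
      simp only [e1, e2'] at this
      generalize q⁻¹ • spinPlus q n = P at *
      generalize q • spinMinus q n = M at *
      simp only [map_smul, map_sub, LinearMap.smul_apply, LinearMap.sub_apply, hPP', hPM, hMP,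
        zero_sub, smul_neg] at this
      -- Clears the inverse spectral parameters and the sign.
      have h3 := congrArg (fun Y => (-(u * v)) • Y) this
      simp only [smul_add, smul_neg, smul_smul, smul_zero] at h3
      rw [← h3]
      match_scalars <;> field_simp
  · rintro ⟨h1, h2⟩ s i j hi hj r
    rw [← sub_eq_zero, coprod_sub]
    rcases Int.units_eq_one_or s with rfl | rfl
    · refine sum_antidiagonal_eq_zero (dfct X i j) (q⁻¹ • spinPlus q n) (q • spinMinus q n) hu hv
        ?_ ?_ ?_ (fun ρ r i j => evalRep q n ρ 1 i j r) e1 e2 r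
      · rw [dfct_congr hi hj hp hp]; simp [(h1 i hi j hj).2]
      · rw [dfct_congr hi hj hm hm]; simp [(h1 i hi j hj).1]
      · rw [dfct_congr hi hj hp hm, dfct_congr hi hj hm hp]
        simp only [map_smul, LinearMap.smul_apply, smul_smul, inv_mul_cancel₀ hq,
          mul_inv_cancel₀ hq, one_smul]
        exact h2 i hi j hj
    -- For `ℓ⁻` the roles of `L⁺` and `L⁻` are exchanged and the spectral parameters are inverted.
    · have := sum_antidiagonal_eq_zero (dfct X i j) (q • spinMinus q n) (q⁻¹ • spinPlus q n)
        (inv_ne_zero hu) (inv_ne_zero hv)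
        ?_ ?_ ?_ (fun ρ r i j => evalRep q n ρ⁻¹ (-1) i j r) (fun ρ => e3 _)
        (fun ρ r => by simp only [e4, inv_pow]) r
      · simpa only [inv_inv] using this
      · rw [dfct_congr hi hj hm hm]; simp [(h1 i hi j hj).1]
      · rw [dfct_congr hi hj hp hp]; simp [(h1 i hi j hj).2]
      · rw [dfct_congr hi hj hp hm, dfct_congr hi hj hm hp]
        simp only [map_smul, LinearMap.smul_apply, smul_smul, inv_mul_cancel₀ hq,
          mul_inv_cancel₀ hq, one_smul]
        have h3 := congrArg (fun Y => (u⁻¹ * v⁻¹) • Y) (h2 i hi j hj)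
        simp only [smul_add, smul_smul, smul_zero] at h3
        rw [show u⁻¹ * v⁻¹ * v = u⁻¹ by field_simp, show u⁻¹ * v⁻¹ * u = v⁻¹ by field_simp] at h3
        rw [add_comm]
        exact h3

end

section

/-! ### Simple root operators -/

/-- Operators `e`, `τ` which act on the vector index of the `ℓ^±_{ij}` by a shift by `σ`: the
commutation relations of `e` and `τ` with the factors of the `ℓ^±_{ij}`. -/
structure SimpleOp (q : ℂ) (n : ℕ) (σ : ℤ) (T t : ℤ → ℂ) (ε : ℂ) (d d' : ℤ → Op n)
    (e τ : Op n) : Prop where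
  supp : ∀ i : ℤ, T i ≠ 0 → (-n ≤ i ∧ i ≤ n) ∧ -n ≤ i + σ ∧ i + σ ≤ n
  e_par : e * par n = ε • (par n * e)
  τ_par : τ * par n = par n * τ
  e_up : ∀ i : ℤ, -n ≤ i → i ≤ n → T i • up q n (i + σ) + t i • (e * up q n i) = ε • (up q n i * e)
  e_lo : ∀ i : ℤ, -n ≤ i → i ≤ n →
    ε • (e * lo q n i) = T (i - σ) • (lo q n (i - σ) * τ) + lo q n i * e
  τ_up : ∀ i : ℤ, -n ≤ i → i ≤ n → t i • (τ * up q n i) = up q n i * τ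
  τ_lo : ∀ i : ℤ, -n ≤ i → i ≤ n → τ * lo q n i = t i • (lo q n i * τ)
  τ_d : ∀ i : ℤ, -n ≤ i → i ≤ n → τ * d i = d i * τ
  τ_d' : ∀ i : ℤ, -n ≤ i → i ≤ n → τ * d' i = d' i * τ
  d_e : ∀ i : ℤ, -n ≤ i → i ≤ n → d i * e = t i • (e * d i)
  d_step : ∀ i : ℤ, -n ≤ i → i ≤ n → T i • d' (i + σ) = T i • (d' i * τ)

variable {q : ℂ} {n : ℕ}

lemma b2_inj {a b c d a' b' c' d' : Op n} :
    b2 a b c d = b2 a' b' c' d' ↔ a = a' ∧ b = b' ∧ c = c' ∧ d = d' := by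
  constructor
  · intro h
    refine ⟨?_, ?_, ?_, ?_⟩ <;> ext r s
    · simpa only [b2, Matrix.of_apply, idxInit_symm, last_symm, neg_one_ne_one_units, if_true, if_false]
      using congrFun (congrFun h ((idxEquiv n).symm (r, -1))) ((idxEquiv n).symm (s, -1))
    · simpa only [b2, Matrix.of_apply, idxInit_symm, last_symm, neg_one_ne_one_units, if_true, if_false]
      using congrFun (congrFun h ((idxEquiv n).symm (r, -1))) ((idxEquiv n).symm (s, 1))
    · simpa only [b2, Matrix.of_apply, idxInit_symm, last_symm, neg_one_ne_one_units, if_true, if_false]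
      using congrFun (congrFun h ((idxEquiv n).symm (r, 1))) ((idxEquiv n).symm (s, -1))
    · simpa only [b2, Matrix.of_apply, idxInit_symm, last_symm, neg_one_ne_one_units, if_true, if_false]
      using congrFun (congrFun h ((idxEquiv n).symm (r, 1))) ((idxEquiv n).symm (s, 1))
  · rintro ⟨rfl, rfl, rfl, rfl⟩; rfl

lemma b2_eq_zero {a b c d : Op n} : b2 a b c d = 0 ↔ a = 0 ∧ b = 0 ∧ c = 0 ∧ d = 0 := by
  rw [← b2_zero, b2_inj]

lemma zero_eq_b2 {a b c d : Op n} : 0 = b2 a b c d ↔ a = 0 ∧ b = 0 ∧ c = 0 ∧ d = 0 := by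
  rw [eq_comm, b2_eq_zero]

lemma emb_eq (A : Op n) : emb A = b2 A 0 0 A := rfl

/-- For old indices the factors gain only scalars in the two blocks, which commute with everything.
For the new indices `±(n+1)` they are multiples of `par n` in a single block, so only the parity `ε`
of `e` matters; there `T` vanishes and `t` is `1`. -/
lemma SimpleOp.succ {σ : ℤ} {T t : ℤ → ℂ} {ε : ℂ} {D D' : (m : ℕ) → ℤ → Op m} {e τ : Op n}
    (h : SimpleOp q n σ T t ε (D n) (D' n) e τ) (hε : ε ^ 2 = 1)
    (hD : ∀ i : ℤ, -n ≤ i → i ≤ n → D (n + 1) i = emb (D n i))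
    (hD' : ∀ i : ℤ, -n ≤ i → i ≤ n → D' (n + 1) i = emb (D' n i))
    (hDl : ∀ i : ℤ, (i = n + 1 ∨ i = -(n + 1)) → ∃ a b : ℂ, D (n + 1) i = b2 (a • 1) 0 0 (b • 1))
    (hDl' : ∀ i : ℤ, (i = n + 1 ∨ i = -(n + 1)) → ∃ a b : ℂ, D' (n + 1) i = b2 (a • 1) 0 0 (b • 1))
    (ht1 : t (n + 1) = 1) (ht2 : t (-(n + 1)) = 1) :
    SimpleOp q (n + 1) σ T t ε (D (n + 1)) (D' (n + 1)) (emb e) (emb τ) := by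
  have hT : ∀ i : ℤ, ¬ (-n ≤ i ∧ i ≤ n) → T i = 0 := fun i hi => by
    by_contra h0; exact hi (h.supp i h0).1
  have hT' : ∀ i : ℤ, ¬ (-n ≤ i ∧ i ≤ n) → T (i - σ) = 0 := fun i hi => by
    by_contra h0
    have := (h.supp _ h0).2
    rw [sub_add_cancel] at this
    exact hi this
  have hε' : ∀ x : ℂ, ε * (ε * x) = x := fun x => by rw [← mul_assoc, ← sq, hε, one_mul]
  have split : ∀ i : ℤ, -((n + 1 : ℕ) : ℤ) ≤ i → i ≤ (n + 1 : ℕ) →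
      (-n ≤ i ∧ i ≤ n) ∨ (i = n + 1 ∨ i = -(n + 1)) := fun i h1 h2 => by
    push_cast at h1 h2; omega
  have t1 : ∀ i : ℤ, (i = n + 1 ∨ i = -(n + 1)) → t i = 1 := by
    rintro i (rfl | rfl) <;> assumption
  have out : ∀ i : ℤ, (i = n + 1 ∨ i = -(n + 1)) → ¬ (-n ≤ i ∧ i ≤ n) := by
    intro i hi; omega
  have hp := h.e_par
  have hp' := h.τ_par
  refine ⟨?_, ?_, ?_, ?_, ?_, ?_, ?_, ?_, ?_, ?_, ?_⟩
  · intro i hi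
    have := h.supp i hi
    push_cast
    omega
  · rw [par_succ, emb_eq, b2_mul, b2_mul, b2_smul]
    simp [hp]
  · rw [par_succ, emb_eq, b2_mul, b2_mul]
    simp [hp']
  · intro i h1 h2
    rcases split i h1 h2 with hi | hi
    · have e := h.e_up i hi.1 hi.2
      rw [up_succ hi.1 hi.2, emb_eq, b2_mul, b2_mul, b2_smul, b2_smul]
      by_cases hT0 : T i = 0
      · rw [hT0, zero_smul, zero_add] at e ⊢
        simp only [mul_zero, zero_mul, add_zero, zero_add, smul_zero, mul_smul_comm,
          smul_mul_assoc, smul_comm _ (q ^ 2), e]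
      · obtain ⟨-, h3, h4⟩ := h.supp i hT0
        rw [up_succ h3 h4, b2_smul, b2_add]
        simp only [mul_zero, zero_mul, add_zero, zero_add, smul_zero, mul_smul_comm,
          smul_mul_assoc, smul_comm _ (q ^ 2), ← e, smul_add]
    · rw [hT i (out i hi), t1 i hi]
      rcases hi with rfl | rfl
      · rw [up_last, emb_eq, b2_mul, b2_mul, b2_smul, b2_smul]
        simp [hp, smul_comm _ ε]
      · rw [up_neg_last, emb_eq, b2_mul, b2_mul, b2_smul, b2_smul]
        simp [hp, smul_comm _ ε]
  · intro i h1 h2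
    rcases split i h1 h2 with hi | hi
    · have e := h.e_lo i hi.1 hi.2
      rw [lo_succ hi.1 hi.2, emb_eq, emb_eq, b2_mul, b2_mul, b2_smul]
      by_cases hT0 : T (i - σ) = 0
      · rw [hT0, zero_smul, zero_add] at e ⊢
        simp only [mul_zero, zero_mul, add_zero, zero_add, smul_zero, mul_smul_comm,
          smul_mul_assoc, smul_comm _ (q ^ 2)⁻¹, e]
      · obtain ⟨h3, -⟩ := h.supp _ hT0
        rw [lo_succ h3.1 h3.2, b2_mul, b2_smul, b2_add]
        simp only [mul_zero, zero_mul, add_zero, zero_add, smul_zero, mul_smul_comm,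
          smul_mul_assoc, smul_comm _ (q ^ 2)⁻¹, e, smul_add]
    · rw [hT' i (out i hi)]
      rcases hi with rfl | rfl
      · rw [lo_last, emb_eq, emb_eq, b2_mul, b2_mul, b2_smul]
        simp [hp, smul_comm _ ε, smul_smul, hε']
      · rw [lo_neg_last, emb_eq, emb_eq, b2_mul, b2_mul, b2_smul]
        simp [hp, smul_comm _ ε, smul_smul, hε']
  · intro i h1 h2
    rcases split i h1 h2 with hi | hi
    · rw [up_succ hi.1 hi.2, emb_eq, b2_mul, b2_mul, b2_smul]
      simp only [mul_zero, zero_mul, add_zero, zero_add, smul_zero, mul_smul_comm,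
          smul_mul_assoc, smul_comm _ (q ^ 2), h.τ_up i hi.1 hi.2]
    · rw [t1 i hi]
      rcases hi with rfl | rfl
      · rw [up_last, emb_eq, b2_mul, b2_mul, b2_smul]; simp [hp']
      · rw [up_neg_last, emb_eq, b2_mul, b2_mul, b2_smul]; simp [hp']
  · intro i h1 h2
    rcases split i h1 h2 with hi | hi
    · rw [lo_succ hi.1 hi.2, emb_eq, b2_mul, b2_mul, b2_smul]
      simp only [mul_zero, zero_mul, add_zero, zero_add, smul_zero, mul_smul_comm,
          smul_mul_assoc, smul_comm _ (q ^ 2)⁻¹, h.τ_lo i hi.1 hi.2]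
    · rw [t1 i hi]
      rcases hi with rfl | rfl
      · rw [lo_last, emb_eq, b2_mul, b2_mul, b2_smul]; simp [hp']
      · rw [lo_neg_last, emb_eq, b2_mul, b2_mul, b2_smul]; simp [hp']
  · intro i h1 h2
    rcases split i h1 h2 with hi | hi
    · rw [hD i hi.1 hi.2, ← emb_mul, ← emb_mul, h.τ_d i hi.1 hi.2]
    · obtain ⟨a, b, e⟩ := hDl i hi
      rw [e, emb_eq, b2_mul, b2_mul]; simp
  · intro i h1 h2
    rcases split i h1 h2 with hi | hi
    · rw [hD' i hi.1 hi.2, ← emb_mul, ← emb_mul, h.τ_d' i hi.1 hi.2]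
    · obtain ⟨a, b, e⟩ := hDl' i hi
      rw [e, emb_eq, b2_mul, b2_mul]; simp
  · intro i h1 h2
    rcases split i h1 h2 with hi | hi
    · rw [hD i hi.1 hi.2, ← emb_mul, ← emb_mul, ← emb_smul, h.d_e i hi.1 hi.2]
    · obtain ⟨a, b, e⟩ := hDl i hi
      rw [e, emb_eq, b2_mul, b2_mul, t1 i hi, b2_smul]; simp
  · intro i h1 h2
    by_cases hT0 : T i = 0
    · rw [hT0, zero_smul, zero_smul]
    · obtain ⟨h3, h5, h6⟩ := h.supp i hT0
      rw [hD' i h3.1 h3.2, hD' _ h5 h6, ← emb_mul, ← emb_smul, h.d_step i h3.1 h3.2, emb_smul]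

/-! ### Explicit simple root operators and their weights -/

/-- Weights of the simple root operators. -/
def rootT (q : ℂ) (k : ℕ) (i : ℤ) : ℂ :=
  if i = k + 1 then (q ^ 2)⁻¹ else if i = -(k + 1) then q ^ 2
  else if k = 0 then 1 else if i = k then q ^ 2 else if i = -k then (q ^ 2)⁻¹ else 1

/-- Coefficients of the action of the raising operators on the vector index. -/
def coefE (q : ℂ) (k : ℕ) (i : ℤ) : ℂ :=
  if k = 0 then (if i = 0 then -(aZero q * (1 + q ^ 2))
    else if i = -1 then q * (aZero q * (1 + q ^ 2)) else 0)
  else if i = k then 1 else if i = -(k + 1) then -1 else 0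

/-- Coefficients of the action of the lowering operators on the vector index. -/
def coefF (q : ℂ) (k : ℕ) (i : ℤ) : ℂ :=
  if k = 0 then (if i = 1 then (q ^ 2)⁻¹ * (aZero q * (1 + q ^ 2))
    else if i = 0 then -(q⁻¹ * (aZero q * (1 + q ^ 2))) else 0)
  else if i = k + 1 then 1 else if i = -k then -1 else 0

/-- The sign of the simple root operators. -/
def rootSign (k : ℕ) : ℂ := if k = 0 then -1 else 1

/-- The raising operators. -/
def simE : (n k : ℕ) → Op n
  | 0, _ => 0
  | 1, k => if k = 0 then b2 0 0 1 0 else 0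
  | n + 2, k => if k = n + 1 then b2 0 0 (b2 0 1 0 0) 0 else emb (simE (n + 1) k)

/-- The lowering operators. -/
def simF : (n k : ℕ) → Op n
  | 0, _ => 0
  | 1, k => if k = 0 then b2 0 1 0 0 else 0
  | n + 2, k => if k = n + 1 then b2 0 (b2 0 0 1 0) 0 0 else emb (simF (n + 1) k)

/-- The Cartan operators attached to the simple roots. -/
def simT (q : ℂ) : (n k : ℕ) → Op n
  | 0, _ => 0
  | 1, k => if k = 0 then b2 (q⁻¹ • 1) 0 0 (q • 1) else 0
  | n + 2, k => if k = n + 1 then b2 (b2 1 0 0 ((q ^ 2)⁻¹ • 1)) 0 0 (b2 (q ^ 2 • 1) 0 0 1)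
      else emb (simT q (n + 1) k)

lemma idx_cases {m : ℕ} {i : ℤ} (h1 : -((m + 2 : ℕ) : ℤ) ≤ i) (h2 : i ≤ (m + 2 : ℕ)) :
    i = ((m + 1 : ℕ) : ℤ) + 1 ∨ i = -(((m + 1 : ℕ) : ℤ) + 1) ∨ i = m + 1 ∨ i = -(m + 1) ∨
      (-m ≤ i ∧ i ≤ m) := by
  push_cast at *; omega

lemma up_two_last (m : ℕ) : up q (m + 2) (((m + 1 : ℕ) : ℤ) + 1) =
    b2 0 0 ((-q ^ 2) ^ (m + 2) • b2 (par m) 0 0 (-par m)) 0 := by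
  rw [up_last, par_succ]

lemma up_two_neg_last (m : ℕ) : up q (m + 2) (-(((m + 1 : ℕ) : ℤ) + 1)) =
    b2 0 (((-1) ^ (m + 2) * q ^ 3) • b2 (par m) 0 0 (-par m)) 0 0 := by
  rw [up_neg_last, par_succ]

lemma up_two_mid (m : ℕ) : up q (m + 2) (m + 1) =
    b2 (b2 0 0 ((-q ^ 2) ^ (m + 1) • par m) 0) 0 0
      (q ^ 2 • b2 0 0 ((-q ^ 2) ^ (m + 1) • par m) 0) := by
  rw [up_succ (by push_cast; omega) (by push_cast; omega), up_last]

lemma up_two_neg_mid (m : ℕ) : up q (m + 2) (-(m + 1)) =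
    b2 (b2 0 (((-1) ^ (m + 1) * q ^ 3) • par m) 0 0) 0 0
      (q ^ 2 • b2 0 (((-1) ^ (m + 1) * q ^ 3) • par m) 0 0) := by
  rw [up_succ (by push_cast; omega) (by push_cast; omega), up_neg_last]

lemma up_two_succ {m : ℕ} {i : ℤ} (h1 : -m ≤ i) (h2 : i ≤ m) : up q (m + 2) i =
    b2 (b2 (up q m i) 0 0 (q ^ 2 • up q m i)) 0 0
      (q ^ 2 • b2 (up q m i) 0 0 (q ^ 2 • up q m i)) := by
  rw [up_succ (by push_cast; omega) (by push_cast; omega), up_succ h1 h2]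

lemma lo_two_last (m : ℕ) : lo q (m + 2) (((m + 1 : ℕ) : ℤ) + 1) =
    b2 0 ((q ^ 2 * ((-q ^ 2) ^ (m + 2))⁻¹) • b2 (par m) 0 0 (-par m)) 0 0 := by
  rw [lo_last, par_succ]

lemma lo_two_neg_last (m : ℕ) : lo q (m + 2) (-(((m + 1 : ℕ) : ℤ) + 1)) =
    b2 0 0 (((-1) ^ (m + 2) * q⁻¹) • b2 (par m) 0 0 (-par m)) 0 := by
  rw [lo_neg_last, par_succ]

lemma lo_two_mid (m : ℕ) : lo q (m + 2) (m + 1) =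
    b2 (b2 0 ((q ^ 2 * ((-q ^ 2) ^ (m + 1))⁻¹) • par m) 0 0) 0 0
      ((q ^ 2)⁻¹ • b2 0 ((q ^ 2 * ((-q ^ 2) ^ (m + 1))⁻¹) • par m) 0 0) := by
  rw [lo_succ (by push_cast; omega) (by push_cast; omega), lo_last]

lemma lo_two_neg_mid (m : ℕ) : lo q (m + 2) (-(m + 1)) =
    b2 (b2 0 0 (((-1) ^ (m + 1) * q⁻¹) • par m) 0) 0 0
      ((q ^ 2)⁻¹ • b2 0 0 (((-1) ^ (m + 1) * q⁻¹) • par m) 0) := by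
  rw [lo_succ (by push_cast; omega) (by push_cast; omega), lo_neg_last]

lemma lo_two_succ {m : ℕ} {i : ℤ} (h1 : -m ≤ i) (h2 : i ≤ m) : lo q (m + 2) i =
    b2 (b2 (lo q m i) 0 0 ((q ^ 2)⁻¹ • lo q m i)) 0 0
      ((q ^ 2)⁻¹ • b2 (lo q m i) 0 0 ((q ^ 2)⁻¹ • lo q m i)) := by
  rw [lo_succ (by push_cast; omega) (by push_cast; omega), lo_succ h1 h2]

lemma dgm_two_last (m : ℕ) : dgm q (m + 2) (((m + 1 : ℕ) : ℤ) + 1) =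
    b2 (q⁻¹ • b2 1 0 0 1) 0 0 (q • b2 1 0 0 1) := by rw [dgm_last, b2_one]

lemma dgm_two_neg_last (m : ℕ) : dgm q (m + 2) (-(((m + 1 : ℕ) : ℤ) + 1)) =
    b2 (q • b2 1 0 0 1) 0 0 (q⁻¹ • b2 1 0 0 1) := by rw [dgm_neg_last, b2_one]

lemma dgm_two_mid (m : ℕ) : dgm q (m + 2) (m + 1) =
    b2 (b2 (q⁻¹ • 1) 0 0 (q • 1)) 0 0 (b2 (q⁻¹ • 1) 0 0 (q • 1)) := by
  rw [dgm_succ (by push_cast; omega) (by push_cast; omega), dgm_last, emb_eq]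

lemma dgm_two_neg_mid (m : ℕ) : dgm q (m + 2) (-(m + 1)) =
    b2 (b2 (q • 1) 0 0 (q⁻¹ • 1)) 0 0 (b2 (q • 1) 0 0 (q⁻¹ • 1)) := by
  rw [dgm_succ (by push_cast; omega) (by push_cast; omega), dgm_neg_last, emb_eq]

lemma dgm_two_succ {m : ℕ} {i : ℤ} (h1 : -m ≤ i) (h2 : i ≤ m) : dgm q (m + 2) i =
    b2 (b2 (dgm q m i) 0 0 (dgm q m i)) 0 0 (b2 (dgm q m i) 0 0 (dgm q m i)) := by
  rw [dgm_succ (by push_cast; omega) (by push_cast; omega), dgm_succ h1 h2, emb_eq, emb_eq]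

lemma dgp_two_last (m : ℕ) : dgp q (m + 2) (((m + 1 : ℕ) : ℤ) + 1) =
    b2 (q • b2 1 0 0 1) 0 0 (q⁻¹ • b2 1 0 0 1) := by rw [dgp_last, b2_one]

lemma dgp_two_neg_last (m : ℕ) : dgp q (m + 2) (-(((m + 1 : ℕ) : ℤ) + 1)) =
    b2 (q⁻¹ • b2 1 0 0 1) 0 0 (q • b2 1 0 0 1) := by rw [dgp_neg_last, b2_one]

lemma dgp_two_mid (m : ℕ) : dgp q (m + 2) (m + 1) =
    b2 (b2 (q • 1) 0 0 (q⁻¹ • 1)) 0 0 (b2 (q • 1) 0 0 (q⁻¹ • 1)) := by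
  rw [dgp_succ (by push_cast; omega) (by push_cast; omega), dgp_last, emb_eq]

lemma dgp_two_neg_mid (m : ℕ) : dgp q (m + 2) (-(m + 1)) =
    b2 (b2 (q⁻¹ • 1) 0 0 (q • 1)) 0 0 (b2 (q⁻¹ • 1) 0 0 (q • 1)) := by
  rw [dgp_succ (by push_cast; omega) (by push_cast; omega), dgp_neg_last, emb_eq]

lemma dgp_two_succ {m : ℕ} {i : ℤ} (h1 : -m ≤ i) (h2 : i ≤ m) : dgp q (m + 2) i =
    b2 (b2 (dgp q m i) 0 0 (dgp q m i)) 0 0 (b2 (dgp q m i) 0 0 (dgp q m i)) := by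
  rw [dgp_succ (by push_cast; omega) (by push_cast; omega), dgp_succ h1 h2, emb_eq, emb_eq]

lemma rootT_two (m : ℕ) : rootT q (m + 1) (((m + 1 : ℕ) : ℤ) + 1) = (q ^ 2)⁻¹ ∧
    rootT q (m + 1) (-(((m + 1 : ℕ) : ℤ) + 1)) = q ^ 2 ∧ rootT q (m + 1) (m + 1) = q ^ 2 ∧
    rootT q (m + 1) (-(m + 1)) = (q ^ 2)⁻¹ ∧
    ∀ i : ℤ, -m ≤ i → i ≤ m → rootT q (m + 1) i = 1 := by
  refine ⟨?_, ?_, ?_, ?_, fun i h1 h2 => ?_⟩ <;>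
  · rw [rootT]
    push_cast
    repeat' first | rw [if_pos (by omega)] | rw [if_neg (by omega)]

/-- The operator raises the last site and lowers the one before it. Only the vector indices `m+1 →
m+2` and `-(m+2) → -(m+1)` move, and every relation is checked in two-by-two blocks over the
remaining `m` sites. -/
lemma simpleOp_E_top (hq : q ≠ 0) (m : ℕ) :
    SimpleOp q (m + 2) 1 (coefE q (m + 1)) (rootT q (m + 1)) 1 (dgp q (m + 2)) (dgm q (m + 2))
      (simE (m + 2) (m + 1)) (simT q (m + 2) (m + 1)) := by
  have hE : simE (m + 2) (m + 1) = b2 0 0 (b2 0 1 0 0) 0 := by rw [simE, if_pos rfl]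
  have hT : simT q (m + 2) (m + 1) =
      b2 (b2 1 0 0 ((q ^ 2)⁻¹ • 1)) 0 0 (b2 (q ^ 2 • 1) 0 0 1) := by rw [simT, if_pos rfl]
  obtain ⟨t1, t2, t3, t4, t5⟩ := rootT_two (q := q) m
  have c0 : ∀ i : ℤ, i ≠ m + 1 → i ≠ -(m + 2) → coefE q (m + 1) i = 0 := fun i h h' => by
    rw [coefE, if_neg (by omega), if_neg (by push_cast; omega), if_neg (by push_cast; omega)]
  have c1 : coefE q (m + 1) (m + 1) = 1 := by
    rw [coefE, if_neg (by omega), if_pos (by push_cast; omega)]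
  have c2 : coefE q (m + 1) (-(((m + 1 : ℕ) : ℤ) + 1)) = -1 := by
    rw [coefE, if_neg (by omega), if_neg (by push_cast; omega), if_pos rfl]
  rw [hE, hT]
  refine ⟨?_, ?_, ?_, ?_, ?_, ?_, ?_, ?_, ?_, ?_, ?_⟩
  · intro i hi
    by_contra h
    refine hi (c0 i ?_ ?_) <;> push_cast at * <;> omega
  · rw [par_succ, par_succ]
    simp [b2_mul, b2_neg]
  · rw [par_succ, par_succ]
    simp [b2_mul]
  · intro i h1 h2
    rcases idx_cases h1 h2 with rfl | rfl | rfl | rfl | ⟨h1, h2⟩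
    · rw [c0 _ (by push_cast; omega) (by push_cast; omega), t1, up_two_last]
      simp [b2_mul, b2_smul, b2_zero]
    · rw [c2, t2, show -(((m + 1 : ℕ) : ℤ) + 1) + 1 = -(m + 1) by push_cast; ring, up_two_neg_last,
        up_two_neg_mid]
      simp [b2_mul, b2_smul, b2_zero, b2_add, b2_neg, smul_smul, pow_succ]
    · rw [c1, t3, show (m : ℤ) + 1 + 1 = ((m + 1 : ℕ) : ℤ) + 1 by push_cast; ring, up_two_last,
        up_two_mid]
      simp [b2_mul, b2_smul, b2_add, smul_smul, pow_succ]
      simp only [b2_inj, and_true, true_and]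
      first
        | (match_scalars <;> field_simp <;> ring)
        | (refine ⟨?_, ?_⟩ <;> match_scalars <;> field_simp <;> ring)
        | (refine ⟨?_, ?_, ?_⟩ <;> match_scalars <;> field_simp <;> ring)
    · rw [c0 _ (by push_cast; omega) (by push_cast; omega), t4, up_two_neg_mid]
      simp [b2_mul, b2_smul, b2_zero, smul_smul]
    · rw [c0 _ (by omega) (by omega), t5 i h1 h2, up_two_succ h1 h2]
      simp [b2_mul, b2_smul]
  · intro i h1 h2
    rcases idx_cases h1 h2 with rfl | rfl | rfl | rfl | ⟨h1, h2⟩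
    · rw [show ((m + 1 : ℕ) : ℤ) + 1 - 1 = m + 1 by push_cast; ring, c1, lo_two_last, lo_two_mid]
      simp [b2_mul, b2_smul, b2_add, smul_smul]
      simp only [b2_inj, zero_eq_b2, and_true, true_and, and_self]
      first
        | (match_scalars <;> field_simp <;> ring)
        | (refine ⟨?_, ?_⟩ <;> match_scalars <;> field_simp <;> ring)
        | (refine ⟨?_, ?_, ?_⟩ <;> match_scalars <;> field_simp <;> ring)
    · rw [c0 _ (by push_cast; omega) (by push_cast; omega), lo_two_neg_last]
      simp [b2_mul, b2_smul, b2_zero]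
    · rw [c0 _ (by push_cast; omega) (by push_cast; omega), lo_two_mid]
      simp [b2_mul, b2_smul, b2_zero, smul_smul]
    · rw [show -((m : ℤ) + 1) - 1 = -(((m + 1 : ℕ) : ℤ) + 1) by push_cast; ring, c2,
        lo_two_neg_last, lo_two_neg_mid]
      simp [b2_mul, b2_smul, b2_add, b2_neg, smul_smul]
      simp only [b2_inj, and_true, true_and]
      first
        | (match_scalars <;> field_simp <;> ring)
        | (refine ⟨?_, ?_⟩ <;> match_scalars <;> field_simp <;> ring)
        | (refine ⟨?_, ?_, ?_⟩ <;> match_scalars <;> field_simp <;> ring)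
    · rw [c0 _ (by omega) (by omega), lo_two_succ h1 h2]
      simp [b2_mul, b2_smul]
  · intro i h1 h2
    rcases idx_cases h1 h2 with rfl | rfl | rfl | rfl | ⟨h1, h2⟩
    · rw [t1, up_two_last]
      simp [b2_mul, b2_smul, smul_smul, hq, mul_comm]
    · rw [t2, up_two_neg_last]
      simp [b2_mul, b2_smul, smul_smul, hq, mul_comm]
    · rw [t3, up_two_mid]
      simp [b2_mul, b2_smul, smul_smul, hq, mul_comm]
    · rw [t4, up_two_neg_mid]
      simp [b2_mul, b2_smul, smul_smul, hq, mul_comm]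
    · rw [t5 i h1 h2, up_two_succ h1 h2]
      simp [b2_mul, b2_smul, smul_smul, hq]
  · intro i h1 h2
    rcases idx_cases h1 h2 with rfl | rfl | rfl | rfl | ⟨h1, h2⟩
    · rw [t1, lo_two_last]
      simp [b2_mul, b2_smul, smul_smul, hq, mul_comm]
    · rw [t2, lo_two_neg_last]
      simp [b2_mul, b2_smul, smul_smul]
      simp only [b2_inj, and_true, true_and]
      first
        | (match_scalars <;> field_simp <;> ring)
        | (refine ⟨?_, ?_⟩ <;> match_scalars <;> field_simp <;> ring)
        | (refine ⟨?_, ?_, ?_⟩ <;> match_scalars <;> field_simp <;> ring)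
    · rw [t3, lo_two_mid]
      simp [b2_mul, b2_smul, smul_smul, hq, mul_comm]
    · rw [t4, lo_two_neg_mid]
      simp [b2_mul, b2_smul, smul_smul, hq, mul_comm]
    · rw [t5 i h1 h2, lo_two_succ h1 h2]
      simp [b2_mul, b2_smul, smul_smul, hq]
  · intro i h1 h2
    rcases idx_cases h1 h2 with rfl | rfl | rfl | rfl | ⟨h1, h2⟩
    · rw [dgp_two_last]; simp [b2_mul, b2_smul, smul_smul, mul_comm]
    · rw [dgp_two_neg_last]; simp [b2_mul, b2_smul, smul_smul, mul_comm]
    · rw [dgp_two_mid]; simp [b2_mul, smul_smul, mul_comm]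
    · rw [dgp_two_neg_mid]; simp [b2_mul, smul_smul, mul_comm]
    · rw [dgp_two_succ h1 h2]; simp [b2_mul]
  · intro i h1 h2
    rcases idx_cases h1 h2 with rfl | rfl | rfl | rfl | ⟨h1, h2⟩
    · rw [dgm_two_last]; simp [b2_mul, b2_smul, smul_smul, mul_comm]
    · rw [dgm_two_neg_last]; simp [b2_mul, b2_smul, smul_smul, mul_comm]
    · rw [dgm_two_mid]; simp [b2_mul, smul_smul, mul_comm]
    · rw [dgm_two_neg_mid]; simp [b2_mul, smul_smul, mul_comm]
    · rw [dgm_two_succ h1 h2]; simp [b2_mul]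
  · intro i h1 h2
    rcases idx_cases h1 h2 with rfl | rfl | rfl | rfl | ⟨h1, h2⟩
    · rw [t1, dgp_two_last]; simp [b2_mul, b2_smul, smul_smul]
      simp only [b2_inj, and_true, true_and, and_self]
      first
        | (match_scalars <;> field_simp <;> ring)
        | (refine ⟨?_, ?_⟩ <;> match_scalars <;> field_simp <;> ring)
        | (refine ⟨?_, ?_, ?_⟩ <;> match_scalars <;> field_simp <;> ring)
    · rw [t2, dgp_two_neg_last]; simp [b2_mul, b2_smul, smul_smul]
      simp only [b2_inj, and_true, true_and, and_self]
      first
        | (match_scalars <;> field_simp <;> ring)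
        | (refine ⟨?_, ?_⟩ <;> match_scalars <;> field_simp <;> ring)
        | (refine ⟨?_, ?_, ?_⟩ <;> match_scalars <;> field_simp <;> ring)
    · rw [t3, dgp_two_mid]; simp [b2_mul, b2_smul, smul_smul]
      simp only [b2_inj, and_true, true_and, and_self]
      first
        | (match_scalars <;> field_simp <;> ring)
        | (refine ⟨?_, ?_⟩ <;> match_scalars <;> field_simp <;> ring)
        | (refine ⟨?_, ?_, ?_⟩ <;> match_scalars <;> field_simp <;> ring)
    · rw [t4, dgp_two_neg_mid]; simp [b2_mul, b2_smul, smul_smul]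
      simp only [b2_inj, and_true, true_and, and_self]
      first
        | (match_scalars <;> field_simp <;> ring)
        | (refine ⟨?_, ?_⟩ <;> match_scalars <;> field_simp <;> ring)
        | (refine ⟨?_, ?_, ?_⟩ <;> match_scalars <;> field_simp <;> ring)
    · rw [t5 i h1 h2, dgp_two_succ h1 h2]; simp [b2_mul]
  · intro i h1 h2
    rcases idx_cases h1 h2 with rfl | rfl | rfl | rfl | ⟨h1, h2⟩
    · rw [c0 _ (by push_cast; omega) (by push_cast; omega)]; simp
    · rw [c2, show -(((m + 1 : ℕ) : ℤ) + 1) + 1 = -(m + 1) by push_cast; ring, dgm_two_neg_last,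
        dgm_two_neg_mid]
      simp [b2_mul, b2_smul, smul_smul, b2_neg]
      simp only [b2_inj, and_true, true_and, and_self]
      first
        | (match_scalars <;> field_simp <;> ring)
        | (refine ⟨?_, ?_⟩ <;> match_scalars <;> field_simp <;> ring)
        | (refine ⟨?_, ?_, ?_⟩ <;> match_scalars <;> field_simp <;> ring)
    · rw [c1, show (m : ℤ) + 1 + 1 = ((m + 1 : ℕ) : ℤ) + 1 by push_cast; ring, dgm_two_last,
        dgm_two_mid]
      simp [b2_mul, b2_smul, smul_smul]
      simp only [b2_inj, and_true, true_and, and_self]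
      first
        | (match_scalars <;> field_simp <;> ring)
        | (refine ⟨?_, ?_⟩ <;> match_scalars <;> field_simp <;> ring)
        | (refine ⟨?_, ?_, ?_⟩ <;> match_scalars <;> field_simp <;> ring)
    · rw [c0 _ (by push_cast; omega) (by push_cast; omega)]; simp
    · rw [c0 _ (by omega) (by omega)]; simp

lemma simpleOp_F_top (hq : q ≠ 0) (m : ℕ) :
    SimpleOp q (m + 2) (-1) (coefF q (m + 1)) (rootT q (m + 1)) 1 (dgm q (m + 2)) (dgp q (m + 2))
      (simF (m + 2) (m + 1)) (simT q (m + 2) (m + 1)) := by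
  have hF : simF (m + 2) (m + 1) = b2 0 (b2 0 0 1 0) 0 0 := by rw [simF, if_pos rfl]
  have hT : simT q (m + 2) (m + 1) =
      b2 (b2 1 0 0 ((q ^ 2)⁻¹ • 1)) 0 0 (b2 (q ^ 2 • 1) 0 0 1) := by rw [simT, if_pos rfl]
  obtain ⟨t1, t2, t3, t4, t5⟩ := rootT_two (q := q) m
  have c0 : ∀ i : ℤ, i ≠ m + 2 → i ≠ -(m + 1) → coefF q (m + 1) i = 0 := fun i h h' => by
    rw [coefF, if_neg (by omega), if_neg (by push_cast; omega), if_neg (by push_cast; omega)]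
  have c1 : coefF q (m + 1) (((m + 1 : ℕ) : ℤ) + 1) = 1 := by
    rw [coefF, if_neg (by omega), if_pos rfl]
  have c2 : coefF q (m + 1) (-(m + 1)) = -1 := by
    rw [coefF, if_neg (by omega), if_neg (by push_cast; omega), if_pos (by push_cast; rfl)]
  rw [hF, hT]
  refine ⟨?_, ?_, ?_, ?_, ?_, ?_, ?_, ?_, ?_, ?_, ?_⟩
  · intro i hi
    by_contra h
    refine hi (c0 i ?_ ?_) <;> push_cast at * <;> omega
  · rw [par_succ, par_succ]
    simp [b2_mul, b2_neg]
  · rw [par_succ, par_succ]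
    simp [b2_mul]
  · intro i h1 h2
    rcases idx_cases h1 h2 with rfl | rfl | rfl | rfl | ⟨h1, h2⟩
    · rw [c1, t1, show ((m + 1 : ℕ) : ℤ) + 1 + -1 = m + 1 by push_cast; ring, up_two_last,
        up_two_mid]
      simp [b2_mul, b2_smul, b2_zero, b2_add, b2_neg, smul_smul, pow_succ]
      simp only [b2_inj, b2_eq_zero, zero_eq_b2, and_true, true_and, and_self]
      first
        | (match_scalars <;> field_simp <;> ring)
        | (refine ⟨?_, ?_⟩ <;> match_scalars <;> field_simp <;> ring)
        | (refine ⟨?_, ?_, ?_⟩ <;> match_scalars <;> field_simp <;> ring)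
    · rw [c0 _ (by push_cast; omega) (by push_cast; omega), t2, up_two_neg_last]
      simp [b2_mul, b2_smul, b2_zero, b2_add, b2_neg, smul_smul, hq]
    · rw [c0 _ (by push_cast; omega) (by push_cast; omega), t3, up_two_mid]
      simp [b2_mul, b2_smul, b2_zero, b2_add, b2_neg, smul_smul, hq]
    · rw [c2, t4, show -((m : ℤ) + 1) + -1 = -(((m + 1 : ℕ) : ℤ) + 1) by push_cast; ring,
        up_two_neg_last, up_two_neg_mid]
      simp [b2_mul, b2_smul, b2_zero, b2_add, b2_neg, smul_smul, pow_succ]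
      simp only [b2_inj, b2_eq_zero, zero_eq_b2, and_true, true_and, and_self]
      first
        | (match_scalars <;> field_simp <;> ring)
        | (refine ⟨?_, ?_⟩ <;> match_scalars <;> field_simp <;> ring)
        | (refine ⟨?_, ?_, ?_⟩ <;> match_scalars <;> field_simp <;> ring)
    · rw [c0 _ (by omega) (by omega), t5 i h1 h2, up_two_succ h1 h2]
      simp [b2_mul, b2_smul, b2_zero, b2_add]
  · intro i h1 h2
    rcases idx_cases h1 h2 with rfl | rfl | rfl | rfl | ⟨h1, h2⟩
    · rw [c0 _ (by push_cast; omega) (by push_cast; omega), lo_two_last]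
      simp [b2_mul, b2_smul, b2_zero, b2_add, b2_neg, smul_smul, hq]
    · rw [show -(((m + 1 : ℕ) : ℤ) + 1) - -1 = -(m + 1) by push_cast; ring, c2, lo_two_neg_last,
        lo_two_neg_mid]
      simp [b2_mul, b2_smul, b2_zero, b2_add, b2_neg, smul_smul]
      simp only [b2_inj, b2_eq_zero, zero_eq_b2, and_true, true_and, and_self]
      first
        | (match_scalars <;> field_simp <;> ring)
        | (refine ⟨?_, ?_⟩ <;> match_scalars <;> field_simp <;> ring)
        | (refine ⟨?_, ?_, ?_⟩ <;> match_scalars <;> field_simp <;> ring)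
    · rw [show (m : ℤ) + 1 - -1 = ((m + 1 : ℕ) : ℤ) + 1 by push_cast; ring, c1, lo_two_last,
        lo_two_mid]
      simp [b2_mul, b2_smul, b2_zero, b2_add, b2_neg, smul_smul]
      simp only [b2_inj, b2_eq_zero, zero_eq_b2, and_true, true_and, and_self]
      first
        | (match_scalars <;> field_simp <;> ring)
        | (refine ⟨?_, ?_⟩ <;> match_scalars <;> field_simp <;> ring)
        | (refine ⟨?_, ?_, ?_⟩ <;> match_scalars <;> field_simp <;> ring)
    · rw [c0 _ (by push_cast; omega) (by push_cast; omega), lo_two_neg_mid]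
      simp [b2_mul, b2_smul, b2_zero, b2_add, b2_neg, smul_smul, hq]
    · rw [c0 _ (by omega) (by omega), lo_two_succ h1 h2]
      simp [b2_mul, b2_smul, b2_zero, b2_add]
  · intro i h1 h2
    rcases idx_cases h1 h2 with rfl | rfl | rfl | rfl | ⟨h1, h2⟩
    · rw [t1, up_two_last]
      simp [b2_mul, b2_smul, smul_smul, hq, mul_comm]
    · rw [t2, up_two_neg_last]
      simp [b2_mul, b2_smul, smul_smul, hq, mul_comm]
    · rw [t3, up_two_mid]
      simp [b2_mul, b2_smul, smul_smul, hq, mul_comm]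
    · rw [t4, up_two_neg_mid]
      simp [b2_mul, b2_smul, smul_smul, hq, mul_comm]
    · rw [t5 i h1 h2, up_two_succ h1 h2]
      simp [b2_mul, b2_smul, smul_smul, hq, mul_comm]
  · intro i h1 h2
    rcases idx_cases h1 h2 with rfl | rfl | rfl | rfl | ⟨h1, h2⟩
    · rw [t1, lo_two_last]
      simp [b2_mul, b2_smul, smul_smul, hq, mul_comm]
    · rw [t2, lo_two_neg_last]
      simp [b2_mul, b2_smul, smul_smul]
      simp only [b2_inj, b2_eq_zero, zero_eq_b2, and_true, true_and, and_self]
      first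
        | (match_scalars <;> field_simp <;> ring)
        | (refine ⟨?_, ?_⟩ <;> match_scalars <;> field_simp <;> ring)
        | (refine ⟨?_, ?_, ?_⟩ <;> match_scalars <;> field_simp <;> ring)
    · rw [t3, lo_two_mid]
      simp [b2_mul, b2_smul, smul_smul, hq, mul_comm]
    · rw [t4, lo_two_neg_mid]
      simp [b2_mul, b2_smul, smul_smul, hq, mul_comm]
    · rw [t5 i h1 h2, lo_two_succ h1 h2]
      simp [b2_mul, b2_smul, smul_smul, hq, mul_comm]
  · intro i h1 h2
    rcases idx_cases h1 h2 with rfl | rfl | rfl | rfl | ⟨h1, h2⟩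
    · rw [dgm_two_last]; simp [b2_mul, b2_smul, smul_smul, mul_comm]
    · rw [dgm_two_neg_last]; simp [b2_mul, b2_smul, smul_smul, mul_comm]
    · rw [dgm_two_mid]; simp [b2_mul, b2_smul, smul_smul, mul_comm]
    · rw [dgm_two_neg_mid]; simp [b2_mul, b2_smul, smul_smul, mul_comm]
    · rw [dgm_two_succ h1 h2]; simp [b2_mul, b2_smul, smul_smul]
  · intro i h1 h2
    rcases idx_cases h1 h2 with rfl | rfl | rfl | rfl | ⟨h1, h2⟩
    · rw [dgp_two_last]; simp [b2_mul, b2_smul, smul_smul, mul_comm]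
    · rw [dgp_two_neg_last]; simp [b2_mul, b2_smul, smul_smul, mul_comm]
    · rw [dgp_two_mid]; simp [b2_mul, b2_smul, smul_smul, mul_comm]
    · rw [dgp_two_neg_mid]; simp [b2_mul, b2_smul, smul_smul, mul_comm]
    · rw [dgp_two_succ h1 h2]; simp [b2_mul, b2_smul, smul_smul]
  · intro i h1 h2
    rcases idx_cases h1 h2 with rfl | rfl | rfl | rfl | ⟨h1, h2⟩
    · rw [t1, dgm_two_last]; simp [b2_mul, b2_smul, smul_smul, hq]
      simp only [b2_inj, b2_eq_zero, zero_eq_b2, and_true, true_and, and_self]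
      first
        | (match_scalars <;> field_simp <;> ring)
        | (refine ⟨?_, ?_⟩ <;> match_scalars <;> field_simp <;> ring)
        | (refine ⟨?_, ?_, ?_⟩ <;> match_scalars <;> field_simp <;> ring)
    · rw [t2, dgm_two_neg_last]; simp [b2_mul, b2_smul, smul_smul, hq]
      simp only [b2_inj, b2_eq_zero, zero_eq_b2, and_true, true_and, and_self]
      first
        | (match_scalars <;> field_simp <;> ring)
        | (refine ⟨?_, ?_⟩ <;> match_scalars <;> field_simp <;> ring)
        | (refine ⟨?_, ?_, ?_⟩ <;> match_scalars <;> field_simp <;> ring)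
    · rw [t3, dgm_two_mid]; simp [b2_mul, b2_smul, smul_smul, hq]
      simp only [b2_inj, b2_eq_zero, zero_eq_b2, and_true, true_and, and_self]
      first
        | (match_scalars <;> field_simp <;> ring)
        | (refine ⟨?_, ?_⟩ <;> match_scalars <;> field_simp <;> ring)
        | (refine ⟨?_, ?_, ?_⟩ <;> match_scalars <;> field_simp <;> ring)
    · rw [t4, dgm_two_neg_mid]; simp [b2_mul, b2_smul, smul_smul, hq]
      simp only [b2_inj, b2_eq_zero, zero_eq_b2, and_true, true_and, and_self]
      first
        | (match_scalars <;> field_simp <;> ring)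
        | (refine ⟨?_, ?_⟩ <;> match_scalars <;> field_simp <;> ring)
        | (refine ⟨?_, ?_, ?_⟩ <;> match_scalars <;> field_simp <;> ring)
    · rw [t5 i h1 h2, dgm_two_succ h1 h2]; simp [b2_mul]
  · intro i h1 h2
    rcases idx_cases h1 h2 with rfl | rfl | rfl | rfl | ⟨h1, h2⟩
    · rw [c1, show ((m + 1 : ℕ) : ℤ) + 1 + -1 = m + 1 by push_cast; ring, dgp_two_last, dgp_two_mid]
      simp [b2_mul, b2_smul, smul_smul, b2_zero, b2_neg]
      simp only [b2_inj, b2_eq_zero, zero_eq_b2, and_true, true_and, and_self]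
      first
        | (match_scalars <;> field_simp <;> ring)
        | (refine ⟨?_, ?_⟩ <;> match_scalars <;> field_simp <;> ring)
        | (refine ⟨?_, ?_, ?_⟩ <;> match_scalars <;> field_simp <;> ring)
    · rw [c0 _ (by push_cast; omega) (by push_cast; omega)]; simp
    · rw [c0 _ (by push_cast; omega) (by push_cast; omega)]; simp
    · rw [c2, show -((m : ℤ) + 1) + -1 = -(((m + 1 : ℕ) : ℤ) + 1) by push_cast; ring,
        dgp_two_neg_last, dgp_two_neg_mid]
      simp [b2_mul, b2_smul, smul_smul, b2_zero, b2_neg]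
      simp only [b2_inj, b2_eq_zero, zero_eq_b2, and_true, true_and, and_self]
      first
        | (match_scalars <;> field_simp <;> ring)
        | (refine ⟨?_, ?_⟩ <;> match_scalars <;> field_simp <;> ring)
        | (refine ⟨?_, ?_, ?_⟩ <;> match_scalars <;> field_simp <;> ring)
    · rw [c0 _ (by omega) (by omega)]; simp

/-! ### The short simple root on one site -/

lemma idx_cases_one {i : ℤ} (h1 : -((0 + 1 : ℕ) : ℤ) ≤ i) (h2 : i ≤ (0 + 1 : ℕ)) :
    i = 1 ∨ i = -1 ∨ i = 0 := by
  push_cast at *; omega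

lemma up_one_one : up q 1 1 = b2 0 0 (-q ^ 2 • 1) 0 := by
  have := up_last (q := q) (n := 0)
  simpa [par_zero] using this

lemma up_one_neg_one : up q 1 (-1) = b2 0 (-q ^ 3 • 1) 0 0 := by
  have := up_neg_last (q := q) (n := 0)
  simpa [par_zero] using this

lemma up_one_zero : up q 1 0 =
    b2 (-(aZero q * q ^ 2) • 1) 0 0 (q ^ 2 • -(aZero q * q ^ 2) • 1) := by
  rw [up_succ (n := 0) (by simp) (by simp), up]

lemma lo_one_one : lo q 1 1 = b2 0 ((q ^ 2 * (-q ^ 2)⁻¹) • 1) 0 0 := by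
  have := lo_last (q := q) (n := 0)
  simpa [par_zero] using this

lemma lo_one_neg_one : lo q 1 (-1) = b2 0 0 (-q⁻¹ • 1) 0 := by
  have := lo_neg_last (q := q) (n := 0)
  simpa [par_zero] using this

lemma lo_one_zero : lo q 1 0 =
    b2 ((aZero q * q) • 1) 0 0 ((q ^ 2)⁻¹ • (aZero q * q) • 1) := by
  rw [lo_succ (n := 0) (by simp) (by simp), lo]

lemma dgm_one_one : dgm q 1 1 = b2 (q⁻¹ • 1) 0 0 (q • 1) := by
  have := dgm_last (q := q) (n := 0)
  simpa using this

lemma dgm_one_neg_one : dgm q 1 (-1) = b2 (q • 1) 0 0 (q⁻¹ • 1) := by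
  have := dgm_neg_last (q := q) (n := 0)
  simpa using this

lemma dgp_one_one : dgp q 1 1 = b2 (q • 1) 0 0 (q⁻¹ • 1) := by
  have := dgp_last (q := q) (n := 0)
  simpa using this

lemma dgp_one_neg_one : dgp q 1 (-1) = b2 (q⁻¹ • 1) 0 0 (q • 1) := by
  have := dgp_neg_last (q := q) (n := 0)
  simpa using this

-- The short root moves the vector index along `-1 → 0 → 1`. Passing through `0` brings in the
-- scalar `a_0`, whose square is known, and the operator is odd, hence the sign `-1`.
set_option maxHeartbeats 2000000 in
lemma simpleOp_E_zero (hq : q ≠ 0) (h1q : 1 + q ^ 2 ≠ 0) :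
    SimpleOp q 1 1 (coefE q 0) (rootT q 0) (-1) (dgp q 1) (dgm q 1) (simE 1 0) (simT q 1 0) := by
  have hE : simE 1 0 = b2 0 0 1 0 := by rw [simE, if_pos rfl]
  have hT : simT q 1 0 = b2 (q⁻¹ • 1) 0 0 (q • 1) := by rw [simT, if_pos rfl]
  have hz := aZero_sq h1q
  have hz0 : aZero q ≠ 0 := fun h => by rw [h] at hz; norm_num at hz
  rw [hE, hT]
  refine ⟨?_, ?_, ?_, ?_, ?_, ?_, ?_, ?_, ?_, ?_, ?_⟩
  · intro i hi
    simp only [coefE] at hi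
    push_cast
    split_ifs at hi <;> first | omega | exact absurd rfl hi
  · rw [par_succ, par_zero]
    simp [b2_mul, b2_neg]
  · rw [par_succ, par_zero]
    simp [b2_mul]
  · intro i h1 h2
    rcases idx_cases_one h1 h2 with rfl | rfl | rfl <;>
    · simp [coefE, rootT, up_one_one, up_one_neg_one, up_one_zero, b2_mul, b2_smul, b2_zero, b2_add, b2_neg, smul_smul, b2_inj,
        b2_eq_zero, zero_eq_b2]
      try (first | constructor | skip)
      all_goals match_scalars
      all_goals field_simp
      all_goals first | ring1 | linear_combination hz | linear_combination -hz |
        linear_combination -q ^ 5 * hz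
  · intro i h1 h2
    rcases idx_cases_one h1 h2 with rfl | rfl | rfl <;>
    · simp [coefE, rootT, lo_one_one, lo_one_neg_one, lo_one_zero, b2_mul, b2_smul, b2_zero, b2_add, b2_neg, smul_smul, b2_inj,
        b2_eq_zero, zero_eq_b2]
      try (first | constructor | skip)
      all_goals match_scalars
      all_goals field_simp
      all_goals first | ring1 | linear_combination hz | linear_combination -hz |
        linear_combination -q ^ 5 * hz
  · intro i h1 h2
    rcases idx_cases_one h1 h2 with rfl | rfl | rfl <;>
    · simp [rootT, up_one_one, up_one_neg_one, up_one_zero, b2_mul, b2_smul, b2_zero, b2_add, b2_neg, smul_smul, b2_inj,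
        b2_eq_zero, zero_eq_b2]
      try (first | constructor | skip) <;> field_simp
  · intro i h1 h2
    rcases idx_cases_one h1 h2 with rfl | rfl | rfl <;>
    · simp [rootT, lo_one_one, lo_one_neg_one, lo_one_zero, b2_mul, b2_smul, b2_zero, b2_add, b2_neg, smul_smul, b2_inj,
        b2_eq_zero, zero_eq_b2]
      try (first | constructor | skip) <;> field_simp
  · intro i h1 h2
    rcases idx_cases_one h1 h2 with rfl | rfl | rfl <;>
    · simp [dgp_one_one, dgp_one_neg_one, dgp_zero, b2_mul, b2_smul, b2_zero, b2_add, b2_neg, smul_smul, b2_inj,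
        b2_eq_zero, zero_eq_b2]
      try field_simp
      try exact ⟨trivial, trivial⟩
      try (rw [← b2_one, b2_smul, smul_zero])
  · intro i h1 h2
    rcases idx_cases_one h1 h2 with rfl | rfl | rfl <;>
    · simp [dgm_one_one, dgm_one_neg_one, dgm_zero, b2_mul, b2_smul, b2_zero, b2_add, b2_neg, smul_smul, b2_inj,
        b2_eq_zero, zero_eq_b2]
      try field_simp
      try exact ⟨trivial, trivial⟩
      try (rw [← b2_one, b2_smul, smul_zero])
  · intro i h1 h2
    rcases idx_cases_one h1 h2 with rfl | rfl | rfl <;>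
    · simp [rootT, dgp_one_one, dgp_one_neg_one, dgp_zero, b2_mul, b2_smul, b2_zero, b2_add, b2_neg, smul_smul, b2_inj,
        b2_eq_zero, zero_eq_b2]
      try field_simp
      try exact ⟨trivial, trivial⟩
      try (rw [← b2_one, b2_smul, smul_zero])
  · intro i h1 h2
    rcases idx_cases_one h1 h2 with rfl | rfl | rfl <;>
    · simp [coefE, rootT, dgm_one_one, dgm_one_neg_one, dgm_zero, b2_mul, b2_smul, b2_zero, b2_add, b2_neg, smul_smul, b2_inj,
        b2_eq_zero, zero_eq_b2]
      try field_simp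
      try exact ⟨trivial, trivial⟩
      try (rw [← b2_one, b2_smul, smul_zero])

set_option maxHeartbeats 2000000 in
lemma simpleOp_F_zero (hq : q ≠ 0) (h1q : 1 + q ^ 2 ≠ 0) :
    SimpleOp q 1 (-1) (coefF q 0) (rootT q 0) (-1) (dgm q 1) (dgp q 1) (simF 1 0) (simT q 1 0) := by
  have hE : simF 1 0 = b2 0 1 0 0 := by rw [simF, if_pos rfl]
  have hT : simT q 1 0 = b2 (q⁻¹ • 1) 0 0 (q • 1) := by rw [simT, if_pos rfl]
  have hz := aZero_sq h1q
  have hz0 : aZero q ≠ 0 := fun h => by rw [h] at hz; norm_num at hz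
  rw [hE, hT]
  refine ⟨?_, ?_, ?_, ?_, ?_, ?_, ?_, ?_, ?_, ?_, ?_⟩
  · intro i hi
    simp only [coefF] at hi
    push_cast
    split_ifs at hi <;> first | omega | exact absurd rfl hi
  · rw [par_succ, par_zero]
    simp [b2_mul, b2_neg]
  · rw [par_succ, par_zero]
    simp [b2_mul]
  · intro i h1 h2
    rcases idx_cases_one h1 h2 with rfl | rfl | rfl <;>
    · simp [coefF, rootT, up_one_one, up_one_neg_one, up_one_zero, b2_mul, b2_smul, b2_zero, b2_add, b2_neg, smul_smul, b2_inj,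
        b2_eq_zero, zero_eq_b2]
      try (first | constructor | skip)
      all_goals match_scalars
      all_goals field_simp
      all_goals first | ring1 | linear_combination hz | linear_combination -hz |
        linear_combination -q ^ 5 * hz
  · intro i h1 h2
    rcases idx_cases_one h1 h2 with rfl | rfl | rfl <;>
    · simp [coefF, rootT, lo_one_one, lo_one_neg_one, lo_one_zero, b2_mul, b2_smul, b2_zero, b2_add, b2_neg, smul_smul, b2_inj,
        b2_eq_zero, zero_eq_b2]
      try (first | constructor | skip)
      all_goals match_scalars
      all_goals field_simp
      all_goals first | ring1 | linear_combination hz | linear_combination -hz |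
        linear_combination -q ^ 5 * hz
  · intro i h1 h2
    rcases idx_cases_one h1 h2 with rfl | rfl | rfl <;>
    · simp [rootT, up_one_one, up_one_neg_one, up_one_zero, b2_mul, b2_smul, b2_zero, b2_add, b2_neg, smul_smul, b2_inj,
        b2_eq_zero, zero_eq_b2]
      try (first | constructor | skip) <;> field_simp
  · intro i h1 h2
    rcases idx_cases_one h1 h2 with rfl | rfl | rfl <;>
    · simp [rootT, lo_one_one, lo_one_neg_one, lo_one_zero, b2_mul, b2_smul, b2_zero, b2_add, b2_neg, smul_smul, b2_inj,
        b2_eq_zero, zero_eq_b2]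
      try (first | constructor | skip) <;> field_simp
  · intro i h1 h2
    rcases idx_cases_one h1 h2 with rfl | rfl | rfl <;>
    · simp [dgm_one_one, dgm_one_neg_one, dgm_zero, b2_mul, b2_smul, b2_zero, b2_add, b2_neg, smul_smul, b2_inj,
        b2_eq_zero, zero_eq_b2]
      try field_simp
      try exact ⟨trivial, trivial⟩
      try (rw [← b2_one, b2_smul, smul_zero])
  · intro i h1 h2
    rcases idx_cases_one h1 h2 with rfl | rfl | rfl <;>
    · simp [dgp_one_one, dgp_one_neg_one, dgp_zero, b2_mul, b2_smul, b2_zero, b2_add, b2_neg, smul_smul, b2_inj,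
        b2_eq_zero, zero_eq_b2]
      try field_simp
      try exact ⟨trivial, trivial⟩
      try (rw [← b2_one, b2_smul, smul_zero])
  · intro i h1 h2
    rcases idx_cases_one h1 h2 with rfl | rfl | rfl <;>
    · simp [rootT, dgm_one_one, dgm_one_neg_one, dgm_zero, b2_mul, b2_smul, b2_zero, b2_add, b2_neg, smul_smul, b2_inj,
        b2_eq_zero, zero_eq_b2]
      try field_simp
      try exact ⟨trivial, trivial⟩
      try (rw [← b2_one, b2_smul, smul_zero])
  · intro i h1 h2
    rcases idx_cases_one h1 h2 with rfl | rfl | rfl <;>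
    · simp [coefF, rootT, dgp_one_one, dgp_one_neg_one, dgp_zero, b2_mul, b2_smul, b2_zero, b2_add, b2_neg, smul_smul, b2_inj,
        b2_eq_zero, zero_eq_b2]
      try field_simp
      try exact ⟨trivial, trivial⟩
      try (rw [← b2_one, b2_smul, smul_zero])

end

section

/-! ### Covariance under the simple root operators -/

variable {q : ℂ} {n : ℕ}

lemma dgm_last_form (i : ℤ) (hi : i = n + 1 ∨ i = -(n + 1)) :
    ∃ a b : ℂ, dgm q (n + 1) i = b2 (a • 1) 0 0 (b • 1) := by
  rcases hi with rfl | rfl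
  · exact ⟨_, _, dgm_last⟩
  · exact ⟨_, _, dgm_neg_last⟩

lemma dgp_last_form (i : ℤ) (hi : i = n + 1 ∨ i = -(n + 1)) :
    ∃ a b : ℂ, dgp q (n + 1) i = b2 (a • 1) 0 0 (b • 1) := by
  rcases hi with rfl | rfl
  · exact ⟨_, _, dgp_last⟩
  · exact ⟨_, _, dgp_neg_last⟩

lemma rootT_of_lt {k : ℕ} (hk : k < n) : rootT q k (n + 1) = 1 ∧ rootT q k (-(n + 1)) = 1 := by
  constructor <;>
  · rw [rootT, if_neg (by omega), if_neg (by omega)]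
    split_ifs <;> first | rfl | omega

lemma rootSign_sq (k : ℕ) : rootSign k ^ 2 = 1 := by
  rw [rootSign]; split_ifs <;> norm_num

theorem simpleOp_E (hq : q ≠ 0) (h1q : 1 + q ^ 2 ≠ 0) :
    ∀ n k : ℕ, k < n → SimpleOp q n 1 (coefE q k) (rootT q k) (rootSign k) (dgp q n) (dgm q n)
      (simE n k) (simT q n k)
  | 0, k, h => absurd h k.not_lt_zero
  | 1, k, h => by
    obtain rfl : k = 0 := by omega
    simpa [rootSign] using simpleOp_E_zero hq h1q
  | n + 2, k, h => by
    by_cases hk : k = n + 1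
    · subst hk
      simpa [rootSign] using simpleOp_E_top hq n
    · have hk' : k < n + 1 := by omega
      rw [simE, simT, if_neg hk, if_neg hk]
      obtain ⟨t1, t2⟩ := rootT_of_lt (q := q) hk'
      exact (simpleOp_E hq h1q (n + 1) k hk').succ (D := dgp q) (D' := dgm q) (rootSign_sq k)
        (fun i => dgp_succ) (fun i => dgm_succ) dgp_last_form dgm_last_form t1 t2

theorem simpleOp_F (hq : q ≠ 0) (h1q : 1 + q ^ 2 ≠ 0) :
    ∀ n k : ℕ, k < n → SimpleOp q n (-1) (coefF q k) (rootT q k) (rootSign k) (dgm q n) (dgp q n)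
      (simF n k) (simT q n k)
  | 0, k, h => absurd h k.not_lt_zero
  | 1, k, h => by
    obtain rfl : k = 0 := by omega
    simpa [rootSign] using simpleOp_F_zero hq h1q
  | n + 2, k, h => by
    by_cases hk : k = n + 1
    · subst hk
      simpa [rootSign] using simpleOp_F_top hq n
    · have hk' : k < n + 1 := by omega
      rw [simF, simT, if_neg hk, if_neg hk]
      obtain ⟨t1, t2⟩ := rootT_of_lt (q := q) hk'
      exact (simpleOp_F hq h1q (n + 1) k hk').succ (D := dgm q) (D' := dgp q) (rootSign_sq k)
        (fun i => dgm_succ) (fun i => dgp_succ) dgm_last_form dgp_last_form t1 t2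

lemma exists_simT_mul (hq : q ≠ 0) : ∀ n k : ℕ, k < n → ∃ A, simT q n k * A = 1
  | 0, k, h => absurd h k.not_lt_zero
  | 1, k, h => by
    obtain rfl : k = 0 := by omega
    exact ⟨b2 (q • 1) 0 0 (q⁻¹ • 1), by simp [simT, b2_mul, smul_smul, hq, b2_one]⟩
  | n + 2, k, h => by
    by_cases hk : k = n + 1
    · refine ⟨b2 (b2 1 0 0 (q ^ 2 • 1)) 0 0 (b2 ((q ^ 2)⁻¹ • 1) 0 0 1), ?_⟩
      simp [simT, hk, b2_mul, smul_smul, hq, b2_one]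
    · obtain ⟨A, hA⟩ := exists_simT_mul hq (n + 1) k (by omega)
      exact ⟨emb A, by rw [simT, if_neg hk, ← emb_mul, hA, emb_one]⟩

lemma coefE_self_ne (h1q : 1 + q ^ 2 ≠ 0) (k : ℕ) : coefE q k k ≠ 0 := by
  have hz0 : aZero q ≠ 0 := fun h => by have := aZero_sq h1q; rw [h] at this; norm_num at this
  rcases k with _ | k
  · simp [coefE, hz0, h1q]
  · simp [coefE]

lemma coefE_neg_ne (hq : q ≠ 0) (h1q : 1 + q ^ 2 ≠ 0) (k : ℕ) : coefE q k (-k - 1) ≠ 0 := by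
  have hz0 : aZero q ≠ 0 := fun h => by have := aZero_sq h1q; rw [h] at this; norm_num at this
  rcases k with _ | k
  · simp [coefE, hz0, h1q, hq]
  · rw [coefE, if_neg (by omega), if_neg (by omega), if_pos (by ring)]
    norm_num

lemma coefF_self_ne (hq : q ≠ 0) (h1q : 1 + q ^ 2 ≠ 0) (k : ℕ) : coefF q k (k + 1) ≠ 0 := by
  have hz0 : aZero q ≠ 0 := fun h => by have := aZero_sq h1q; rw [h] at this; norm_num at this
  rcases k with _ | k
  · simp [coefF, hz0, h1q, hq]
  · simp [coefF]

lemma coefF_neg_ne (hq : q ≠ 0) (h1q : 1 + q ^ 2 ≠ 0) (k : ℕ) : coefF q k (-k) ≠ 0 := by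
  have hz0 : aZero q ≠ 0 := fun h => by have := aZero_sq h1q; rw [h] at this; norm_num at this
  rcases k with _ | k
  · simp [coefF, hz0, h1q, hq]
  · rw [coefF, if_neg (by omega), if_neg (by omega), if_pos rfl]
    norm_num

lemma coefE_of_lt {k : ℕ} {i : ℤ} (h : (k : ℤ) < i ∨ i < -k - 1) : coefE q k i = 0 := by
  rw [coefE]
  split_ifs <;> first | rfl | omega

lemma coefF_of_lt {k : ℕ} {i : ℤ} (h : (k : ℤ) + 1 < i ∨ i < -k) : coefF q k i = 0 := by
  rw [coefF]
  split_ifs <;> first | rfl | omega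

/-- Covariance of a matrix of operators under an operator `e` of weight `τ` which shifts the
vector index by `σ`. -/
structure Cov (n : ℕ) (σ : ℤ) (T t : ℤ → ℂ) (e τ : Op n) (L : ℤ → ℤ → Op n) : Prop where
  move : ∀ i j : ℤ, (-n ≤ i ∧ i ≤ n) → (-n ≤ j ∧ j ≤ n) →
    L i j * e = T i • L (i + σ) j + t i • (e * L i j) - T (j - σ) • (L i (j - σ) * τ)
  weight : ∀ i j : ℤ, (-n ≤ i ∧ i ≤ n) → (-n ≤ j ∧ j ≤ n) →
    t i • (τ * L i j) = t j • (L i j * τ)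

section

variable {σ : ℤ} {T t : ℤ → ℂ} {ε : ℂ} {d d' : ℤ → Op n} {e τ : Op n}

/-- The sign picked up in passing one factor is undone by the other, and the term `up_i * e * lo_j`
is eliminated between the two relations. -/
lemma SimpleOp.cov_mul (h : SimpleOp q n σ T t ε d d' e τ) :
    Cov n σ T t e τ fun i j => up q n i * lo q n j where
  move i j hi hj := by
    have h1 := congrArg (· * lo q n j) (h.e_up i hi.1 hi.2)
    have h2 := congrArg (up q n i * ·) (h.e_lo j hj.1 hj.2)
    simp only [add_mul, mul_add, smul_mul_assoc, mul_smul_comm, mul_assoc] at h1 h2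
    rw [mul_assoc, mul_assoc, eq_sub_iff_add_eq, add_comm, ← h2, ← h1]
  weight i j hi hj := by
    rw [← mul_assoc, ← smul_mul_assoc, h.τ_up i hi.1 hi.2, mul_assoc, h.τ_lo j hj.1 hj.2,
      mul_smul_comm, mul_assoc]

lemma Cov.lin {L L' : ℤ → ℤ → Op n} (h : Cov n σ T t e τ L) (h' : Cov n σ T t e τ L') (a b : ℂ) :
    Cov n σ T t e τ fun i j => a • L i j + b • L' i j where
  move i j hi hj := by
    rw [add_mul, smul_mul_assoc, smul_mul_assoc, h.move i j hi hj, h'.move i j hi hj]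
    simp only [add_mul, mul_add, smul_mul_assoc, mul_smul_comm]
    module
  weight i j hi hj := by
    have h1 := h.weight i j hi hj
    have h2 := h'.weight i j hi hj
    simp only [add_mul, mul_add, smul_mul_assoc, mul_smul_comm, smul_add]
    rw [smul_comm (t i) a, smul_comm (t i) b, h1, h2, smul_comm (t j) a, smul_comm (t j) b]

lemma Cov.congr {L L' : ℤ → ℤ → Op n} (h : Cov n σ T t e τ L)
    (hT : ∀ i : ℤ, T i ≠ 0 → (-n ≤ i ∧ i ≤ n) ∧ -n ≤ i + σ ∧ i + σ ≤ n)
    (hL : ∀ i j : ℤ, (-n ≤ i ∧ i ≤ n) → L' i j = L i j) :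
    Cov n σ T t e τ L' where
  move i j hi hj := by
    rw [hL i j hi, hL i _ hi, h.move i j hi hj]
    by_cases h0 : T i = 0
    · rw [h0, zero_smul, zero_smul]
    · rw [hL _ j (hT i h0).2]
  weight i j hi hj := by rw [hL i j hi, h.weight i j hi hj]

/-- Both shifts, `i` by `σ` and `j` by `-σ`, raise `σ (i - j)` by one, that is, they move towards or
into the triangle where `L` is factorized. Only the diagonal and the entries just outside it need
more than `cov_mul`. -/
lemma SimpleOp.cov_tri (h : SimpleOp q n σ T t ε d d' e τ) (hσ : σ = 1 ∨ σ = -1)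
    {L : ℤ → ℤ → Op n} {c c' : ℂ} (h0 : ∀ i, L i i = d' i)
    (hp : ∀ i j, 0 < σ * (i - j) → L i j = c • (up q n i * lo q n j))
    (hm : ∀ i j, σ * (i - j) < 0 → L i j = 0)
    (hd : ∀ i : ℤ, (-n ≤ i ∧ i ≤ n) → c • (up q n i * lo q n i) = d' i - c' • d i) :
    Cov n σ T t e τ L where
  move i j hi hj := by
    have hσ2 : σ * σ = 1 := by rcases hσ with rfl | rfl <;> rfl
    have key := congrArg (c • ·) (h.cov_mul.move i j hi hj)
    have e1 : σ * (i + σ - j) = σ * (i - j) + 1 := by linear_combination hσ2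
    have e2 : σ * (i - (j - σ)) = σ * (i - j) + 1 := by linear_combination hσ2
    rcases lt_trichotomy (σ * (i - j)) 0 with h1 | h1 | h1
    · rw [hm i j h1]
      rcases lt_or_eq_of_le (show σ * (i - j) + 1 ≤ 0 by omega) with h2 | h2
      · rw [hm _ j (by omega), hm i _ (by omega)]
        simp
      -- One step outside the triangle both shifted entries are diagonal, and they cancel by
      -- `d_step`.
      · have : j = i + σ := by linear_combination (i - j) * hσ2 - σ * h2
        subst this
        rw [h0, add_sub_cancel_right, h0, h.d_step i hi.1 hi.2]
        simp
    · have : i = j := by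
        have : i - j = 0 := by linear_combination σ * h1 - (i - j) * hσ2
        omega
      subst this
      rw [h0, hp _ i (by omega), hp i _ (by omega)]
      have e3 := h.d_e i hi.1 hi.2
      -- On the diagonal `L` is the factorized term plus a multiple of `d`, and `d` commutes with
      -- `e` up to the weight.
      have e4 : d' i = c • (up q n i * lo q n i) + c' • d i := by rw [hd i hi]; abel
      rw [e4, add_mul, smul_mul_assoc, key, smul_mul_assoc, e3]
      simp only [mul_add, mul_smul_comm, smul_mul_assoc]
      module
    · rw [hp i j h1, hp _ j (by omega), hp i _ (by omega)]
      rw [smul_mul_assoc, key]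
      simp only [mul_smul_comm, smul_mul_assoc]
      module
  weight i j hi hj := by
    have hσ2 : σ * σ = 1 := by rcases hσ with rfl | rfl <;> rfl
    rcases lt_trichotomy (σ * (i - j)) 0 with h1 | h1 | h1
    · rw [hm i j h1]; simp
    · have : i = j := by
        have : i - j = 0 := by linear_combination σ * h1 - (i - j) * hσ2
        omega
      subst this
      rw [h0, h.τ_d' i hi.1 hi.2]
    · rw [hp i j h1, mul_smul_comm, smul_mul_assoc, smul_comm (t i), smul_comm (t j),
        h.cov_mul.weight i j hi hj]

end

lemma cov_E_Lm (hq : q ≠ 0) (h1q : 1 + q ^ 2 ≠ 0) {k : ℕ} (hk : k < n) :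
    Cov n 1 (coefE q k) (rootT q k) (simE n k) (simT q n k) (Lm q n) := by
  refine (simpleOp_E hq h1q n k hk).cov_tri (Or.inl rfl) (c := kap q) (c' := (q ^ 2)⁻¹) ?_ ?_ ?_ ?_
  · intro i; rw [Lm, if_pos rfl]
  · intro i j h; rw [Lm, if_neg (by omega), if_pos (by omega)]
  · intro i j h; rw [Lm, if_neg (by omega), if_neg (by omega)]
  · intro i hi
    rw [dgp_eq hq h1q hi.1 hi.2, smul_sub, smul_smul, smul_smul, inv_mul_cancel₀ (pow_ne_zero 2 hq),
      inv_mul_cancel_left₀ (pow_ne_zero 2 hq), one_smul, sub_sub_cancel]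

/-- For `σ = 1` the nonzero triangle of `L⁺` lies on the wrong side for `cov_tri`, but `L⁺` is a
combination of `L⁻` and the factorized matrix, both covariant. -/
lemma cov_E_Lp (hq : q ≠ 0) (h1q : 1 + q ^ 2 ≠ 0) {k : ℕ} (hk : k < n) :
    Cov n 1 (coefE q k) (rootT q k) (simE n k) (simT q n k) (Lp q n) := by
  refine ((cov_E_Lm hq h1q hk).lin (simpleOp_E hq h1q n k hk).cov_mul (q ^ 2)
    (-(q ^ 2 * kap q))).congr (simpleOp_E hq h1q n k hk).supp fun i j hi => ?_
  rw [Lp_eq hq h1q hi.1 hi.2, neg_smul, sub_eq_add_neg]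

lemma cov_F_Lp (hq : q ≠ 0) (h1q : 1 + q ^ 2 ≠ 0) {k : ℕ} (hk : k < n) :
    Cov n (-1) (coefF q k) (rootT q k) (simF n k) (simT q n k) (Lp q n) := by
  refine (simpleOp_F hq h1q n k hk).cov_tri (Or.inr rfl) (c := -q ^ 2 * kap q) (c' := q ^ 2)
    ?_ ?_ ?_ ?_
  · intro i; rw [Lp, if_pos rfl]
  · intro i j h; rw [Lp, if_neg (by omega), if_pos (by omega)]
  · intro i j h; rw [Lp, if_neg (by omega), if_neg (by omega)]
  · intro i hi
    rw [dgp_eq hq h1q hi.1 hi.2]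
    module

lemma cov_F_Lm (hq : q ≠ 0) (h1q : 1 + q ^ 2 ≠ 0) {k : ℕ} (hk : k < n) :
    Cov n (-1) (coefF q k) (rootT q k) (simF n k) (simT q n k) (Lm q n) := by
  refine ((cov_F_Lp hq h1q hk).lin (simpleOp_F hq h1q n k hk).cov_mul (q ^ 2)⁻¹
    (kap q)).congr (simpleOp_F hq h1q n k hk).supp fun i j hi => ?_
  rw [Lp_eq hq h1q hi.1 hi.2, smul_sub, smul_smul, smul_smul, inv_mul_cancel₀ (pow_ne_zero 2 hq),
    inv_mul_cancel_left₀ (pow_ne_zero 2 hq), one_smul, sub_add_cancel]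

/-! ### Coproducts of the root operators and covariance of defects -/

/-- The coproduct of a simple root operator. -/
def cop (e τ : Op n) : Op₂ n := e ⊗ₖ 1 + τ ⊗ₖ e

/-- The opposite coproduct of a simple root operator. -/
def opc (e τ : Op n) : Op₂ n := 1 ⊗ₖ e + e ⊗ₖ τ

lemma sum_shift {M : Type*} [AddCommMonoid M] (σ : ℤ) (s : Finset ℤ) (g : ℤ → M)
    (hg : ∀ k, g k ≠ 0 → k ∈ s ∧ k + σ ∈ s) : ∑ k ∈ s, g (k - σ) = ∑ k ∈ s, g k := by
  refine Finset.sum_bij_ne_zero (fun k _ _ => k - σ) ?_ ?_ ?_ ?_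
  · intro k _ h; exact (hg _ h).1
  · intro a _ _ b _ _ h; simpa using h
  · intro b _ h; exact ⟨b + σ, (hg b h).2, by simpa using h, by simp⟩
  · intro k _ _; rfl

section

variable {σ : ℤ} {T t : ℤ → ℂ} {e τ : Op n} {L L' : ℤ → ℤ → Op n}

/-- Besides the outer shifts, moving `e` through the two factors shifts the inner index `k` twice
with opposite signs. The two sums agree after a translation of `k`, because `T` vanishes whenever
the shift would leave the range. -/
lemma pr_mul_cop (h : Cov n σ T t e τ L) (h' : Cov n σ T t e τ L')
    (hT : ∀ i : ℤ, T i ≠ 0 → (-n ≤ i ∧ i ≤ n) ∧ -n ≤ i + σ ∧ i + σ ≤ n)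
    {i j : ℤ} (hi : -n ≤ i ∧ i ≤ n) (hj : -n ≤ j ∧ j ≤ n) :
    pr L L' i j * cop e τ = T i • pr L L' (i + σ) j + t i • (cop e τ * pr L L' i j) -
      T (j - σ) • (pr L L' i (j - σ) * (τ ⊗ₖ τ)) := by
  have hs := sum_shift σ (Finset.Icc (-(n : ℤ)) n)
    (fun k => T k • ((L i k * τ) ⊗ₖ L' (k + σ) j)) (fun k hk => by
      have := hT k (fun h0 => hk (by rw [h0, zero_smul]))
      simpa only [Finset.mem_Icc] using this)
  simp only [sub_add_cancel] at hs
  have key : ∀ k ∈ Finset.Icc (-(n : ℤ)) n, (L i k ⊗ₖ L' k j) * cop e τ =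
      (T i • (L (i + σ) k ⊗ₖ L' k j) + t i • (cop e τ * (L i k ⊗ₖ L' k j)) -
        T (j - σ) • ((L i k ⊗ₖ L' k (j - σ)) * (τ ⊗ₖ τ))) +
      (T k • ((L i k * τ) ⊗ₖ L' (k + σ) j) - T (k - σ) • ((L i (k - σ) * τ) ⊗ₖ L' k j)) := by
    intro k hk
    rw [Finset.mem_Icc] at hk
    have w := congrArg (fun A => A ⊗ₖ (e * L' k j)) (h.weight i k hi hk)
    simp only [Matrix.smul_kronecker] at w
    simp only [cop, mul_add, add_mul, ← Matrix.mul_kronecker_mul, mul_one, one_mul,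
      h.move i k hi hk, h'.move k j hk hj, Matrix.add_kronecker, Matrix.kronecker_add,
      sub_eq_add_neg, Matrix.smul_kronecker, Matrix.kronecker_smul, smul_add, w,
      ← neg_smul]
    abel
  rw [pr, Finset.sum_mul, Finset.sum_congr rfl key, Finset.sum_add_distrib,
    Finset.sum_sub_distrib, Finset.sum_sub_distrib, hs, sub_self, add_zero,
    Finset.sum_add_distrib, pr, pr, ← Finset.smul_sum, ← Finset.smul_sum, ← Finset.smul_sum,
    Finset.mul_sum, Finset.sum_mul]

lemma opr_mul_opc (h : Cov n σ T t e τ L) (h' : Cov n σ T t e τ L')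
    (hT : ∀ i : ℤ, T i ≠ 0 → (-n ≤ i ∧ i ≤ n) ∧ -n ≤ i + σ ∧ i + σ ≤ n)
    {i j : ℤ} (hi : -n ≤ i ∧ i ≤ n) (hj : -n ≤ j ∧ j ≤ n) :
    opr L L' i j * opc e τ = T i • opr L L' (i + σ) j + t i • (opc e τ * opr L L' i j) -
      T (j - σ) • (opr L L' i (j - σ) * (τ ⊗ₖ τ)) := by
  have hs := sum_shift σ (Finset.Icc (-(n : ℤ)) n)
    (fun k => T k • (L (k + σ) j ⊗ₖ (L' i k * τ))) (fun k hk => by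
      have := hT k (fun h0 => hk (by rw [h0, zero_smul]))
      simpa only [Finset.mem_Icc] using this)
  simp only [sub_add_cancel] at hs
  have key : ∀ k ∈ Finset.Icc (-(n : ℤ)) n, (L k j ⊗ₖ L' i k) * opc e τ =
      (T i • (L k j ⊗ₖ L' (i + σ) k) + t i • (opc e τ * (L k j ⊗ₖ L' i k)) -
        T (j - σ) • ((L k (j - σ) ⊗ₖ L' i k) * (τ ⊗ₖ τ))) +
      (T k • (L (k + σ) j ⊗ₖ (L' i k * τ)) - T (k - σ) • (L k j ⊗ₖ (L' i (k - σ) * τ))) := by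
    intro k hk
    rw [Finset.mem_Icc] at hk
    have w := congrArg (fun A => (e * L k j) ⊗ₖ A) (h'.weight i k hi hk)
    simp only [Matrix.kronecker_smul] at w
    simp only [opc, mul_add, add_mul, ← Matrix.mul_kronecker_mul, mul_one, one_mul,
      h'.move i k hi hk, h.move k j hk hj, Matrix.add_kronecker, Matrix.kronecker_add,
      sub_eq_add_neg, Matrix.smul_kronecker, Matrix.kronecker_smul, smul_add, w,
      ← neg_smul]
    abel
  rw [opr, Finset.sum_mul, Finset.sum_congr rfl key, Finset.sum_add_distrib,
    Finset.sum_sub_distrib, Finset.sum_sub_distrib, hs, sub_self, add_zero,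
    Finset.sum_add_distrib, opr, opr, ← Finset.smul_sum, ← Finset.smul_sum, ← Finset.smul_sum,
    Finset.mul_sum, Finset.sum_mul]

/-- Covariance of a matrix of defects. -/
def DefectCov (n : ℕ) (σ : ℤ) (T t : ℤ → ℂ) (e τ : Op n) (D : ℤ → ℤ → Op₂ n) : Prop :=
  ∀ i j : ℤ, (-n ≤ i ∧ i ≤ n) → (-n ≤ j ∧ j ≤ n) →
    D i j * cop e τ = T i • D (i + σ) j + t i • (opc e τ * D i j) -
      T (j - σ) • (D i (j - σ) * (τ ⊗ₖ τ))

/-- `X` carries the coproduct of `e` to the opposite one, so the covariance laws of the two products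
have the same form and can be subtracted. -/
lemma defectCov_dfct (h : Cov n σ T t e τ L) (h' : Cov n σ T t e τ L')
    (hT : ∀ i : ℤ, T i ≠ 0 → (-n ≤ i ∧ i ≤ n) ∧ -n ≤ i + σ ∧ i + σ ≤ n) {X : Op₂ n}
    (hX : X * cop e τ = opc e τ * X) (hX' : X * (τ ⊗ₖ τ) = (τ ⊗ₖ τ) * X) :
    DefectCov n σ T t e τ fun i j => dfct X i j L L' := by
  intro i j hi hj
  simp only [dfct_apply]
  rw [sub_mul, mul_assoc, hX, ← mul_assoc, opr_mul_opc h h' hT hi hj, mul_assoc X,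
    pr_mul_cop h h' hT hi hj]
  simp only [sub_mul, add_mul, mul_add, mul_sub, smul_mul_assoc, mul_smul_comm, mul_assoc,
    smul_sub, ← hX']
  rw [← mul_assoc X (cop e τ), hX, mul_assoc]
  abel

lemma DefectCov.lin {D D' : ℤ → ℤ → Op₂ n} (h : DefectCov n σ T t e τ D)
    (h' : DefectCov n σ T t e τ D') (a b : ℂ) :
    DefectCov n σ T t e τ fun i j => a • D i j + b • D' i j := by
  intro i j hi hj
  simp only [add_mul, mul_add, smul_mul_assoc, mul_smul_comm, h i j hi hj, h' i j hi hj]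
  module

/-- Vanishing of a defect propagates along the columns. -/
lemma DefectCov.col {D : ℤ → ℤ → Op₂ n} (h : DefectCov n σ T t e τ D) {i j : ℤ}
    (hi : -n ≤ i ∧ i ≤ n) (hj : -n ≤ j ∧ j ≤ n) (hTi : T i = 0) (hTj : T (j - σ) ≠ 0)
    (hτ : ∃ A, τ * A = 1) (h0 : D i j = 0) : D i (j - σ) = 0 := by
  obtain ⟨A, hA⟩ := hτ
  have := h i j hi hj
  rw [h0, hTi, zero_mul, zero_smul, mul_zero, smul_zero, add_zero, zero_sub, eq_comm, neg_eq_zero,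
    smul_eq_zero_iff_right hTj] at this
  have h2 := congrArg (· * (A ⊗ₖ A)) this
  simpa only [mul_assoc, ← Matrix.mul_kronecker_mul, hA, Matrix.one_kronecker_one, mul_one,
    zero_mul] using h2

/-- Vanishing of a row of defects propagates to the next row. -/
lemma DefectCov.row {D : ℤ → ℤ → Op₂ n} (h : DefectCov n σ T t e τ D)
    (hT : ∀ i : ℤ, T i ≠ 0 → (-n ≤ i ∧ i ≤ n) ∧ -n ≤ i + σ ∧ i + σ ≤ n) {i : ℤ}
    (hi : -n ≤ i ∧ i ≤ n) (hTi : T i ≠ 0) (h0 : ∀ j : ℤ, (-n ≤ j ∧ j ≤ n) → D i j = 0)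
    {j : ℤ} (hj : -n ≤ j ∧ j ≤ n) : D (i + σ) j = 0 := by
  have := h i j hi hj
  have h1 : T (j - σ) • (D i (j - σ) * (τ ⊗ₖ τ)) = 0 := by
    by_cases h2 : T (j - σ) = 0
    · rw [h2, zero_smul]
    · rw [h0 _ (hT _ h2).1, zero_mul, smul_zero]
  rw [h1, h0 j hj, zero_mul, mul_zero, smul_zero, add_zero, sub_zero, eq_comm,
    smul_eq_zero_iff_right hTi] at this
  exact this

end

/-- A matrix of defects which is covariant under all simple root operators and has a vanishing
corner vanishes. -/
theorem defect_eq_zero (hq : q ≠ 0) (h1q : 1 + q ^ 2 ≠ 0) {D : ℤ → ℤ → Op₂ n}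
    (hE : ∀ k < n, DefectCov n 1 (coefE q k) (rootT q k) (simE n k) (simT q n k) D)
    (hF : ∀ k < n, DefectCov n (-1) (coefF q k) (rootT q k) (simF n k) (simT q n k) D)
    (h0 : D n n = 0) {i j : ℤ} (hi : -n ≤ i ∧ i ≤ n) (hj : -n ≤ j ∧ j ≤ n) : D i j = 0 := by
  -- In row `n` the coefficient `coefE q k n` vanishes for every `k < n`, so a raising operator only
  -- moves the column, one step down.
  have top : ∀ m : ℕ, m ≤ 2 * n → D n (n - m) = 0 := by
    intro m
    induction m with
    | zero => intro _; simpa using h0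
    | succ m ih =>
      intro hm
      -- The step from column `n - m` to `n - m - 1` is made by the root `n - m - 1` on the positive
      -- side and by `m - n` otherwise.
      obtain ⟨k, hk, hT⟩ : ∃ k < n, coefE q k (n - m - 1) ≠ 0 := by
        rcases le_or_gt (1 : ℤ) (n - m) with h | h
        · refine ⟨((n : ℤ) - m - 1).toNat, by omega, ?_⟩
          have := coefE_self_ne h1q ((n : ℤ) - m - 1).toNat
          rwa [Int.toNat_of_nonneg (by omega)] at this
        · refine ⟨((m : ℤ) - n).toNat, by omega, ?_⟩
          have := coefE_neg_ne hq h1q ((m : ℤ) - n).toNat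
          rwa [Int.toNat_of_nonneg (by omega), neg_sub] at this
      have := (hE k hk).col (i := n) (j := n - m) (by omega) (by omega)
        (coefE_of_lt (by omega)) hT (exists_simT_mul hq n k hk) (ih (by omega))
      rw [← this]
      congr 1
      push_cast
      ring
  -- The lowering operators carry a vanishing row to the row below it.
  have rows : ∀ m : ℕ, m ≤ 2 * n → ∀ j : ℤ, (-n ≤ j ∧ j ≤ n) → D (n - m) j = 0 := by
    intro m
    induction m with
    | zero =>
      intro _ j hj
      have := top (n - j).toNat (by omega)
      rw [Int.toNat_of_nonneg (by omega), sub_sub_cancel] at this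
      simpa using this
    | succ m ih =>
      intro hm j hj
      obtain ⟨k, hk, hT⟩ : ∃ k < n, coefF q k (n - m) ≠ 0 := by
        rcases le_or_gt (1 : ℤ) (n - m) with h | h
        · refine ⟨((n : ℤ) - m - 1).toNat, by omega, ?_⟩
          have := coefF_self_ne hq h1q ((n : ℤ) - m - 1).toNat
          rwa [Int.toNat_of_nonneg (by omega), sub_add_cancel] at this
        · refine ⟨((m : ℤ) - n).toNat, by omega, ?_⟩
          have := coefF_neg_ne hq h1q ((m : ℤ) - n).toNat
          rwa [Int.toNat_of_nonneg (by omega), neg_sub] at this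
      have := (hF k hk).row (simpleOp_F hq h1q n k hk).supp (i := n - m) (by omega) hT
        (ih (by omega)) hj
      rw [← this]
      congr 1
      push_cast
      ring
  have := rows (n - i).toNat (by omega) j hj
  rwa [Int.toNat_of_nonneg (by omega), sub_sub_cancel] at this

end

section

/-! ### Block forms of the products -/

variable {q : ℂ} {n : ℕ}

lemma sum_Icc_succ {M : Type*} [AddCommMonoid M] (f : ℤ → M) :
    ∑ k ∈ Finset.Icc (-((n + 1 : ℕ) : ℤ)) (n + 1 : ℕ), f k =
      ∑ k ∈ Finset.Icc (-(n : ℤ)) n, f k + f (n + 1) + f (-(n + 1)) := by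
  have h : Finset.Icc (-((n + 1 : ℕ) : ℤ)) (n + 1 : ℕ) =
      insert (-((n : ℤ) + 1)) (insert ((n : ℤ) + 1) (Finset.Icc (-(n : ℤ)) n)) := by
    ext k
    simp only [Finset.mem_Icc, Finset.mem_insert]
    push_cast
    omega
  rw [h, Finset.sum_insert, Finset.sum_insert, add_comm, add_comm (f (n + 1))]
  · simp
  · simp only [Finset.mem_Icc, Finset.mem_insert]
    omega

lemma Lm_succ (hq : q ≠ 0) {i j : ℤ} (hi : -n ≤ i ∧ i ≤ n) (hj : -n ≤ j ∧ j ≤ n) :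
    Lm q (n + 1) i j = emb (Lm q n i j) := by
  rw [Lm, Lm]
  split_ifs
  · exact dgm_succ hi.1 hi.2
  · rw [up_succ hi.1 hi.2, lo_succ hj.1 hj.2, b2_mul, emb_smul, emb]
    simp [smul_smul, hq]
  · exact emb_zero.symm

lemma Lp_succ (hq : q ≠ 0) {i j : ℤ} (hi : -n ≤ i ∧ i ≤ n) (hj : -n ≤ j ∧ j ≤ n) :
    Lp q (n + 1) i j = emb (Lp q n i j) := by
  rw [Lp, Lp]
  split_ifs
  · exact dgp_succ hi.1 hi.2
  · rw [up_succ hi.1 hi.2, lo_succ hj.1 hj.2, b2_mul, emb_smul, emb]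
    simp [smul_smul, hq]
  · exact emb_zero.symm

lemma Lm_last {j : ℤ} (hj : -n ≤ j ∧ j ≤ n) :
    Lm q (n + 1) (n + 1) j = (kap q * (-q ^ 2) ^ (n + 1)) • b2 0 0 (par n * lo q n j) 0 := by
  rw [Lm, if_neg (by omega), if_pos (by omega), up_last, lo_succ hj.1 hj.2, b2_mul, b2_smul,
    b2_smul]
  simp [smul_smul]

lemma Lm_last_last : Lm q (n + 1) (n + 1) (n + 1) = b2 (q⁻¹ • 1) 0 0 (q • 1) := by
  rw [Lm, if_pos rfl, dgm_last]

lemma Lm_last_neg : Lm q (n + 1) (n + 1) (-(n + 1)) = 0 := by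
  rw [Lm, if_neg (by omega), if_pos (by omega),
    up_mul_lo_neg (by omega) (by push_cast; omega) (by push_cast; omega), smul_zero]

lemma Lm_of_lt {i j : ℤ} (h : i < j) : Lm q n i j = 0 := by
  rw [Lm, if_neg (by omega), if_neg (by omega)]

lemma Lp_of_lt {i j : ℤ} (h : j < i) : Lp q n i j = 0 := by
  rw [Lp, if_neg (by omega), if_neg (by omega)]

lemma Lp_last_last : Lp q (n + 1) (n + 1) (n + 1) = b2 (q • 1) 0 0 (q⁻¹ • 1) := by
  rw [Lp, if_pos rfl, dgp_last]

lemma Lp_neg_last_last : Lp q (n + 1) (-(n + 1)) (-(n + 1)) = b2 (q⁻¹ • 1) 0 0 (q • 1) := by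
  rw [Lp, if_pos rfl, dgp_neg_last]

lemma Lp_neg_last {j : ℤ} (hq : q ≠ 0) (hj : -n ≤ j ∧ j ≤ n) : Lp q (n + 1) (-(n + 1)) j =
    (-kap q * ((-1) ^ (n + 1) * q ^ 3)) • b2 0 (par n * lo q n j) 0 0 := by
  rw [Lp, if_neg (by omega), if_pos (by omega), up_neg_last, lo_succ hj.1 hj.2, b2_mul, b2_smul,
    b2_smul]
  simp only [zero_mul, mul_zero, add_zero, zero_add, smul_zero, smul_mul_assoc, mul_smul_comm,
    smul_smul]
  congr 2
  field_simp

lemma Lp_neg_last_pos : Lp q (n + 1) (-(n + 1)) (n + 1) = 0 := by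
  have := up_mul_lo_neg (q := q) (n := n + 1) (i := -(n + 1)) (by omega) (by push_cast; omega)
    (by push_cast; omega)
  rw [neg_neg] at this
  rw [Lp, if_neg (by omega), if_pos (by omega), this, smul_zero]

lemma Lp_mid_last {i : ℤ} (hi : -n ≤ i ∧ i ≤ n) : Lp q (n + 1) i (n + 1) =
    (-q ^ 2 * kap q * (q ^ 2 * ((-q ^ 2) ^ (n + 1))⁻¹)) • b2 0 (up q n i * par n) 0 0 := by
  rw [Lp, if_neg (by omega), if_pos (by omega), lo_last, up_succ hi.1 hi.2, b2_mul, b2_smul,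
    b2_smul]
  simp [smul_smul]

/-- This identifies `strR` inside the entry `(n+1, 0)` of `L⁻`; the parity operator comes from the
block of `up_{n+1}`. -/
lemma par_mul_lo_zero_right (n : ℕ) :
    (1 : Op n) ⊗ₖ (par n * lo q n 0) = (aZero q * q) • strR q n := by
  induction n with
  | zero => rw [par_zero, lo, one_mul, Matrix.kronecker_smul, Matrix.one_kronecker_one, strR]
  | succ n ih =>
    rw [par_succ, lo_succ (by omega) (by omega), b2_mul, ← b2_one, strR]
    simp only [zero_mul, mul_zero, add_zero, zero_add, diag_kron_diag, neg_mul, mul_smul_comm,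
      ← smul_neg, Matrix.kronecker_smul, ih, wt_smul, smul_zero]
    simp only [← neg_smul, ← neg_one_smul ℂ (par n * lo q n 0), Matrix.kronecker_smul, ih]
    congr 1 <;> module

lemma par_mul_lo_zero_left (n : ℕ) :
    (par n * lo q n 0) ⊗ₖ (1 : Op n) = (aZero q * q) • strL q n := by
  induction n with
  | zero => rw [par_zero, lo, one_mul, Matrix.smul_kronecker, Matrix.one_kronecker_one, strL]
  | succ n ih =>
    rw [par_succ, lo_succ (by omega) (by omega), b2_mul, ← b2_one, strL]
    simp only [zero_mul, mul_zero, add_zero, zero_add, diag_kron_diag, neg_mul, mul_smul_comm,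
      ← smul_neg, Matrix.smul_kronecker, ih, wt_smul, smul_zero]
    simp only [← neg_smul, ← neg_one_smul ℂ (par n * lo q n 0), Matrix.smul_kronecker, ih]
    congr 1 <;> module

lemma par_mul_lo_succ {j : ℤ} (hj : -n ≤ j ∧ j ≤ n) : par (n + 1) * lo q (n + 1) j =
    b2 (par n * lo q n j) 0 0 (-(q ^ 2)⁻¹ • (par n * lo q n j)) := by
  rw [par_succ, lo_succ hj.1 hj.2, b2_mul]
  simp

lemma par_mul_lo_last : par (n + 1) * lo q (n + 1) (n + 1) =
    (q ^ 2 * ((-q ^ 2) ^ (n + 1))⁻¹) • b2 0 1 0 0 := by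
  rw [par_succ, lo_last, b2_mul, b2_smul]
  simp [par_mul_par]

lemma par_mul_lo_neg_last : par (n + 1) * lo q (n + 1) (-(n + 1)) =
    (-((-1) ^ (n + 1) * q⁻¹)) • b2 0 0 1 0 := by
  rw [par_succ, lo_neg_last, b2_mul, b2_smul]
  simp [par_mul_par]

lemma up_mul_par_succ {j : ℤ} (hj : -n ≤ j ∧ j ≤ n) : up q (n + 1) j * par (n + 1) =
    b2 (up q n j * par n) 0 0 (-q ^ 2 • (up q n j * par n)) := by
  rw [par_succ, up_succ hj.1 hj.2, b2_mul]
  simp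

lemma up_last_mul_par : up q (n + 1) (n + 1) * par (n + 1) = (-q ^ 2) ^ (n + 1) • b2 0 0 1 0 := by
  rw [par_succ, up_last, b2_mul, b2_smul]
  simp [par_mul_par]

lemma up_neg_last_mul_par : up q (n + 1) (-(n + 1)) * par (n + 1) =
    (-((-1) ^ (n + 1) * q ^ 3)) • b2 0 1 0 0 := by
  rw [par_succ, up_neg_last, b2_mul, b2_smul]
  simp [par_mul_par]

lemma sum_wt {ι : Type*} (s : Finset ι) (f1 f2 f3 f4 f5 f6 : ι → Op₂ n) :
    ∑ k ∈ s, wt (f1 k) (f2 k) (f3 k) (f4 k) (f5 k) (f6 k) =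
      wt (∑ k ∈ s, f1 k) (∑ k ∈ s, f2 k) (∑ k ∈ s, f3 k) (∑ k ∈ s, f4 k) (∑ k ∈ s, f5 k)
        (∑ k ∈ s, f6 k) := by
  classical
  induction s using Finset.induction_on with
  | empty => simp [wt_zero]
  | insert a s ha ih => simp only [Finset.sum_insert ha, ih, wt_add]

lemma sum_rs {ι : Type*} (s : Finset ι) (f1 f2 f3 f4 : ι → Op₂ n) :
    ∑ k ∈ s, rs (f1 k) (f2 k) (f3 k) (f4 k) =
      rs (∑ k ∈ s, f1 k) (∑ k ∈ s, f2 k) (∑ k ∈ s, f3 k) (∑ k ∈ s, f4 k) := by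
  classical
  induction s using Finset.induction_on with
  | empty =>
    have := rs_smul (n := n) 0 0 0 0 0
    simp only [zero_smul] at this
    simp [← this]
  | insert a s ha ih => simp only [Finset.sum_insert ha, ih, rs_add]

lemma sum_lw {ι : Type*} (s : Finset ι) (f1 f2 f3 f4 : ι → Op₂ n) :
    ∑ k ∈ s, lw (f1 k) (f2 k) (f3 k) (f4 k) =
      lw (∑ k ∈ s, f1 k) (∑ k ∈ s, f2 k) (∑ k ∈ s, f3 k) (∑ k ∈ s, f4 k) := by
  classical
  induction s using Finset.induction_on with
  | empty =>
    have := lw_smul (n := n) 0 0 0 0 0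
    simp only [zero_smul] at this
    simp [← this]
  | insert a s ha ih => simp only [Finset.sum_insert ha, ih, lw_add]

lemma Icc_zero_sum {M : Type*} [AddCommMonoid M] (f : ℤ → M) :
    ∑ k ∈ Finset.Icc (-((0 : ℕ) : ℤ)) (0 : ℕ), f k = f 0 := by simp

lemma kap_mul_sq (hq : q ≠ 0) : kap q * q ^ 2 = q - q⁻¹ ^ 3 := by
  rw [kap]; field_simp

/-- The old indices contribute block-diagonally. Of the two new ones, `-(n+1)` drops out by
triangularity and `n+1` gives the off-diagonal `strR`, with `q - q⁻³ = kap q²`. The three sums that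
follow have the same structure. -/
lemma sum_vecB (hq : q ≠ 0) (n : ℕ) :
    ∑ k ∈ Finset.Icc (-(n : ℤ)) n, (par n * lo q n k) ⊗ₖ Lm q n k 0 =
      (aZero q * q) • vecB q n := by
  induction n with
  | zero =>
    rw [Icc_zero_sum, Lm, if_pos rfl, dgm, par_zero, lo, one_mul, Matrix.smul_kronecker,
      Matrix.one_kronecker_one, vecB]
  | succ n ih =>
    have hp : (-q ^ 2 : ℂ) ^ (n + 1) ≠ 0 := pow_ne_zero _ (neg_ne_zero.2 (pow_ne_zero 2 hq))
    have e : ∀ k ∈ Finset.Icc (-(n : ℤ)) n, (par (n + 1) * lo q (n + 1) k) ⊗ₖ Lm q (n + 1) k 0 =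
        wt ((par n * lo q n k) ⊗ₖ Lm q n k 0) ((par n * lo q n k) ⊗ₖ Lm q n k 0) 0 0 (-(q ^ 2)⁻¹ • ((par n * lo q n k) ⊗ₖ Lm q n k 0)) (-(q ^ 2)⁻¹ • ((par n * lo q n k) ⊗ₖ Lm q n k 0)) := fun k hk => by
      rw [Finset.mem_Icc] at hk
      rw [par_mul_lo_succ hk, Lm_succ hq hk ⟨by omega, by omega⟩, emb_eq, diag_kron_diag,
        Matrix.smul_kronecker]
    rw [sum_Icc_succ, Finset.sum_congr rfl e, sum_wt]
    simp only [← Finset.smul_sum, ih, Finset.sum_const_zero]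
    rw [Lm_of_lt (i := -(n + 1)) (by omega), Matrix.kronecker_zero, add_zero,
      Lm_last ⟨by omega, by omega⟩, par_mul_lo_last, Matrix.smul_kronecker, Matrix.kronecker_smul,
      upp_kron_low, par_mul_lo_zero_right, vecB, smul_smul, wt_smul, wt_smul, wt_add]
    simp only [smul_zero, add_zero, zero_add, smul_smul, wt_smul]
    rw [← kap_mul_sq hq]
    congr 1 <;> match_scalars <;> field_simp

lemma sum_vecBt (hq : q ≠ 0) (n : ℕ) :
    ∑ k ∈ Finset.Icc (-(n : ℤ)) n, (par n * lo q n k) ⊗ₖ Lp q n k 0 =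
      (aZero q * q) • vecBt q n := by
  induction n with
  | zero =>
    rw [Icc_zero_sum, Lp, if_pos rfl, dgp, par_zero, lo, one_mul, Matrix.smul_kronecker,
      Matrix.one_kronecker_one, vecBt]
  | succ n ih =>
    have hp : (-q ^ 2 : ℂ) ^ (n + 1) ≠ 0 := pow_ne_zero _ (neg_ne_zero.2 (pow_ne_zero 2 hq))
    have e : ∀ k ∈ Finset.Icc (-(n : ℤ)) n, (par (n + 1) * lo q (n + 1) k) ⊗ₖ Lp q (n + 1) k 0 =
        wt ((par n * lo q n k) ⊗ₖ Lp q n k 0) ((par n * lo q n k) ⊗ₖ Lp q n k 0) 0 0 (-(q ^ 2)⁻¹ • ((par n * lo q n k) ⊗ₖ Lp q n k 0)) (-(q ^ 2)⁻¹ • ((par n * lo q n k) ⊗ₖ Lp q n k 0)) := fun k hk => by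
      rw [Finset.mem_Icc] at hk
      rw [par_mul_lo_succ hk, Lp_succ hq hk ⟨by omega, by omega⟩, emb_eq, diag_kron_diag,
        Matrix.smul_kronecker]
    rw [sum_Icc_succ, Finset.sum_congr rfl e, sum_wt]
    simp only [← Finset.smul_sum, ih, Finset.sum_const_zero]
    rw [Lp_of_lt (i := n + 1) (by omega), Matrix.kronecker_zero, add_zero,
      Lp_neg_last hq ⟨by omega, by omega⟩, par_mul_lo_neg_last, Matrix.smul_kronecker,
      Matrix.kronecker_smul, low_kron_upp, par_mul_lo_zero_right, vecBt, smul_smul, wt_smul, wt_smul,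
      wt_add]
    simp only [smul_zero, add_zero, zero_add, smul_smul, wt_smul]
    have h1 : ((-1 : ℂ) ^ (n + 1)) * (-1) ^ (n + 1) = 1 := by rw [← mul_pow]; norm_num
    rw [← kap_mul_sq hq]
    congr 1 <;> match_scalars <;> field_simp
    linear_combination (kap q * aZero q) * h1

lemma sum_vecA (hq : q ≠ 0) (n : ℕ) :
    ∑ k ∈ Finset.Icc (-(n : ℤ)) n, Lm q n k 0 ⊗ₖ (par n * lo q n k) =
      (aZero q * q) • vecA q n := by
  induction n with
  | zero =>
    rw [Icc_zero_sum, Lm, if_pos rfl, dgm, par_zero, lo, one_mul, Matrix.kronecker_smul,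
      Matrix.one_kronecker_one, vecA]
  | succ n ih =>
    have hp : (-q ^ 2 : ℂ) ^ (n + 1) ≠ 0 := pow_ne_zero _ (neg_ne_zero.2 (pow_ne_zero 2 hq))
    have e : ∀ k ∈ Finset.Icc (-(n : ℤ)) n, Lm q (n + 1) k 0 ⊗ₖ (par (n + 1) * lo q (n + 1) k) =
        wt (Lm q n k 0 ⊗ₖ (par n * lo q n k)) (-(q ^ 2)⁻¹ • (Lm q n k 0 ⊗ₖ (par n * lo q n k))) 0 0 (Lm q n k 0 ⊗ₖ (par n * lo q n k)) (-(q ^ 2)⁻¹ • (Lm q n k 0 ⊗ₖ (par n * lo q n k))) := fun k hk => by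
      rw [Finset.mem_Icc] at hk
      rw [par_mul_lo_succ hk, Lm_succ hq hk ⟨by omega, by omega⟩, emb_eq, diag_kron_diag,
        Matrix.kronecker_smul]
    rw [sum_Icc_succ, Finset.sum_congr rfl e, sum_wt]
    simp only [← Finset.smul_sum, ih, Finset.sum_const_zero]
    rw [Lm_of_lt (i := -(n + 1)) (by omega), Matrix.zero_kronecker, add_zero,
      Lm_last ⟨by omega, by omega⟩, par_mul_lo_last, Matrix.smul_kronecker, Matrix.kronecker_smul,
      low_kron_upp, par_mul_lo_zero_left, vecA, smul_smul, wt_smul, wt_smul, wt_add]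
    simp only [smul_zero, add_zero, zero_add, smul_smul, wt_smul]
    rw [← kap_mul_sq hq]
    congr 1 <;> match_scalars <;> field_simp

lemma sum_vecAt (hq : q ≠ 0) (n : ℕ) :
    ∑ k ∈ Finset.Icc (-(n : ℤ)) n, Lp q n k 0 ⊗ₖ (par n * lo q n k) =
      (aZero q * q) • vecAt q n := by
  induction n with
  | zero =>
    rw [Icc_zero_sum, Lp, if_pos rfl, dgp, par_zero, lo, one_mul, Matrix.kronecker_smul,
      Matrix.one_kronecker_one, vecAt]
  | succ n ih =>
    have hp : (-q ^ 2 : ℂ) ^ (n + 1) ≠ 0 := pow_ne_zero _ (neg_ne_zero.2 (pow_ne_zero 2 hq))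
    have e : ∀ k ∈ Finset.Icc (-(n : ℤ)) n, Lp q (n + 1) k 0 ⊗ₖ (par (n + 1) * lo q (n + 1) k) =
        wt (Lp q n k 0 ⊗ₖ (par n * lo q n k)) (-(q ^ 2)⁻¹ • (Lp q n k 0 ⊗ₖ (par n * lo q n k))) 0 0 (Lp q n k 0 ⊗ₖ (par n * lo q n k)) (-(q ^ 2)⁻¹ • (Lp q n k 0 ⊗ₖ (par n * lo q n k))) := fun k hk => by
      rw [Finset.mem_Icc] at hk
      rw [par_mul_lo_succ hk, Lp_succ hq hk ⟨by omega, by omega⟩, emb_eq, diag_kron_diag,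
        Matrix.kronecker_smul]
    rw [sum_Icc_succ, Finset.sum_congr rfl e, sum_wt]
    simp only [← Finset.smul_sum, ih, Finset.sum_const_zero]
    rw [Lp_of_lt (i := n + 1) (by omega), Matrix.zero_kronecker, add_zero,
      Lp_neg_last hq ⟨by omega, by omega⟩, par_mul_lo_neg_last, Matrix.smul_kronecker,
      Matrix.kronecker_smul, upp_kron_low, par_mul_lo_zero_left, vecAt, smul_smul, wt_smul, wt_smul,
      wt_add]
    simp only [smul_zero, add_zero, zero_add, smul_smul, wt_smul]
    have h1 : ((-1 : ℂ) ^ (n + 1)) * (-1) ^ (n + 1) = 1 := by rw [← mul_pow]; norm_num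
    rw [← kap_mul_sq hq]
    congr 1 <;> match_scalars <;> field_simp
    linear_combination (kap q * aZero q) * h1

/-- The contraction of the two factors over the vector index reproduces the recursion of `Mrec`: the
new indices `±(n+1)` supply the two identity blocks, and their coefficient `q + q⁻¹` comes from
`a_0² (1 + q²) = -1`. -/
lemma sum_sig_Mrec (hq : q ≠ 0) (h1q : 1 + q ^ 2 ≠ 0) (n : ℕ) :
    ∑ k ∈ Finset.Icc (-(n : ℤ)) n, (par n * lo q n k) ⊗ₖ (up q n k * par n) =
      (-(aZero q ^ 2 * q ^ 3)) • sig (Mrec q n) := by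
  induction n with
  | zero =>
    rw [Icc_zero_sum, par_zero, lo, up, one_mul, mul_one, Matrix.smul_kronecker,
      Matrix.kronecker_smul, Matrix.one_kronecker_one, Mrec, smul_smul, sig_one]
    congr 1; ring
  | succ n ih =>
    have hp : (-q ^ 2 : ℂ) ^ (n + 1) ≠ 0 := pow_ne_zero _ (neg_ne_zero.2 (pow_ne_zero 2 hq))
    have e : ∀ k ∈ Finset.Icc (-(n : ℤ)) n, (par (n + 1) * lo q (n + 1) k) ⊗ₖ (up q (n + 1) k * par (n + 1)) =
        wt ((par n * lo q n k) ⊗ₖ (up q n k * par n)) (-q ^ 2 • ((par n * lo q n k) ⊗ₖ (up q n k * par n))) 0 0 (-(q ^ 2)⁻¹ • ((par n * lo q n k) ⊗ₖ (up q n k * par n))) ((par n * lo q n k) ⊗ₖ (up q n k * par n)) := fun k hk => by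
      rw [Finset.mem_Icc] at hk
      rw [par_mul_lo_succ hk, up_mul_par_succ hk, diag_kron_diag, Matrix.smul_kronecker,
        Matrix.kronecker_smul, Matrix.smul_kronecker, Matrix.kronecker_smul, smul_smul]
      congr 1
      rw [show -(q ^ 2)⁻¹ * -q ^ 2 = 1 by field_simp, one_smul]
    rw [sum_Icc_succ, Finset.sum_congr rfl e, sum_wt]
    simp only [← Finset.smul_sum, ih, Finset.sum_const_zero]
    rw [par_mul_lo_last, par_mul_lo_neg_last, up_last_mul_par, up_neg_last_mul_par,
      Matrix.smul_kronecker, Matrix.smul_kronecker, Matrix.kronecker_smul, Matrix.kronecker_smul,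
      upp_kron_low, low_kron_upp, Matrix.one_kronecker_one, sig_Mrec_succ]
    simp only [wt_add, smul_zero, add_zero, zero_add, smul_smul, wt_smul]
    have h1 : ((-1 : ℂ) ^ (n + 1)) * (-1) ^ (n + 1) = 1 := by rw [← mul_pow]; norm_num
    have hz := aZero_sq h1q
    congr 1 <;> match_scalars <;> field_simp
    all_goals first | linear_combination hz | linear_combination h1 + hz

lemma sum_Mrec (hq : q ≠ 0) (h1q : 1 + q ^ 2 ≠ 0) (n : ℕ) :
    ∑ k ∈ Finset.Icc (-(n : ℤ)) n, (up q n k * par n) ⊗ₖ (par n * lo q n k) =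
      (-(aZero q ^ 2 * q ^ 3)) • Mrec q n := by
  induction n with
  | zero =>
    rw [Icc_zero_sum, par_zero, lo, up, one_mul, mul_one, Matrix.smul_kronecker,
      Matrix.kronecker_smul, Matrix.one_kronecker_one, Mrec, smul_smul]
    congr 1; ring
  | succ n ih =>
    have hp : (-q ^ 2 : ℂ) ^ (n + 1) ≠ 0 := pow_ne_zero _ (neg_ne_zero.2 (pow_ne_zero 2 hq))
    have e : ∀ k ∈ Finset.Icc (-(n : ℤ)) n, (up q (n + 1) k * par (n + 1)) ⊗ₖ (par (n + 1) * lo q (n + 1) k) =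
        wt ((up q n k * par n) ⊗ₖ (par n * lo q n k)) (-(q ^ 2)⁻¹ • ((up q n k * par n) ⊗ₖ (par n * lo q n k))) 0 0 (-q ^ 2 • ((up q n k * par n) ⊗ₖ (par n * lo q n k))) ((up q n k * par n) ⊗ₖ (par n * lo q n k)) := fun k hk => by
      rw [Finset.mem_Icc] at hk
      rw [par_mul_lo_succ hk, up_mul_par_succ hk, diag_kron_diag, Matrix.smul_kronecker,
        Matrix.kronecker_smul, Matrix.smul_kronecker, Matrix.kronecker_smul, smul_smul]
      congr 1
      rw [show -q ^ 2 * -(q ^ 2)⁻¹ = 1 by field_simp, one_smul]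
    rw [sum_Icc_succ, Finset.sum_congr rfl e, sum_wt]
    simp only [← Finset.smul_sum, ih, Finset.sum_const_zero]
    rw [par_mul_lo_last, par_mul_lo_neg_last, up_last_mul_par, up_neg_last_mul_par,
      Matrix.smul_kronecker, Matrix.smul_kronecker, Matrix.kronecker_smul, Matrix.kronecker_smul,
      upp_kron_low, low_kron_upp, Matrix.one_kronecker_one, Mrec]
    simp only [wt_add, smul_zero, add_zero, zero_add, smul_smul, wt_smul]
    have h1 : ((-1 : ℂ) ^ (n + 1)) * (-1) ^ (n + 1) = 1 := by rw [← mul_pow]; norm_num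
    have hz := aZero_sq h1q
    congr 1 <;> match_scalars <;> field_simp
    all_goals first | linear_combination hz | linear_combination h1 + hz

/-- The normalization of the first row of the `ℓ⁻`. -/
def rowM (q : ℂ) (n : ℕ) : ℂ := kap q * (-q ^ 2) ^ (n + 1)

/-- The normalization of the last row of the `ℓ⁺`. -/
def rowP (q : ℂ) (n : ℕ) : ℂ := -kap q * ((-1) ^ (n + 1) * q ^ 3)

/-- Column `0` is used because the index `0` is present for every `n`; the sums over `k` then close
on the recursive operators `strR` and `vecB`. -/
lemma pr_Lm_Lm (hq : q ≠ 0) (n : ℕ) : pr (Lm q (n + 1)) (Lm q (n + 1)) (n + 1) 0 =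
    (rowM q n * (aZero q * q)) • rs (q⁻¹ • strR q n) (vecB q n) (vecB q n) (q • strR q n) := by
  have e : ∀ k ∈ Finset.Icc (-(n : ℤ)) n, Lm q (n + 1) (n + 1) k ⊗ₖ Lm q (n + 1) k 0 =
      rowM q n • rs 0 ((par n * lo q n k) ⊗ₖ Lm q n k 0) ((par n * lo q n k) ⊗ₖ Lm q n k 0) 0 :=
    fun k hk => by
      rw [Finset.mem_Icc] at hk
      rw [Lm_last hk, Lm_succ hq hk ⟨by omega, by omega⟩, emb_eq, Matrix.smul_kronecker,
        low_kron_diag, rowM]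
  rw [pr, sum_Icc_succ, Finset.sum_congr rfl e, ← Finset.smul_sum, sum_rs, sum_vecB hq,
    Lm_last_neg, Matrix.zero_kronecker, Lm_last_last, Lm_last ⟨by omega, by omega⟩,
    Matrix.kronecker_smul, diag_kron_low, ← rowM]
  simp only [Finset.sum_const_zero, Matrix.smul_kronecker, par_mul_lo_zero_right, rs_smul, rs_add,
    smul_zero, add_zero, zero_add]
  congr 1 <;> module

lemma opr_Lm_Lm (hq : q ≠ 0) (n : ℕ) : opr (Lm q (n + 1)) (Lm q (n + 1)) (n + 1) 0 =
    (rowM q n * (aZero q * q)) • rs (vecA q n) (q⁻¹ • strL q n) (q • strL q n) (vecA q n) := by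
  have e : ∀ k ∈ Finset.Icc (-(n : ℤ)) n, Lm q (n + 1) k 0 ⊗ₖ Lm q (n + 1) (n + 1) k =
      rowM q n • rs (Lm q n k 0 ⊗ₖ (par n * lo q n k)) 0 0 (Lm q n k 0 ⊗ₖ (par n * lo q n k)) :=
    fun k hk => by
      rw [Finset.mem_Icc] at hk
      rw [Lm_last hk, Lm_succ hq hk ⟨by omega, by omega⟩, emb_eq, Matrix.kronecker_smul,
        diag_kron_low, rowM]
  rw [opr, sum_Icc_succ, Finset.sum_congr rfl e, ← Finset.smul_sum, sum_rs, sum_vecA hq,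
    Lm_last_neg, Matrix.kronecker_zero, Lm_last_last, Lm_last ⟨by omega, by omega⟩,
    Matrix.smul_kronecker, low_kron_diag, ← rowM]
  simp only [Finset.sum_const_zero, Matrix.kronecker_smul, par_mul_lo_zero_left, rs_smul, rs_add,
    smul_zero, add_zero, zero_add]
  congr 1 <;> module

lemma pr_Lp_Lp (hq : q ≠ 0) (n : ℕ) : pr (Lp q (n + 1)) (Lp q (n + 1)) (-(n + 1)) 0 =
    (rowP q n * (aZero q * q)) • lw (q⁻¹ • strR q n) (vecBt q n) (vecBt q n) (q • strR q n) := by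
  have e : ∀ k ∈ Finset.Icc (-(n : ℤ)) n, Lp q (n + 1) (-(n + 1)) k ⊗ₖ Lp q (n + 1) k 0 =
      rowP q n • lw 0 ((par n * lo q n k) ⊗ₖ Lp q n k 0) ((par n * lo q n k) ⊗ₖ Lp q n k 0) 0 :=
    fun k hk => by
      rw [Finset.mem_Icc] at hk
      rw [Lp_neg_last hq hk, Lp_succ hq hk ⟨by omega, by omega⟩, emb_eq, Matrix.smul_kronecker,
        upp_kron_diag, rowP]
  rw [pr, sum_Icc_succ, Finset.sum_congr rfl e, ← Finset.smul_sum, sum_lw, sum_vecBt hq,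
    Lp_neg_last_pos, Matrix.zero_kronecker, Lp_neg_last_last, Lp_neg_last hq ⟨by omega, by omega⟩,
    Matrix.kronecker_smul, diag_kron_upp, ← rowP]
  simp only [Finset.sum_const_zero, Matrix.smul_kronecker, par_mul_lo_zero_right, lw_smul, lw_add,
    smul_zero, add_zero, zero_add]
  congr 1 <;> module

lemma opr_Lp_Lp (hq : q ≠ 0) (n : ℕ) : opr (Lp q (n + 1)) (Lp q (n + 1)) (-(n + 1)) 0 =
    (rowP q n * (aZero q * q)) • lw (vecAt q n) (q⁻¹ • strL q n) (q • strL q n) (vecAt q n) := by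
  have e : ∀ k ∈ Finset.Icc (-(n : ℤ)) n, Lp q (n + 1) k 0 ⊗ₖ Lp q (n + 1) (-(n + 1)) k =
      rowP q n • lw (Lp q n k 0 ⊗ₖ (par n * lo q n k)) 0 0 (Lp q n k 0 ⊗ₖ (par n * lo q n k)) :=
    fun k hk => by
      rw [Finset.mem_Icc] at hk
      rw [Lp_neg_last hq hk, Lp_succ hq hk ⟨by omega, by omega⟩, emb_eq, Matrix.kronecker_smul,
        diag_kron_upp, rowP]
  rw [opr, sum_Icc_succ, Finset.sum_congr rfl e, ← Finset.smul_sum, sum_lw, sum_vecAt hq,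
    Lp_neg_last_pos, Matrix.kronecker_zero, Lp_neg_last_last, Lp_neg_last hq ⟨by omega, by omega⟩,
    Matrix.smul_kronecker, upp_kron_diag, ← rowP]
  simp only [Finset.sum_const_zero, Matrix.kronecker_smul, par_mul_lo_zero_left, lw_smul, lw_add,
    smul_zero, add_zero, zero_add]
  congr 1 <;> module

lemma pr_Lp_Lm (n : ℕ) : pr (Lp q (n + 1)) (Lm q (n + 1)) (n + 1) 0 =
    (rowM q n * (aZero q * q)) • rs (q • strR q n) 0 0 (q⁻¹ • strR q n) := by
  have e : ∀ k ∈ Finset.Icc (-(n : ℤ)) n, Lp q (n + 1) (n + 1) k ⊗ₖ Lm q (n + 1) k 0 = 0 :=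
    fun k hk => by
      rw [Finset.mem_Icc] at hk
      rw [Lp_of_lt (by omega), Matrix.zero_kronecker]
  rw [pr, sum_Icc_succ, Finset.sum_eq_zero e, Lp_of_lt (i := n + 1) (j := -(n + 1)) (by omega),
    Matrix.zero_kronecker, Lp_last_last, Lm_last ⟨by omega, by omega⟩,
    Matrix.kronecker_smul, diag_kron_low, ← rowM]
  simp only [Matrix.smul_kronecker, par_mul_lo_zero_right, rs_smul,
    smul_zero, add_zero, zero_add]
  congr 1 <;> module

lemma pr_Lm_Lp (hq : q ≠ 0) (n : ℕ) : pr (Lm q (n + 1)) (Lp q (n + 1)) (n + 1) 0 =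
    (rowM q n * (aZero q * q)) • rs 0 (vecBt q n) (vecBt q n) 0 := by
  have e : ∀ k ∈ Finset.Icc (-(n : ℤ)) n, Lm q (n + 1) (n + 1) k ⊗ₖ Lp q (n + 1) k 0 =
      rowM q n • rs 0 ((par n * lo q n k) ⊗ₖ Lp q n k 0) ((par n * lo q n k) ⊗ₖ Lp q n k 0) 0 :=
    fun k hk => by
      rw [Finset.mem_Icc] at hk
      rw [Lm_last hk, Lp_succ hq hk ⟨by omega, by omega⟩, emb_eq, Matrix.smul_kronecker,
        low_kron_diag, rowM]
  rw [pr, sum_Icc_succ, Finset.sum_congr rfl e, ← Finset.smul_sum, sum_rs, sum_vecBt hq,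
    Lm_last_neg, Matrix.zero_kronecker, Lp_of_lt (by omega), Matrix.kronecker_zero]
  simp only [Finset.sum_const_zero, rs_smul, smul_zero, add_zero, smul_smul]

lemma opr_Lp_Lm (hq : q ≠ 0) (n : ℕ) : opr (Lp q (n + 1)) (Lm q (n + 1)) (n + 1) 0 =
    (rowM q n * (aZero q * q)) • rs (vecAt q n) 0 0 (vecAt q n) := by
  have e : ∀ k ∈ Finset.Icc (-(n : ℤ)) n, Lp q (n + 1) k 0 ⊗ₖ Lm q (n + 1) (n + 1) k =
      rowM q n • rs (Lp q n k 0 ⊗ₖ (par n * lo q n k)) 0 0 (Lp q n k 0 ⊗ₖ (par n * lo q n k)) :=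
    fun k hk => by
      rw [Finset.mem_Icc] at hk
      rw [Lm_last hk, Lp_succ hq hk ⟨by omega, by omega⟩, emb_eq, Matrix.kronecker_smul,
        diag_kron_low, rowM]
  rw [opr, sum_Icc_succ, Finset.sum_congr rfl e, ← Finset.smul_sum, sum_rs, sum_vecAt hq,
    Lm_last_neg, Matrix.kronecker_zero, Lp_of_lt (i := n + 1) (by omega), Matrix.zero_kronecker]
  simp only [Finset.sum_const_zero, rs_smul, smul_zero, add_zero, smul_smul]

lemma opr_Lm_Lp (n : ℕ) : opr (Lm q (n + 1)) (Lp q (n + 1)) (n + 1) 0 =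
    (rowM q n * (aZero q * q)) • rs 0 (q • strL q n) (q⁻¹ • strL q n) 0 := by
  have e : ∀ k ∈ Finset.Icc (-(n : ℤ)) n, Lm q (n + 1) k 0 ⊗ₖ Lp q (n + 1) (n + 1) k = 0 :=
    fun k hk => by
      rw [Finset.mem_Icc] at hk
      rw [Lp_of_lt (by omega), Matrix.kronecker_zero]
  rw [opr, sum_Icc_succ, Finset.sum_eq_zero e, Lp_of_lt (i := n + 1) (j := -(n + 1)) (by omega),
    Matrix.kronecker_zero, Lp_last_last, Lm_last ⟨by omega, by omega⟩,
    Matrix.smul_kronecker, low_kron_diag, ← rowM]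
  simp only [Matrix.kronecker_smul, par_mul_lo_zero_left, rs_smul,
    smul_zero, add_zero, zero_add]
  congr 1 <;> module

lemma dgp_kron_dgm (n : ℕ) : (b2 (q • (1 : Op n)) 0 0 (q⁻¹ • 1)) ⊗ₖ b2 (q⁻¹ • (1 : Op n)) 0 0 (q • 1) =
    wt ((q * q⁻¹) • 1) ((q * q) • 1) 0 0 ((q⁻¹ * q⁻¹) • 1) ((q⁻¹ * q) • 1) := by
  simp only [diag_kron_diag, Matrix.smul_kronecker, Matrix.kronecker_smul, smul_smul,
    Matrix.one_kronecker_one, mul_comm q⁻¹ q]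

lemma dgm_kron_dgp (n : ℕ) : (b2 (q⁻¹ • (1 : Op n)) 0 0 (q • 1)) ⊗ₖ b2 (q • (1 : Op n)) 0 0 (q⁻¹ • 1) =
    wt ((q⁻¹ * q) • 1) ((q⁻¹ * q⁻¹) • 1) 0 0 ((q * q) • 1) ((q * q⁻¹) • 1) := by
  simp only [diag_kron_diag, Matrix.smul_kronecker, Matrix.kronecker_smul, smul_smul,
    Matrix.one_kronecker_one, mul_comm q⁻¹ q]

lemma corner_coef (hq : q ≠ 0) (h1q : 1 + q ^ 2 ≠ 0) (n : ℕ) :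
    rowM q n * (-q ^ 2 * kap q * (q ^ 2 * ((-q ^ 2) ^ (n + 1))⁻¹)) * -(aZero q ^ 2 * q ^ 3) =
      -((q - q⁻¹) * (q ^ 2 - (q ^ 2)⁻¹)) := by
  have hp : (-q ^ 2 : ℂ) ^ (n + 1) ≠ 0 := pow_ne_zero _ (neg_ne_zero.2 (pow_ne_zero 2 hq))
  have hz := aZero_sq h1q
  have hz' : aZero q ^ 2 = -(1 + q ^ 2)⁻¹ := by
    field_simp
    linear_combination hz
  rw [rowM, kap, hz']
  field_simp
  ring

/-- In `L⁺ L⁻` triangularity leaves only `k = n+1`. In `L⁻ L⁺` the old indices also survive, and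
their contraction is `sig Mrec`; it is the only block that is not scalar. -/
lemma pr_corner (hq : q ≠ 0) (h1q : 1 + q ^ 2 ≠ 0) (n : ℕ) (u v : ℂ) :
    v • pr (Lp q (n + 1)) (Lm q (n + 1)) (n + 1) (n + 1) +
      u • pr (Lm q (n + 1)) (Lp q (n + 1)) (n + 1) (n + 1) =
    wt ((v + u) • 1) ((v * q ^ 2 + u * (q ^ 2)⁻¹) • 1) 0
      (-(u * ((q - q⁻¹) * (q ^ 2 - (q ^ 2)⁻¹))) • sig (Mrec q n))
      ((v * (q ^ 2)⁻¹ + u * q ^ 2) • 1) ((v + u) • 1) := by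
  have e : ∀ k ∈ Finset.Icc (-(n : ℤ)) n, Lp q (n + 1) (n + 1) k ⊗ₖ Lm q (n + 1) k (n + 1) = 0 :=
    fun k hk => by
      rw [Finset.mem_Icc] at hk
      rw [Lp_of_lt (by omega), Matrix.zero_kronecker]
  have e' : ∀ k ∈ Finset.Icc (-(n : ℤ)) n, Lm q (n + 1) (n + 1) k ⊗ₖ Lp q (n + 1) k (n + 1) =
      (rowM q n * (-q ^ 2 * kap q * (q ^ 2 * ((-q ^ 2) ^ (n + 1))⁻¹))) •
        wt 0 0 0 ((par n * lo q n k) ⊗ₖ (up q n k * par n)) 0 0 :=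
    fun k hk => by
      rw [Finset.mem_Icc] at hk
      rw [Lm_last hk, Lp_mid_last hk, Matrix.smul_kronecker, Matrix.kronecker_smul,
        low_kron_upp, ← rowM, smul_smul]
  rw [pr, pr, sum_Icc_succ, sum_Icc_succ, Finset.sum_eq_zero e, Finset.sum_congr rfl e',
    ← Finset.smul_sum, sum_wt, sum_sig_Mrec hq h1q,
    Lp_of_lt (i := n + 1) (j := -(n + 1)) (by omega),
    Matrix.zero_kronecker, Lp_last_last, Lm_last_last, dgp_kron_dgm, Lm_last_neg,
    Matrix.zero_kronecker, dgm_kron_dgp]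
  simp only [Finset.sum_const_zero, wt_smul, wt_add, smul_zero, add_zero, zero_add, smul_smul,
    corner_coef hq h1q]
  congr 1 <;> match_scalars <;> field_simp

lemma opr_corner (hq : q ≠ 0) (h1q : 1 + q ^ 2 ≠ 0) (n : ℕ) (u v : ℂ) :
    v • opr (Lp q (n + 1)) (Lm q (n + 1)) (n + 1) (n + 1) +
      u • opr (Lm q (n + 1)) (Lp q (n + 1)) (n + 1) (n + 1) =
    wt ((v + u) • 1) ((v * q ^ 2 + u * (q ^ 2)⁻¹) • 1)
      (-(v * ((q - q⁻¹) * (q ^ 2 - (q ^ 2)⁻¹))) • Mrec q n) 0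
      ((v * (q ^ 2)⁻¹ + u * q ^ 2) • 1) ((v + u) • 1) := by
  have e : ∀ k ∈ Finset.Icc (-(n : ℤ)) n, Lm q (n + 1) k (n + 1) ⊗ₖ Lp q (n + 1) (n + 1) k = 0 :=
    fun k hk => by
      rw [Finset.mem_Icc] at hk
      rw [Lp_of_lt (by omega), Matrix.kronecker_zero]
  have e' : ∀ k ∈ Finset.Icc (-(n : ℤ)) n, Lp q (n + 1) k (n + 1) ⊗ₖ Lm q (n + 1) (n + 1) k =
      (rowM q n * (-q ^ 2 * kap q * (q ^ 2 * ((-q ^ 2) ^ (n + 1))⁻¹))) •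
        wt 0 0 ((up q n k * par n) ⊗ₖ (par n * lo q n k)) 0 0 0 :=
    fun k hk => by
      rw [Finset.mem_Icc] at hk
      rw [Lm_last hk, Lp_mid_last hk, Matrix.smul_kronecker, Matrix.kronecker_smul,
        upp_kron_low, ← rowM, smul_smul, mul_comm]
  rw [opr, opr, sum_Icc_succ, sum_Icc_succ, Finset.sum_eq_zero e, Finset.sum_congr rfl e',
    ← Finset.smul_sum, sum_wt, sum_Mrec hq h1q,
    Lp_of_lt (i := n + 1) (j := -(n + 1)) (by omega),
    Matrix.kronecker_zero, Lp_last_last, Lm_last_last, dgp_kron_dgm, Lm_last_neg,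
    Matrix.kronecker_zero, dgm_kron_dgp]
  simp only [Finset.sum_const_zero, wt_smul, wt_add, smul_zero, add_zero, zero_add, smul_smul,
    corner_coef hq h1q]
  congr 1 <;> match_scalars <;> field_simp

end

section

/-! ### Existence of the intertwiner -/

variable {q : ℂ} {n : ℕ}

/-- Compatibility with the coproducts of the simple root operators. -/
structure IsSym (q : ℂ) (n : ℕ) (X : Op₂ n) : Prop where
  e : ∀ k < n, X * cop (simE n k) (simT q n k) = opc (simE n k) (simT q n k) * X
  f : ∀ k < n, X * cop (simF n k) (simT q n k) = opc (simF n k) (simT q n k) * X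
  t : ∀ k < n, X * (simT q n k ⊗ₖ simT q n k) = (simT q n k ⊗ₖ simT q n k) * X
  d : ∀ i, X * (dgm q n i ⊗ₖ dgm q n i) = (dgm q n i ⊗ₖ dgm q n i) * X

lemma commute_inv_of_commute {X A B : Op₂ n} (h : X * A = A * X) (hAB : A * B = 1) :
    X * B = B * X := by
  have hBA : B * A = 1 := mul_eq_one_comm.1 hAB
  calc X * B = B * A * (X * B) := by rw [hBA, one_mul]
    _ = B * (X * (A * B)) := by rw [mul_assoc, ← mul_assoc A, ← h, mul_assoc X]
    _ = B * X := by rw [hAB, mul_one]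

lemma IsSym.kron_dgp (hq : q ≠ 0) {X : Op₂ n} (h : IsSym q n X) (i : ℤ) :
    X * (dgp q n i ⊗ₖ dgp q n i) =
      (dgp q n i ⊗ₖ dgp q n i) * X :=
  commute_inv_of_commute (h.d i) (by
    rw [← Matrix.mul_kronecker_mul, dgm_mul_dgp hq, Matrix.one_kronecker_one])

lemma pr_Lm_corner (n : ℕ) : pr (Lm q n) (Lm q n) n n = dgm q n n ⊗ₖ dgm q n n ∧
    opr (Lm q n) (Lm q n) n n = dgm q n n ⊗ₖ dgm q n n := by
  have h0 : Lm q n n n = dgm q n n := by rw [Lm, if_pos rfl]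
  constructor
  · rw [pr, Finset.sum_eq_single (n : ℤ), h0]
    · intro k hk hkn
      rw [Finset.mem_Icc] at hk
      rw [Lm_of_lt (i := k) (by omega), Matrix.kronecker_zero]
    · intro h; exact absurd (Finset.mem_Icc.2 ⟨by omega, le_rfl⟩) h
  · rw [opr, Finset.sum_eq_single (n : ℤ), h0]
    · intro k hk hkn
      rw [Finset.mem_Icc] at hk
      rw [Lm_of_lt (i := k) (by omega), Matrix.zero_kronecker]
    · intro h; exact absurd (Finset.mem_Icc.2 ⟨by omega, le_rfl⟩) h

lemma pr_Lp_corner (n : ℕ) : pr (Lp q n) (Lp q n) n n = dgp q n n ⊗ₖ dgp q n n ∧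
    opr (Lp q n) (Lp q n) n n = dgp q n n ⊗ₖ dgp q n n := by
  have h0 : Lp q n n n = dgp q n n := by rw [Lp, if_pos rfl]
  constructor
  · rw [pr, Finset.sum_eq_single (n : ℤ), h0]
    · intro k hk hkn
      rw [Finset.mem_Icc] at hk
      rw [Lp_of_lt (j := k) (by omega), Matrix.zero_kronecker]
    · intro h; exact absurd (Finset.mem_Icc.2 ⟨by omega, le_rfl⟩) h
  · rw [opr, Finset.sum_eq_single (n : ℤ), h0]
    · intro k hk hkn
      rw [Finset.mem_Icc] at hk
      rw [Lp_of_lt (j := k) (by omega), Matrix.kronecker_zero]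
    · intro h; exact absurd (Finset.mem_Icc.2 ⟨by omega, le_rfl⟩) h

section

variable (hq : q ≠ 0) (h1q : 1 + q ^ 2 ≠ 0)
include hq h1q

/-- By propagation only the corner has to be checked. There triangularity leaves one diagonal term,
the same for both coproducts, and `X` commutes with it. -/
lemma IsSym.isFT {X : Op₂ n} (h : IsSym q n X) : IsFT q n X := by
  intro i hi j hj
  rw [Finset.mem_Icc] at hi hj
  constructor
  · refine defect_eq_zero hq h1q (D := fun i j => dfct X i j (Lm q n) (Lm q n)) (fun k hk => ?_)
      (fun k hk => ?_) ?_ hi hj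
    · exact defectCov_dfct (cov_E_Lm hq h1q hk) (cov_E_Lm hq h1q hk)
        (simpleOp_E hq h1q n k hk).supp (h.e k hk) (h.t k hk)
    · exact defectCov_dfct (cov_F_Lm hq h1q hk) (cov_F_Lm hq h1q hk)
        (simpleOp_F hq h1q n k hk).supp (h.f k hk) (h.t k hk)
    · rw [dfct_apply, (pr_Lm_corner n).1, (pr_Lm_corner n).2, h.d, sub_self]
  · refine defect_eq_zero hq h1q (D := fun i j => dfct X i j (Lp q n) (Lp q n)) (fun k hk => ?_)
      (fun k hk => ?_) ?_ hi hj
    · exact defectCov_dfct (cov_E_Lp hq h1q hk) (cov_E_Lp hq h1q hk)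
        (simpleOp_E hq h1q n k hk).supp (h.e k hk) (h.t k hk)
    · exact defectCov_dfct (cov_F_Lp hq h1q hk) (cov_F_Lp hq h1q hk)
        (simpleOp_F hq h1q n k hk).supp (h.f k hk) (h.t k hk)
    · rw [dfct_apply, (pr_Lp_corner n).1, (pr_Lp_corner n).2, h.kron_dgp hq, sub_self]

lemma IsSym.isAff {X : Op₂ n} (h : IsSym q n X) {u v : ℂ}
    (h0 : v • dfct X n n (Lp q n) (Lm q n) + u • dfct X n n (Lm q n) (Lp q n) = 0) :
    IsAff q n u v X := by
  intro i hi j hj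
  rw [Finset.mem_Icc] at hi hj
  refine defect_eq_zero hq h1q (D := fun i j => v • dfct X i j (Lp q n) (Lm q n) +
    u • dfct X i j (Lm q n) (Lp q n)) (fun k hk => ?_) (fun k hk => ?_) h0 hi hj
  · exact (defectCov_dfct (cov_E_Lp hq h1q hk) (cov_E_Lm hq h1q hk)
      (simpleOp_E hq h1q n k hk).supp (h.e k hk) (h.t k hk)).lin
      (defectCov_dfct (cov_E_Lm hq h1q hk) (cov_E_Lp hq h1q hk)
      (simpleOp_E hq h1q n k hk).supp (h.e k hk) (h.t k hk)) v u
  · exact (defectCov_dfct (cov_F_Lp hq h1q hk) (cov_F_Lm hq h1q hk)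
      (simpleOp_F hq h1q n k hk).supp (h.f k hk) (h.t k hk)).lin
      (defectCov_dfct (cov_F_Lm hq h1q hk) (cov_F_Lp hq h1q hk)
      (simpleOp_F hq h1q n k hk).supp (h.f k hk) (h.t k hk)) v u

end

lemma simE_succ {k : ℕ} (hk : k < n) : simE (n + 1) k = emb (simE n k) := by
  rcases n with _ | n
  · omega
  · rw [simE, if_neg (by omega)]

lemma simF_succ {k : ℕ} (hk : k < n) : simF (n + 1) k = emb (simF n k) := by
  rcases n with _ | n
  · omega
  · rw [simF, if_neg (by omega)]

lemma simT_succ {k : ℕ} (hk : k < n) : simT q (n + 1) k = emb (simT q n k) := by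
  rcases n with _ | n
  · omega
  · rw [simT, if_neg (by omega)]

lemma emb_kron_emb (A B : Op n) :
    emb A ⊗ₖ emb B = wt (A ⊗ₖ B) (A ⊗ₖ B) 0 0 (A ⊗ₖ B) (A ⊗ₖ B) := diag_kron_diag ..

lemma cop_emb (e τ : Op n) : cop (emb e) (emb τ) =
    wt (cop e τ) (cop e τ) 0 0 (cop e τ) (cop e τ) := by
  rw [cop, ← emb_one, emb_kron_emb, emb_kron_emb, wt_add, add_zero, ← cop]

lemma opc_emb (e τ : Op n) : opc (emb e) (emb τ) =
    wt (opc e τ) (opc e τ) 0 0 (opc e τ) (opc e τ) := by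
  rw [opc, ← emb_one, emb_kron_emb, emb_kron_emb, wt_add, add_zero, ← opc]

lemma wt_intertwines {a x₁₁ x₁₂ x₂₁ x₂₂ d C C' : Op₂ n} (h1 : a * C = C' * a)
    (h2 : x₁₁ * C = C' * x₁₁) (h3 : x₁₂ * C = C' * x₁₂) (h4 : x₂₁ * C = C' * x₂₁)
    (h5 : x₂₂ * C = C' * x₂₂) (h6 : d * C = C' * d) :
    wt a x₁₁ x₁₂ x₂₁ x₂₂ d * wt C C 0 0 C C = wt C' C' 0 0 C' C' * wt a x₁₁ x₁₂ x₂₁ x₂₂ d := by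
  simp only [wt_mul_wt, h1, h2, h3, h4, h5, h6, mul_zero, zero_mul, add_zero, zero_add]

lemma kap_ne (hq : q ≠ 0) (hq4 : q ^ 4 ≠ 1) : kap q ≠ 0 := by
  refine mul_ne_zero (inv_ne_zero (pow_ne_zero 3 hq)) fun h => hq4 ?_
  field_simp at h
  linear_combination h

/-- The new root operator is, up to an invertible factor, the entry of `L⁻` next to the diagonal in
the last row; this is how defects give back relations for root operators. -/
lemma simE_top (hq : q ≠ 0) (h1q : 1 + q ^ 2 ≠ 0) (hq4 : q ^ 4 ≠ 1) (n : ℕ) :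
    ∃ c : ℂ, c ≠ 0 ∧ Lm q (n + 1) (n + 1) n = c • (simE (n + 1) n * dgm q (n + 1) n) := by
  have hz0 : aZero q ≠ 0 := fun h => by have := aZero_sq h1q; rw [h] at this; norm_num at this
  have hk := kap_ne hq hq4
  have hp : ∀ m : ℕ, (-q ^ 2 : ℂ) ^ m ≠ 0 := fun m =>
    pow_ne_zero _ (neg_ne_zero.2 (pow_ne_zero 2 hq))
  rw [Lm_last ⟨by omega, le_rfl⟩]
  rcases n with _ | n
  · refine ⟨rowM q 0 * (aZero q * q), mul_ne_zero (mul_ne_zero hk (hp _)) (mul_ne_zero hz0 hq), ?_⟩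
    rw [Nat.cast_zero, dgm_zero, par_zero, lo, simE, if_pos rfl, ← rowM, mul_one, b2_smul, b2_smul]
    simp [smul_smul]
  · refine ⟨rowM q (n + 1) * (q ^ 2 * ((-q ^ 2) ^ (n + 1))⁻¹) * q⁻¹, mul_ne_zero (mul_ne_zero
      (mul_ne_zero hk (hp _)) (mul_ne_zero (pow_ne_zero 2 hq) (inv_ne_zero (hp _))))
      (inv_ne_zero hq), ?_⟩
    rw [dgm_succ (by omega) le_rfl, simE, if_pos rfl, ← rowM, Nat.cast_add, Nat.cast_one,
      par_mul_lo_last, dgm_last, emb_eq, b2_mul, b2_mul, b2_smul, b2_smul]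
    simp [b2_smul, smul_smul, b2_zero, hq]

lemma simF_top (hq : q ≠ 0) (h1q : 1 + q ^ 2 ≠ 0) (hq4 : q ^ 4 ≠ 1) (n : ℕ) :
    ∃ c : ℂ, c ≠ 0 ∧ Lp q (n + 1) (-(n + 1)) (-n) = c • (simF (n + 1) n * dgp q (n + 1) (-n)) := by
  have hz0 : aZero q ≠ 0 := fun h => by have := aZero_sq h1q; rw [h] at this; norm_num at this
  have hk := kap_ne hq hq4
  have h1 : ∀ m : ℕ, (-1 : ℂ) ^ m ≠ 0 := fun m => pow_ne_zero _ (by norm_num)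
  have hP : ∀ m, rowP q m ≠ 0 := fun m =>
    mul_ne_zero (neg_ne_zero.2 hk) (mul_ne_zero (h1 _) (pow_ne_zero 3 hq))
  rw [Lp_neg_last hq ⟨le_rfl, by omega⟩]
  rcases n with _ | n
  · refine ⟨rowP q 0 * (aZero q * q), mul_ne_zero (hP _) (mul_ne_zero hz0 hq), ?_⟩
    rw [Nat.cast_zero, neg_zero, dgp_zero, par_zero, lo, simF, if_pos rfl, ← rowP, mul_one, b2_smul, b2_smul]
    simp [smul_smul]
  · refine ⟨rowP q (n + 1) * (-((-1) ^ (n + 1) * q⁻¹)) * q, mul_ne_zero (mul_ne_zero (hP _)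
      (neg_ne_zero.2 (mul_ne_zero (h1 _) (inv_ne_zero hq)))) hq, ?_⟩
    rw [dgp_succ le_rfl (by omega), simF, if_pos rfl, ← rowP, Nat.cast_add, Nat.cast_one,
      par_mul_lo_neg_last, dgp_neg_last, emb_eq, b2_mul, b2_mul, b2_smul, b2_smul]
    simp [b2_smul, smul_smul, b2_zero, b2_neg, hq]

lemma pr_Lm_step (n : ℕ) : pr (Lm q (n + 1)) (Lm q (n + 1)) (n + 1) n =
      Lm q (n + 1) (n + 1) n ⊗ₖ dgm q (n + 1) n + dgm q (n + 1) (n + 1) ⊗ₖ Lm q (n + 1) (n + 1) n ∧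
    opr (Lm q (n + 1)) (Lm q (n + 1)) (n + 1) n =
      dgm q (n + 1) n ⊗ₖ Lm q (n + 1) (n + 1) n +
        Lm q (n + 1) (n + 1) n ⊗ₖ dgm q (n + 1) (n + 1) := by
  have h0 : ∀ i : ℤ, Lm q (n + 1) i i = dgm q (n + 1) i := fun i => by rw [Lm, if_pos rfl]
  have hne : ((n : ℤ)) ≠ n + 1 := by omega
  have hs : ({(n : ℤ), (n : ℤ) + 1} : Finset ℤ) ⊆ Finset.Icc (-((n + 1 : ℕ) : ℤ)) (n + 1 : ℕ) := by
    intro k hk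
    simp only [Finset.mem_insert, Finset.mem_singleton] at hk
    rw [Finset.mem_Icc]
    push_cast
    omega
  constructor
  · rw [pr, ← Finset.sum_subset hs, Finset.sum_pair hne, h0, h0]
    intro k hk hkn
    rw [Finset.mem_Icc] at hk
    simp only [Finset.mem_insert, Finset.mem_singleton, not_or] at hkn
    push_cast at hk
    rw [Lm_of_lt (i := k) (by omega), Matrix.kronecker_zero]
  · rw [opr, ← Finset.sum_subset hs, Finset.sum_pair hne, h0, h0]
    intro k hk hkn
    rw [Finset.mem_Icc] at hk
    simp only [Finset.mem_insert, Finset.mem_singleton, not_or] at hkn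
    push_cast at hk
    rw [Lm_of_lt (i := k) (by omega), Matrix.zero_kronecker]

lemma pr_Lp_step (n : ℕ) : pr (Lp q (n + 1)) (Lp q (n + 1)) (-(n + 1)) (-n) =
      Lp q (n + 1) (-(n + 1)) (-n) ⊗ₖ dgp q (n + 1) (-n) +
        dgp q (n + 1) (-(n + 1)) ⊗ₖ Lp q (n + 1) (-(n + 1)) (-n) ∧
    opr (Lp q (n + 1)) (Lp q (n + 1)) (-(n + 1)) (-n) =
      dgp q (n + 1) (-n) ⊗ₖ Lp q (n + 1) (-(n + 1)) (-n) +
        Lp q (n + 1) (-(n + 1)) (-n) ⊗ₖ dgp q (n + 1) (-(n + 1)) := by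
  have h0 : ∀ i : ℤ, Lp q (n + 1) i i = dgp q (n + 1) i := fun i => by rw [Lp, if_pos rfl]
  have hne : (-(n : ℤ)) ≠ -(n + 1) := by omega
  have hs : ({-(n : ℤ), -((n : ℤ) + 1)} : Finset ℤ) ⊆
      Finset.Icc (-((n + 1 : ℕ) : ℤ)) (n + 1 : ℕ) := by
    intro k hk
    simp only [Finset.mem_insert, Finset.mem_singleton] at hk
    rw [Finset.mem_Icc]
    push_cast
    omega
  constructor
  · rw [pr, ← Finset.sum_subset hs, Finset.sum_pair hne, h0, h0]
    intro k hk hkn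
    rw [Finset.mem_Icc] at hk
    simp only [Finset.mem_insert, Finset.mem_singleton, not_or] at hkn
    push_cast at hk
    rw [Lp_of_lt (i := k) (by omega), Matrix.kronecker_zero]
  · rw [opr, ← Finset.sum_subset hs, Finset.sum_pair hne, h0, h0]
    intro k hk hkn
    rw [Finset.mem_Icc] at hk
    simp only [Finset.mem_insert, Finset.mem_singleton, not_or] at hkn
    push_cast at hk
    rw [Lp_of_lt (i := k) (by omega), Matrix.zero_kronecker]

/-- A relation of triangular operators gives a relation for the normalized ones. -/
lemma cop_of_step {X : Op₂ n} {L d d' g e τ : Op n} {c : ℂ} (hc : c ≠ 0) (hL : L = c • (e * d))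
    (hd' : d' = τ * d) (hg : d * g = 1) (hX : X * (d ⊗ₖ d) = (d ⊗ₖ d) * X)
    (h : (d ⊗ₖ L + L ⊗ₖ d') * X = X * (L ⊗ₖ d + d' ⊗ₖ L)) : X * cop e τ = opc e τ * X := by
  have h1 : L ⊗ₖ d + d' ⊗ₖ L = c • (cop e τ * (d ⊗ₖ d)) := by
    rw [hL, hd', cop, add_mul, ← Matrix.mul_kronecker_mul, ← Matrix.mul_kronecker_mul, one_mul,
      Matrix.smul_kronecker, Matrix.kronecker_smul, smul_add]
  have h2 : d ⊗ₖ L + L ⊗ₖ d' = c • (opc e τ * (d ⊗ₖ d)) := by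
    rw [hL, hd', opc, add_mul, ← Matrix.mul_kronecker_mul, ← Matrix.mul_kronecker_mul, one_mul,
      Matrix.smul_kronecker, Matrix.kronecker_smul, smul_add]
  rw [h1, h2, smul_mul_assoc, mul_smul_comm] at h
  have h3 := smul_right_injective _ hc h
  simp only at h3
  have h4 := congrArg (· * (g ⊗ₖ g)) h3
  have hgg : (d ⊗ₖ d) * (g ⊗ₖ g) = 1 := by
    rw [← Matrix.mul_kronecker_mul, hg, Matrix.one_kronecker_one]
  simp only [mul_assoc] at h4
  rw [← mul_assoc (d ⊗ₖ d) X, ← hX, mul_assoc X, hgg, mul_one, mul_one] at h4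
  exact h4.symm

section step

variable (hq : q ≠ 0) (h1q : 1 + q ^ 2 ≠ 0) (hq4 : q ^ 4 ≠ 1) {a x₁₁ x₁₂ x₂₁ x₂₂ b : Op₂ n}
include hq h1q hq4

-- The old roots and the Cartan elements act by blocks. The relation for the new root is the
-- vanishing of the defect at `(n+1, n)` for `L⁻`, or at `(-(n+1), -n)` for `L⁺`, and the old roots
-- carry it there from column `0`, where the sums are explicit.
set_option maxHeartbeats 1000000 in
theorem IsSym.succ (ha : IsSym q n a) (h11 : IsSym q n x₁₁) (h12 : IsSym q n x₁₂)
    (h21 : IsSym q n x₂₁) (h22 : IsSym q n x₂₂) (hb : IsSym q n b)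
    (hE : dfct (wt a x₁₁ x₁₂ x₂₁ x₂₂ b) (n + 1) 0 (Lm q (n + 1)) (Lm q (n + 1)) = 0)
    (hF : dfct (wt a x₁₁ x₁₂ x₂₁ x₂₂ b) (-(n + 1)) 0 (Lp q (n + 1)) (Lp q (n + 1)) = 0) :
    IsSym q (n + 1) (wt a x₁₁ x₁₂ x₂₁ x₂₂ b) := by
  have hd : ∀ i, wt a x₁₁ x₁₂ x₂₁ x₂₂ b * (dgm q (n + 1) i ⊗ₖ dgm q (n + 1) i) =
      (dgm q (n + 1) i ⊗ₖ dgm q (n + 1) i) * wt a x₁₁ x₁₂ x₂₁ x₂₂ b := by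
    intro i
    rw [dgm]
    split_ifs
    · simp [diag_kron_diag, Matrix.smul_kronecker, Matrix.kronecker_smul, wt_mul_wt, smul_smul, hq]
    · simp [diag_kron_diag, Matrix.smul_kronecker, Matrix.kronecker_smul, wt_mul_wt, smul_smul, hq]
    · rw [emb_kron_emb]
      exact wt_intertwines (ha.d i) (h11.d i) (h12.d i) (h21.d i) (h22.d i) (hb.d i)
  have he : ∀ k < n, wt a x₁₁ x₁₂ x₂₁ x₂₂ b * cop (simE (n + 1) k) (simT q (n + 1) k) =
      opc (simE (n + 1) k) (simT q (n + 1) k) * wt a x₁₁ x₁₂ x₂₁ x₂₂ b := by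
    intro k hk
    rw [simE_succ hk, simT_succ hk, cop_emb, opc_emb]
    exact wt_intertwines (ha.e k hk) (h11.e k hk) (h12.e k hk) (h21.e k hk) (h22.e k hk)
      (hb.e k hk)
  have hf : ∀ k < n, wt a x₁₁ x₁₂ x₂₁ x₂₂ b * cop (simF (n + 1) k) (simT q (n + 1) k) =
      opc (simF (n + 1) k) (simT q (n + 1) k) * wt a x₁₁ x₁₂ x₂₁ x₂₂ b := by
    intro k hk
    rw [simF_succ hk, simT_succ hk, cop_emb, opc_emb]
    exact wt_intertwines (ha.f k hk) (h11.f k hk) (h12.f k hk) (h21.f k hk) (h22.f k hk)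
      (hb.f k hk)
  have ht : ∀ k < n, wt a x₁₁ x₁₂ x₂₁ x₂₂ b * (simT q (n + 1) k ⊗ₖ simT q (n + 1) k) =
      (simT q (n + 1) k ⊗ₖ simT q (n + 1) k) * wt a x₁₁ x₁₂ x₂₁ x₂₂ b := by
    intro k hk
    rw [simT_succ hk, emb_kron_emb]
    exact wt_intertwines (ha.t k hk) (h11.t k hk) (h12.t k hk) (h21.t k hk) (h22.t k hk)
      (hb.t k hk)
  generalize wt a x₁₁ x₁₂ x₂₁ x₂₂ b = X at *
  have hdp : ∀ i, X * (dgp q (n + 1) i ⊗ₖ dgp q (n + 1) i) =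
      (dgp q (n + 1) i ⊗ₖ dgp q (n + 1) i) * X := fun i => commute_inv_of_commute (hd i) (by
    rw [← Matrix.mul_kronecker_mul, dgm_mul_dgp hq, Matrix.one_kronecker_one])
  -- The root `m < n` moves the column from `m` to `m + 1` and does not move the row index `n + 1`,
  -- so only roots already treated are used.
  have moveE : ∀ m : ℕ, m ≤ n → dfct X (n + 1) m (Lm q (n + 1)) (Lm q (n + 1)) = 0 := by
    intro m
    induction m with
    | zero => intro _; exact hE
    | succ m ih =>
      intro hm
      have hk : m < n + 1 := by omega
      have := (defectCov_dfct (cov_F_Lm hq h1q hk) (cov_F_Lm hq h1q hk)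
        (simpleOp_F hq h1q _ m hk).supp (hf m (by omega)) (ht m (by omega))).col
        (i := n + 1) (j := m) ⟨by omega, by push_cast; omega⟩ ⟨by omega, by push_cast; omega⟩
        (coefF_of_lt (by omega))
        (by rw [sub_neg_eq_add]; exact coefF_self_ne hq h1q m) (exists_simT_mul hq _ m hk)
        (ih (by omega))
      rw [sub_neg_eq_add] at this
      exact_mod_cast this
  have moveF : ∀ m : ℕ, m ≤ n → dfct X (-(n + 1)) (-m) (Lp q (n + 1)) (Lp q (n + 1)) = 0 := by
    intro m
    induction m with
    | zero => intro _; exact hF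
    | succ m ih =>
      intro hm
      have hk : m < n + 1 := by omega
      have := (defectCov_dfct (cov_E_Lp hq h1q hk) (cov_E_Lp hq h1q hk)
        (simpleOp_E hq h1q _ m hk).supp (he m (by omega)) (ht m (by omega))).col
        (i := -(n + 1)) (j := -m) ⟨by push_cast; omega, by omega⟩ ⟨by push_cast; omega, by omega⟩
        (coefE_of_lt (by omega))
        (coefE_neg_ne hq h1q m) (exists_simT_mul hq _ m hk)
        (ih (by omega))
      rw [← this]
      congr 1
      push_cast
      ring_nf
  -- The Cartan operator of the new root is the ratio of two neighbouring diagonal operators.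
  have hτ : dgm q (n + 1) (n + 1) = simT q (n + 1) n * dgm q (n + 1) n := by
    have S := simpleOp_E hq h1q (n + 1) n n.lt_succ_self
    have h := S.d_step n (by push_cast; omega) (by push_cast; omega)
    rw [S.τ_d' n (by push_cast; omega) (by push_cast; omega)]
    exact smul_right_injective _ (coefE_self_ne h1q n) h
  have hτ' : dgp q (n + 1) (-(n + 1)) = simT q (n + 1) n * dgp q (n + 1) (-n) := by
    have S := simpleOp_F hq h1q (n + 1) n n.lt_succ_self
    have h := S.d_step (-n) (by push_cast; omega) (by push_cast; omega)
    rw [S.τ_d' (-n) (by push_cast; omega) (by push_cast; omega), neg_add]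
    exact smul_right_injective _ (coefF_neg_ne hq h1q n) h
  refine ⟨fun k hk => ?_, fun k hk => ?_, fun k hk => ?_, hd⟩
  · rcases Nat.lt_succ_iff_lt_or_eq.1 hk with h | rfl
    · exact he k h
    · obtain ⟨c, hc, hL⟩ := simE_top hq h1q hq4 k
      have h0 := moveE k le_rfl
      rw [dfct_apply, (pr_Lm_step k).1, (pr_Lm_step k).2] at h0
      exact cop_of_step hc hL hτ (dgm_mul_dgp hq _ _) (hd k) (sub_eq_zero.1 h0)
  · rcases Nat.lt_succ_iff_lt_or_eq.1 hk with h | rfl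
    · exact hf k h
    · obtain ⟨c, hc, hL⟩ := simF_top hq h1q hq4 k
      have h0 := moveF k le_rfl
      rw [dfct_apply, (pr_Lp_step k).1, (pr_Lp_step k).2] at h0
      exact cop_of_step hc hL hτ' (dgp_mul_dgm hq _ _) (hdp _) (sub_eq_zero.1 h0)
  · rcases Nat.lt_succ_iff_lt_or_eq.1 hk with h | rfl
    · exact ht k h
    · have : simT q (k + 1) k = dgm q (k + 1) (k + 1) * dgp q (k + 1) k := by
        rw [hτ, mul_assoc, dgm_mul_dgp hq, mul_one]
      rw [this, Matrix.mul_kronecker_mul, ← mul_assoc, hd, mul_assoc, hdp, mul_assoc]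

end step

end

section

/-! ### The operator `Rrec` is an intertwiner -/

variable {q : ℂ} {n : ℕ}

lemma permOp_mul_kron (A B : Op n) : permOp n * (A ⊗ₖ B) = (B ⊗ₖ A) * permOp n := by
  ext r c
  simp only [permOp, Matrix.mul_apply, Matrix.of_apply, ite_mul, one_mul, zero_mul, mul_ite,
    mul_one, mul_zero, Matrix.kronecker_apply]
  rw [Finset.sum_eq_single r.swap, Finset.sum_eq_single c.swap]
  · simp [mul_comm]
  · intro b _ h; rw [if_neg h]
  · simp
  · intro b _ h; rw [if_neg]; rintro rfl; exact h (Prod.swap_swap b).symm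
  · simp

lemma isSym_permOp (q : ℂ) (n : ℕ) : IsSym q n (permOp n) where
  e k _ := by rw [cop, opc, mul_add, permOp_mul_kron, permOp_mul_kron, add_mul]
  f k _ := by rw [cop, opc, mul_add, permOp_mul_kron, permOp_mul_kron, add_mul]
  t k _ := permOp_mul_kron _ _
  d i := permOp_mul_kron _ _

lemma IsSym.smul {X : Op₂ n} (h : IsSym q n X) (c : ℂ) : IsSym q n (c • X) where
  e k hk := by rw [smul_mul_assoc, mul_smul_comm, h.e k hk]
  f k hk := by rw [smul_mul_assoc, mul_smul_comm, h.f k hk]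
  t k hk := by rw [smul_mul_assoc, mul_smul_comm, h.t k hk]
  d i := by rw [smul_mul_assoc, mul_smul_comm, h.d i]

lemma isSym_one_zero (q : ℂ) : IsSym q 0 1 where
  e k hk := by omega
  f k hk := by omega
  t k hk := by omega
  d i := by rw [one_mul, mul_one]

lemma permOp_mul_strR (n : ℕ) : permOp n * strR q n = strL q n * permOp n := by
  induction n with
  | zero => simp [strR, strL]
  | succ n ih =>
    simp only [strR, strL, permOp_succ, wt_mul_wt, wt_inj, mul_zero, zero_mul, add_zero, zero_add,
      mul_smul_comm, smul_mul_assoc, smul_zero, ih, and_self]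

lemma permOp_mul_vecB (n : ℕ) : permOp n * vecB q n = vecA q n * permOp n := by
  induction n with
  | zero => simp [vecB, vecA]
  | succ n ih =>
    simp only [vecA, vecB, permOp_succ, wt_mul_wt, wt_inj, mul_zero, zero_mul, add_zero, zero_add,
      mul_smul_comm, smul_mul_assoc, smul_zero, ih, permOp_mul_strR,
      and_self]

lemma permOp_mul_vecBt (n : ℕ) : permOp n * vecBt q n = vecAt q n * permOp n := by
  induction n with
  | zero => simp [vecBt, vecAt]
  | succ n ih =>
    simp only [vecAt, vecBt, permOp_succ, wt_mul_wt, wt_inj, mul_zero, zero_mul, add_zero, zero_add,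
      mul_smul_comm, smul_mul_assoc, smul_zero, ih, permOp_mul_strR,
      and_self]

lemma strL_mul_Mrec' (hq : q ≠ 0) (n : ℕ) :
    strL q n * Mrec q n = (1 + (q ^ 2)⁻¹) • vecAt q n - (q ^ 2)⁻¹ • (Mrec q n * strL q n) := by
  rw [strL_mul_Mrec hq, vecAt_eq hq]
  match_scalars <;> (field_simp; try ring)

lemma vecAt_mul_Mrec (hq : q ≠ 0) (n : ℕ) :
    vecAt q n * Mrec q n = (1 + q ^ 2) • strL q n - q ^ 2 • (Mrec q n * vecAt q n) := by
  rw [vecAt_eq hq, sub_mul, smul_mul_assoc, smul_mul_assoc, mul_assoc, vecA_mul_Mrec hq,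
    strL_mul_Mrec hq]
  simp only [mul_sub, mul_smul_comm]
  match_scalars <;> (field_simp; try ring)

lemma Mrec_mul_permOp_succ (n : ℕ) : Mrec q (n + 1) * permOp (n + 1) =
    wt (Mrec q n * permOp n) ((q + q⁻¹) • permOp n) (-(q ^ 2)⁻¹ • (Mrec q n * permOp n))
      (-q ^ 2 • (Mrec q n * permOp n)) ((q + q⁻¹) • permOp n) (Mrec q n * permOp n) := by
  simp only [Mrec, permOp_succ, wt_mul_wt, mul_zero, zero_add, add_zero, smul_mul_assoc, one_mul]

section

variable (hq : q ≠ 0) (h1q : 1 + q ^ 2 ≠ 0) (hq4 : q ^ 4 ≠ 1)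
include hq h1q hq4

/-- Once the permutation has been moved to the right, both conditions of `IsSym.succ` become
combinations of the rules that move `Mrec` past `strL`, `vecA` and `vecAt`. -/
lemma isSym_Mrec_mul_permOp (n : ℕ) : IsSym q n (Mrec q n * permOp n) := by
  induction n with
  | zero =>
    have : permOp 0 = 1 := by ext r c; simp [permOp, Matrix.one_apply, Subsingleton.elim r c,
      Subsingleton.elim c.swap c]
    rw [this, mul_one]
    exact isSym_one_zero q
  | succ n ih =>
    have hP := isSym_permOp q n
    rw [Mrec_mul_permOp_succ]
    refine IsSym.succ hq h1q hq4 ih (hP.smul _) (ih.smul _) (ih.smul _) (hP.smul _) ih ?_ ?_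
    · rw [dfct_apply, pr_Lm_Lm hq, opr_Lm_Lm hq, smul_mul_assoc, mul_smul_comm, ← smul_sub,
        rs_mul_wt, wt_mul_rs]
      convert smul_zero _
      rw [sub_eq_zero, rs_inj]
      simp only [smul_mul_assoc, mul_smul_comm, mul_assoc, permOp_mul_strR, permOp_mul_vecB]
      simp only [← mul_assoc, strL_mul_Mrec hq, vecA_mul_Mrec hq, sub_mul, smul_mul_assoc]
      refine ⟨?_, ?_, ?_, ?_⟩ <;> match_scalars <;> (field_simp; try ring)
    · rw [dfct_apply, pr_Lp_Lp hq, opr_Lp_Lp hq, smul_mul_assoc, mul_smul_comm, ← smul_sub,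
        lw_mul_wt, wt_mul_lw]
      convert smul_zero _
      rw [sub_eq_zero, lw_inj]
      simp only [smul_mul_assoc, mul_smul_comm, mul_assoc, permOp_mul_strR, permOp_mul_vecBt]
      simp only [← mul_assoc, strL_mul_Mrec' hq, vecAt_mul_Mrec hq, sub_mul, smul_mul_assoc]
      refine ⟨?_, ?_, ?_, ?_⟩ <;> match_scalars <;> (field_simp; try ring)

/-- Both `Mrec * P` and `P` carry a coproduct to its opposite, and `P² = 1`; hence `Mrec` commutes
with the opposite coproducts and may be put in front of `X`. -/
lemma IsSym.Mrec_mul {X : Op₂ n} (h : IsSym q n X) : IsSym q n (Mrec q n * X) := by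
  have hM := isSym_Mrec_mul_permOp hq h1q hq4 n
  have hP := isSym_permOp q n
  have key : ∀ {C D : Op₂ n}, permOp n * C = D * permOp n →
      Mrec q n * permOp n * C = D * (Mrec q n * permOp n) → X * C = D * X →
      Mrec q n * X * C = D * (Mrec q n * X) := fun {C D} h1 h2 h3 => by
    have h' : Mrec q n * D * permOp n = D * Mrec q n * permOp n := by
      rw [mul_assoc, ← h1, ← mul_assoc, h2, mul_assoc]
    have h4 := congrArg (· * permOp n) h'
    simp only [mul_assoc, permOp_mul_permOp, mul_one] at h4
    rw [mul_assoc, h3, ← mul_assoc, h4, mul_assoc]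
  exact ⟨fun k hk => key (hP.e k hk) (hM.e k hk) (h.e k hk),
    fun k hk => key (hP.f k hk) (hM.f k hk) (h.f k hk),
    fun k hk => key (hP.t k hk) (hM.t k hk) (h.t k hk),
    fun i => key (hP.d i) (hM.d i) (h.d i)⟩

/-- The two conditions of `IsSym.succ`, read block by block, are consequences of the left and right
exchange relations. -/
lemma isSym_Rrec (n : ℕ) (u v : ℂ) (huv : ∀ k < n, q * (q ^ (4 * k) * v) - q⁻¹ * u ≠ 0) :
    IsSym q n (Rrec q n u v) := by
  induction n generalizing v with
  | zero => exact isSym_one_zero q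
  | succ n ih =>
    have hS : IsSym q n (Rrec q n u (q ^ 4 * v)) := ih _ fun k hk => by
      have := huv (k + 1) (by omega)
      rwa [show q ^ (4 * (k + 1)) * v = q ^ (4 * k) * (q ^ 4 * v) by ring] at this
    have hMS := hS.Mrec_mul hq h1q hq4
    have hR := ih v fun k hk => huv k (by omega)
    have huv' : ∀ k ≤ n, q * (q ^ (4 * k) * v) - q⁻¹ * u ≠ 0 := fun k hk => huv k (by omega)
    rw [Rrec]
    refine IsSym.succ hq h1q hq4 hR (hS.smul _) (hMS.smul _) (hMS.smul _) (hS.smul _) hR ?_ ?_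
    · rw [dfct_apply, pr_Lm_Lm hq, opr_Lm_Lm hq, smul_mul_assoc, mul_smul_comm, ← smul_sub,
        rs_mul_wt, wt_mul_rs]
      convert smul_zero _
      rw [sub_eq_zero, rs_inj]
      simp only [smul_mul_assoc, mul_smul_comm, vecA_mul_Rrec hq n u v huv',
        strL_mul_Rrec hq n u v huv', Rrec_mul_vecB hq n u v huv', Rrec_mul_strR' hq n u v huv']
      refine ⟨?_, ?_, ?_, ?_⟩ <;> match_scalars <;> (field_simp; try ring)
    · rw [dfct_apply, pr_Lp_Lp hq, opr_Lp_Lp hq, smul_mul_assoc, mul_smul_comm, ← smul_sub,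
        lw_mul_wt, wt_mul_lw]
      convert smul_zero _
      rw [sub_eq_zero, lw_inj]
      simp only [smul_mul_assoc, mul_smul_comm, vecAt_mul_Rrec hq n u v huv',
        strL_mul_Rrec' hq n u v huv', Rrec_mul_vecBt hq n u v huv', Rrec_mul_strR hq n u v huv']
      refine ⟨?_, ?_, ?_, ?_⟩ <;> match_scalars <;> (field_simp; try ring)

-- The corner matrices contain no operators other than `Mrec` and its mirror image. After
-- `Mrec_mul_Rrec` what remains is a set of scalar identities for `alpha` and `beta`.
omit hq4 in
lemma Rrec_corner (n : ℕ) (u v : ℂ) :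
    v • dfct (Rrec q (n + 1) u v) (n + 1) (n + 1) (Lp q (n + 1)) (Lm q (n + 1)) +
      u • dfct (Rrec q (n + 1) u v) (n + 1) (n + 1) (Lm q (n + 1)) (Lp q (n + 1)) = 0 := by
  have h : ∀ X a b c d : Op₂ (n + 1), v • (a * X - X * b) + u • (c * X - X * d) =
      (v • a + u • c) * X - X * (v • b + u • d) := fun X a b c d => by
    simp only [add_mul, mul_add, smul_mul_assoc, mul_smul_comm, smul_sub]; abel
  rw [dfct_apply, dfct_apply, h, pr_corner hq h1q, opr_corner hq h1q, Rrec, wt_mul_wt, wt_mul_wt,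
    sub_eq_zero, wt_inj]
  simp only [smul_mul_assoc, mul_smul_comm, one_mul, mul_one, zero_mul, mul_zero, add_zero,
    zero_add, mul_assoc, ← Mrec_mul_Rrec hq]
  refine ⟨trivial, ?_, ?_, ?_, ?_, trivial⟩ <;> match_scalars <;>
    simp only [alpha, beta, div_eq_mul_inv] <;>
    generalize (q * v - q⁻¹ * u)⁻¹ = I <;> field_simp <;> ring

lemma isAff_Rrec (n : ℕ) (u v : ℂ) (huv : ∀ k < n + 1, q * (q ^ (4 * k) * v) - q⁻¹ * u ≠ 0) :
    IsAff q (n + 1) u v (Rrec q (n + 1) u v) :=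
  (isSym_Rrec hq h1q hq4 (n + 1) u v huv).isAff hq h1q (by
    exact_mod_cast Rrec_corner hq h1q n u v)

end

lemma Generic.den_ne (hq : q ≠ 0) {u v : ℂ} (h : Generic q n u v) :
    ∀ k < n, q * (q ^ (4 * k) * v) - q⁻¹ * u ≠ 0 := fun k hk h0 => by
  refine h.2.2 k hk ?_
  field_simp at h0
  rw [pow_add]
  linear_combination -h0

lemma isIntertwiner_Rrec (hq : q ≠ 0) (h1q : 1 + q ^ 2 ≠ 0) (hq4 : q ^ 4 ≠ 1) {u v : ℂ}
    (h : Generic q (n + 1) u v) : IsIntertwiner q (n + 1) u v (Rrec q (n + 1) u v) :=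
  (isIntertwiner_iff hq h.1 h.2.1 _).2 ⟨(isSym_Rrec hq h1q hq4 _ u v (h.den_ne hq)).isFT hq h1q,
    isAff_Rrec hq h1q hq4 n u v (h.den_ne hq)⟩

lemma Rrec_apply_highest (n : ℕ) (u v : ℂ) (r : Idx n × Idx n) :
    Rrec q n u v r (fun _ => -1, fun _ => -1) = if r = (fun _ => -1, fun _ => -1) then 1 else 0 := by
  induction n generalizing u v with
  | zero =>
    rw [Rrec, Matrix.one_apply]
  | succ n ih =>
    have h1 : (-1 : ℤˣ) ≠ 1 := neg_one_ne_one_units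
    have hi : idxInit (fun _ : Fin (n + 1) => (-1 : ℤˣ)) = fun _ => -1 := rfl
    obtain ⟨r, r'⟩ := r
    rcases Int.units_eq_one_or (r (Fin.last n)) with h | h <;>
      rcases Int.units_eq_one_or (r' (Fin.last n)) with h' | h' <;>
      simp [Rrec, wt, h, h', h1, h1.symm, hi, ih, Prod.ext_iff, idx_ext]

lemma Rrec_vacuum (n : ℕ) (u v : ℂ) : (Rrec q n u v).mulVec (vacuum n) = vacuum n := by
  ext r
  rw [vacuum, Matrix.mulVec_single_one, Matrix.col_apply, Rrec_apply_highest, Pi.single_apply]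

end

section

/-! ### Uniqueness of the intertwiner -/

variable {q : ℂ} {n : ℕ}

/-! ### Restriction of the products to one site fewer -/

section mid

variable {i j : ℤ} (hq : q ≠ 0) (hi : -n ≤ i ∧ i ≤ n) (hj : -n ≤ j ∧ j ≤ n)
include hi

lemma Lm_last_eq_low : ∃ c, Lm q (n + 1) (n + 1) i = b2 0 0 c 0 :=
  ⟨_, by rw [Lm_last hi, b2_smul, smul_zero]⟩

lemma Lp_mid_last_eq_upp : ∃ c, Lp q (n + 1) i (n + 1) = b2 0 c 0 0 :=
  ⟨_, by rw [Lp_mid_last hi, b2_smul, smul_zero]⟩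

lemma Lm_neg_last_eq_low : ∃ c, Lm q (n + 1) i (-(n + 1)) = b2 0 0 c 0 := by
  rw [Lm, if_neg (by omega), if_pos (by omega), lo_neg_last, up_succ hi.1 hi.2, b2_mul, b2_smul]
  simp only [mul_zero, zero_mul, add_zero, zero_add, smul_zero]
  exact ⟨_, rfl⟩

include hq in
lemma Lp_neg_last_eq_upp : ∃ c, Lp q (n + 1) (-(n + 1)) i = b2 0 c 0 0 :=
  ⟨_, by rw [Lp_neg_last hq hi, b2_smul, smul_zero]⟩

omit hi in
lemma sum_emb_kron {F G : ℤ → Op (n + 1)} {F' G' : ℤ → Op n}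
    (hF : ∀ k : ℤ, -n ≤ k ∧ k ≤ n → F k = emb (F' k))
    (hG : ∀ k : ℤ, -n ≤ k ∧ k ≤ n → G k = emb (G' k)) :
    ∑ k ∈ Finset.Icc (-(n : ℤ)) n, F k ⊗ₖ G k =
      wt (∑ k ∈ Finset.Icc (-(n : ℤ)) n, F' k ⊗ₖ G' k) (∑ k ∈ Finset.Icc (-(n : ℤ)) n, F' k ⊗ₖ G' k)
        0 0 (∑ k ∈ Finset.Icc (-(n : ℤ)) n, F' k ⊗ₖ G' k)
        (∑ k ∈ Finset.Icc (-(n : ℤ)) n, F' k ⊗ₖ G' k) := by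
  have e : ∀ k ∈ Finset.Icc (-(n : ℤ)) n, F k ⊗ₖ G k =
      wt (F' k ⊗ₖ G' k) (F' k ⊗ₖ G' k) 0 0 (F' k ⊗ₖ G' k) (F' k ⊗ₖ G' k) := fun k hk => by
    rw [hF k (Finset.mem_Icc.1 hk), hG k (Finset.mem_Icc.1 hk), emb_kron_emb]
  rw [Finset.sum_congr rfl e, sum_wt, Finset.sum_const_zero]

include hq hj

lemma pr_Lm_Lm_succ : pr (Lm q (n + 1)) (Lm q (n + 1)) i j =
    wt (pr (Lm q n) (Lm q n) i j) (pr (Lm q n) (Lm q n) i j) 0 0 (pr (Lm q n) (Lm q n) i j) (pr (Lm q n) (Lm q n) i j) := by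
  rw [pr, sum_Icc_succ, sum_emb_kron (fun k hk => Lm_succ hq hi hk) (fun k hk => Lm_succ hq hk hj),
    Lm_of_lt (i := i) (j := n + 1) (by omega), Lm_of_lt (i := -(n + 1)) (j := j) (by omega), Matrix.zero_kronecker,
    Matrix.kronecker_zero, add_zero, add_zero, ← pr]

lemma opr_Lm_Lm_succ : opr (Lm q (n + 1)) (Lm q (n + 1)) i j =
    wt (opr (Lm q n) (Lm q n) i j) (opr (Lm q n) (Lm q n) i j) 0 0 (opr (Lm q n) (Lm q n) i j) (opr (Lm q n) (Lm q n) i j) := by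
  rw [opr, sum_Icc_succ, sum_emb_kron (fun k hk => Lm_succ hq hk hj) (fun k hk => Lm_succ hq hi hk),
    Lm_of_lt (i := i) (j := n + 1) (by omega), Lm_of_lt (i := -(n + 1)) (j := j) (by omega), Matrix.kronecker_zero,
    Matrix.zero_kronecker, add_zero, add_zero, ← opr]

lemma pr_Lp_Lp_succ : pr (Lp q (n + 1)) (Lp q (n + 1)) i j =
    wt (pr (Lp q n) (Lp q n) i j) (pr (Lp q n) (Lp q n) i j) 0 0 (pr (Lp q n) (Lp q n) i j) (pr (Lp q n) (Lp q n) i j) := by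
  rw [pr, sum_Icc_succ, sum_emb_kron (fun k hk => Lp_succ hq hi hk) (fun k hk => Lp_succ hq hk hj),
    Lp_of_lt (i := n + 1) (j := j) (by omega), Lp_of_lt (i := i) (j := -(n + 1)) (by omega), Matrix.kronecker_zero,
    Matrix.zero_kronecker, add_zero, add_zero, ← pr]

lemma opr_Lp_Lp_succ : opr (Lp q (n + 1)) (Lp q (n + 1)) i j =
    wt (opr (Lp q n) (Lp q n) i j) (opr (Lp q n) (Lp q n) i j) 0 0 (opr (Lp q n) (Lp q n) i j) (opr (Lp q n) (Lp q n) i j) := by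
  rw [opr, sum_Icc_succ, sum_emb_kron (fun k hk => Lp_succ hq hk hj) (fun k hk => Lp_succ hq hi hk),
    Lp_of_lt (i := n + 1) (j := j) (by omega), Lp_of_lt (i := i) (j := -(n + 1)) (by omega), Matrix.zero_kronecker,
    Matrix.kronecker_zero, add_zero, add_zero, ← opr]

/-- The new indices contribute to one off-diagonal middle block only. Its value is irrelevant, since
the mixed condition is restricted to the `(-1,-1)` block alone. -/
lemma pr_Lp_Lm_succ : ∃ y, pr (Lp q (n + 1)) (Lm q (n + 1)) i j =
    wt (pr (Lp q n) (Lm q n) i j) (pr (Lp q n) (Lm q n) i j) y 0 (pr (Lp q n) (Lm q n) i j) (pr (Lp q n) (Lm q n) i j) := by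
  obtain ⟨b, hb⟩ := Lp_mid_last_eq_upp (q := q) hi
  obtain ⟨c, hc⟩ := Lm_last_eq_low (q := q) hj
  refine ⟨b ⊗ₖ c, ?_⟩
  rw [pr, sum_Icc_succ, sum_emb_kron (fun k hk => Lp_succ hq hi hk) (fun k hk => Lm_succ hq hk hj),
    hb, hc, upp_kron_low, Lp_of_lt (i := i) (j := -(n + 1)) (by omega), Matrix.zero_kronecker, add_zero, ← pr, wt_add]
  simp only [add_zero, zero_add]

lemma opr_Lp_Lm_succ : ∃ y, opr (Lp q (n + 1)) (Lm q (n + 1)) i j =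
    wt (opr (Lp q n) (Lm q n) i j) (opr (Lp q n) (Lm q n) i j) y 0 (opr (Lp q n) (Lm q n) i j) (opr (Lp q n) (Lm q n) i j) := by
  obtain ⟨b, hb⟩ := Lp_neg_last_eq_upp hq hj
  obtain ⟨c, hc⟩ := Lm_neg_last_eq_low (q := q) hi
  refine ⟨b ⊗ₖ c, ?_⟩
  rw [opr, sum_Icc_succ, sum_emb_kron (fun k hk => Lp_succ hq hk hj) (fun k hk => Lm_succ hq hi hk),
    hb, hc, upp_kron_low, Lp_of_lt (i := n + 1) (j := j) (by omega), Matrix.zero_kronecker, add_zero, ← opr, wt_add]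
  simp only [add_zero, zero_add]

lemma pr_Lm_Lp_succ : ∃ y, pr (Lm q (n + 1)) (Lp q (n + 1)) i j =
    wt (pr (Lm q n) (Lp q n) i j) (pr (Lm q n) (Lp q n) i j) 0 y (pr (Lm q n) (Lp q n) i j) (pr (Lm q n) (Lp q n) i j) := by
  obtain ⟨b, hb⟩ := Lp_neg_last_eq_upp hq hj
  obtain ⟨c, hc⟩ := Lm_neg_last_eq_low (q := q) hi
  refine ⟨c ⊗ₖ b, ?_⟩
  rw [pr, sum_Icc_succ, sum_emb_kron (fun k hk => Lm_succ hq hi hk) (fun k hk => Lp_succ hq hk hj),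
    hb, hc, low_kron_upp, Lp_of_lt (i := n + 1) (j := j) (by omega), Matrix.kronecker_zero, add_zero, ← pr, wt_add]
  simp only [add_zero, zero_add]

lemma opr_Lm_Lp_succ : ∃ y, opr (Lm q (n + 1)) (Lp q (n + 1)) i j =
    wt (opr (Lm q n) (Lp q n) i j) (opr (Lm q n) (Lp q n) i j) 0 y (opr (Lm q n) (Lp q n) i j) (opr (Lm q n) (Lp q n) i j) := by
  obtain ⟨b, hb⟩ := Lp_mid_last_eq_upp (q := q) hi
  obtain ⟨c, hc⟩ := Lm_last_eq_low (q := q) hj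
  refine ⟨c ⊗ₖ b, ?_⟩
  rw [opr, sum_Icc_succ, sum_emb_kron (fun k hk => Lm_succ hq hk hj) (fun k hk => Lp_succ hq hi hk),
    hb, hc, low_kron_upp, Lp_of_lt (i := i) (j := -(n + 1)) (by omega), Matrix.kronecker_zero, add_zero, ← opr, wt_add]
  simp only [add_zero, zero_add]

end mid

section

variable (hq : q ≠ 0) {a x₁₁ x₁₂ x₂₁ x₂₂ d : Op₂ n}
include hq

/-- For old indices both finite-type products are the same operator in all four diagonal blocks, so
the condition holds for each block of `X` separately. -/
lemma IsFT.blocks (h : IsFT q (n + 1) (wt a x₁₁ x₁₂ x₂₁ x₂₂ d)) :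
    IsFT q n a ∧ IsFT q n x₁₁ ∧ IsFT q n x₁₂ ∧ IsFT q n x₂₁ ∧ IsFT q n x₂₂ ∧ IsFT q n d := by
  have key : ∀ i ∈ Finset.Icc (-(n : ℤ)) n, ∀ j ∈ Finset.Icc (-(n : ℤ)) n,
      ((dfct a i j (Lm q n) (Lm q n) = 0 ∧ dfct x₁₁ i j (Lm q n) (Lm q n) = 0 ∧
        dfct x₁₂ i j (Lm q n) (Lm q n) = 0 ∧ dfct x₂₁ i j (Lm q n) (Lm q n) = 0 ∧
        dfct x₂₂ i j (Lm q n) (Lm q n) = 0 ∧ dfct d i j (Lm q n) (Lm q n) = 0) ∧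
      (dfct a i j (Lp q n) (Lp q n) = 0 ∧ dfct x₁₁ i j (Lp q n) (Lp q n) = 0 ∧
        dfct x₁₂ i j (Lp q n) (Lp q n) = 0 ∧ dfct x₂₁ i j (Lp q n) (Lp q n) = 0 ∧
        dfct x₂₂ i j (Lp q n) (Lp q n) = 0 ∧ dfct d i j (Lp q n) (Lp q n) = 0)) := by
    intro i hi j hj
    obtain ⟨h1, h2⟩ := h i (by simp only [Finset.mem_Icc] at hi ⊢; push_cast; omega) j
      (by simp only [Finset.mem_Icc] at hj ⊢; push_cast; omega)
    rw [Finset.mem_Icc] at hi hj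
    constructor
    · rw [dfct_apply, pr_Lm_Lm_succ hq hi hj, opr_Lm_Lm_succ hq hi hj, wt_mul_wt, wt_mul_wt,
        wt_sub, ← wt_zero, wt_inj] at h1
      simpa only [zero_mul, mul_zero, add_zero, zero_add, ← dfct_apply] using h1
    · rw [dfct_apply, pr_Lp_Lp_succ hq hi hj, opr_Lp_Lp_succ hq hi hj, wt_mul_wt, wt_mul_wt,
        wt_sub, ← wt_zero, wt_inj] at h2
      simpa only [zero_mul, mul_zero, add_zero, zero_add, ← dfct_apply] using h2
  exact ⟨fun i hi j hj => ⟨(key i hi j hj).1.1, (key i hi j hj).2.1⟩,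
    fun i hi j hj => ⟨(key i hi j hj).1.2.1, (key i hi j hj).2.2.1⟩,
    fun i hi j hj => ⟨(key i hi j hj).1.2.2.1, (key i hi j hj).2.2.2.1⟩,
    fun i hi j hj => ⟨(key i hi j hj).1.2.2.2.1, (key i hi j hj).2.2.2.2.1⟩,
    fun i hi j hj => ⟨(key i hi j hj).1.2.2.2.2.1, (key i hi j hj).2.2.2.2.2.1⟩,
    fun i hi j hj => ⟨(key i hi j hj).1.2.2.2.2.2, (key i hi j hj).2.2.2.2.2.2⟩⟩

lemma IsAff.block {u v : ℂ} (h : IsAff q (n + 1) u v (wt a x₁₁ x₁₂ x₂₁ x₂₂ d)) :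
    IsAff q n u v a := by
  intro i hi j hj
  have h1 := h i (by simp only [Finset.mem_Icc] at hi ⊢; push_cast; omega) j
    (by simp only [Finset.mem_Icc] at hj ⊢; push_cast; omega)
  rw [Finset.mem_Icc] at hi hj
  obtain ⟨y₁, e1⟩ := pr_Lp_Lm_succ hq hi hj
  obtain ⟨y₂, e2⟩ := opr_Lp_Lm_succ hq hi hj
  obtain ⟨y₃, e3⟩ := pr_Lm_Lp_succ hq hi hj
  obtain ⟨y₄, e4⟩ := opr_Lm_Lp_succ hq hi hj
  rw [dfct_apply, dfct_apply, e1, e2, e3, e4] at h1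
  simp only [wt_mul_wt, wt_sub, wt_smul, wt_add] at h1
  rw [← wt_zero, wt_inj] at h1
  exact h1.1

variable (h1q : 1 + q ^ 2 ≠ 0) (hq4 : q ^ 4 ≠ 1)

include hq4

lemma rowM_ne (h1q : 1 + q ^ 2 ≠ 0) (n : ℕ) : rowM q n * (aZero q * q) ≠ 0 := by
  have hz0 : aZero q ≠ 0 := fun h => by have := aZero_sq h1q; rw [h] at this; norm_num at this
  exact mul_ne_zero (mul_ne_zero (kap_ne hq hq4) (pow_ne_zero _ (neg_ne_zero.2 (pow_ne_zero 2 hq))))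
    (mul_ne_zero hz0 hq)

/-- The corner condition says that `X` commutes with an operator acting by `q⁻²`, `1`, `1`, `q²` on
the four values of the last entries. As `q⁴ ≠ 1`, the three weights are distinct and `X` preserves
them. -/
lemma IsFT.exists_wt {X : Op₂ (n + 1)} (h : IsFT q (n + 1) X) :
    ∃ a x₁₁ x₁₂ x₂₁ x₂₂ d, X = wt a x₁₁ x₁₂ x₂₁ x₂₂ d := by
  refine ⟨blk X (-1, -1) (-1, -1), blk X (-1, 1) (-1, 1), blk X (-1, 1) (1, -1),
    blk X (1, -1) (-1, 1), blk X (1, -1) (1, -1), blk X (1, 1) (1, 1), ext_blk ?_⟩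
  have hc := (h (n + 1 : ℕ) (by rw [Finset.mem_Icc]; omega) (n + 1 : ℕ)
    (by rw [Finset.mem_Icc]; omega)).1
  rw [dfct_apply, (pr_Lm_corner _).1, (pr_Lm_corner _).2, sub_eq_zero, Nat.cast_add, Nat.cast_one,
    dgm_last, diag_kron_diag] at hc
  have hq2 : q ^ 2 ≠ 1 := fun h => hq4 (by rw [show q ^ 4 = (q ^ 2) ^ 2 by ring, h, one_pow])
  have hi1 : q⁻¹ * q⁻¹ ≠ 1 := fun h => hq2 (by field_simp at h; exact h.symm)
  have hi2 : q⁻¹ * q⁻¹ ≠ q * q := fun h => hq4 (by field_simp at h; exact h.symm)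
  have hi3 : q * q ≠ 1 := fun h => hq2 (by rw [sq, h])
  simp only [Matrix.smul_kronecker, Matrix.kronecker_smul, smul_smul, Matrix.one_kronecker_one,
    mul_inv_cancel₀ hq, inv_mul_cancel₀ hq] at hc
  have key : ∀ {s t : ℂ} {Y : Op₂ n}, s ≠ t → s • Y = t • Y → Y = 0 := fun {s t Y} hst hY => by
    have : (s - t) • Y = 0 := by rw [sub_smul, hY, sub_self]
    exact (smul_eq_zero.1 this).resolve_left (sub_ne_zero.2 hst)
  have hb := fun p p' => congrArg (fun Y => blk Y p p') hc
  have n1 : (-1 : ℤˣ) ≠ 1 := neg_one_ne_one_units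
  simp only [blk_mul, blk_wt] at hb
  rintro ⟨p₁, p₂⟩ ⟨r₁, r₂⟩
  have hb' := hb (p₁, p₂) (r₁, r₂)
  rcases Int.units_eq_one_or p₁ with rfl | rfl <;> rcases Int.units_eq_one_or p₂ with rfl | rfl <;>
    rcases Int.units_eq_one_or r₁ with rfl | rfl <;>
    rcases Int.units_eq_one_or r₂ with rfl | rfl <;>
    simp only [blk_wt, n1, if_true, if_false, zero_mul, mul_zero, add_zero, zero_add,
      smul_mul_assoc, mul_smul_comm, one_mul, mul_one, one_smul] at hb' ⊢
  all_goals
    first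
    | exact key hi1 hb'
    | exact key hi2 hb'
    | exact key hi3 hb'
    | exact key hi1.symm hb'
    | exact key hi2.symm hb'
    | exact key hi3.symm hb'
    | exact key hi1 (by rw [one_smul]; exact hb')
    | exact key hi3 (by rw [one_smul]; exact hb')
    | exact key hi1.symm (by rw [one_smul]; exact hb')
    | exact key hi3.symm (by rw [one_smul]; exact hb')

include h1q

/-- The equation for the entry `(n+1, 0)` of the products of the `ℓ⁻_{ij}`. -/
lemma IsFT.row (h : IsFT q (n + 1) (wt a x₁₁ x₁₂ x₂₁ x₂₂ d)) :
    rs (vecA q n) (q⁻¹ • strL q n) (q • strL q n) (vecA q n) * wt a x₁₁ x₁₂ x₂₁ x₂₂ d =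
      wt a x₁₁ x₁₂ x₂₁ x₂₂ d * rs (q⁻¹ • strR q n) (vecB q n) (vecB q n) (q • strR q n) := by
  have h1 := (h (n + 1 : ℕ) (by rw [Finset.mem_Icc]; omega) 0 (by rw [Finset.mem_Icc]; omega)).1
  rw [dfct_apply, Nat.cast_add, Nat.cast_one, pr_Lm_Lm hq, opr_Lm_Lm hq, smul_mul_assoc,
    mul_smul_comm, ← smul_sub] at h1
  exact sub_eq_zero.1 ((smul_eq_zero.1 h1).resolve_left (rowM_ne hq hq4 h1q n))

/-- The equation for the entry `(n+1, 0)` of the mixed products. -/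
lemma IsAff.row {u v : ℂ} (h : IsAff q (n + 1) u v (wt a x₁₁ x₁₂ x₂₁ x₂₂ d)) :
    rs (v • vecAt q n) ((u * q) • strL q n) ((u * q⁻¹) • strL q n) (v • vecAt q n) *
      wt a x₁₁ x₁₂ x₂₁ x₂₂ d = wt a x₁₁ x₁₂ x₂₁ x₂₂ d *
      rs ((v * q) • strR q n) (u • vecBt q n) (u • vecBt q n) ((v * q⁻¹) • strR q n) := by
  have h1 := h (n + 1 : ℕ) (by rw [Finset.mem_Icc]; omega) 0 (by rw [Finset.mem_Icc]; omega)
  rw [dfct_apply, dfct_apply, Nat.cast_add, Nat.cast_one, pr_Lp_Lm, opr_Lp_Lm hq, pr_Lm_Lp hq,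
    opr_Lm_Lp] at h1
  simp only [smul_mul_assoc, mul_smul_comm, ← smul_sub] at h1
  rw [smul_comm v, smul_comm u, ← smul_add] at h1
  have h2 := (smul_eq_zero.1 h1).resolve_left (rowM_ne hq hq4 h1q n)
  have e1 : rs (v • vecAt q n) ((u * q) • strL q n) ((u * q⁻¹) • strL q n) (v • vecAt q n) =
      v • rs (vecAt q n) 0 0 (vecAt q n) + u • rs 0 (q • strL q n) (q⁻¹ • strL q n) 0 := by
    simp only [rs_smul, rs_add, smul_zero, add_zero, zero_add, smul_smul]
  have e2 : rs ((v * q) • strR q n) (u • vecBt q n) (u • vecBt q n) ((v * q⁻¹) • strR q n) =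
      v • rs (q • strR q n) 0 0 (q⁻¹ • strR q n) + u • rs 0 (vecBt q n) (vecBt q n) 0 := by
    simp only [rs_smul, rs_add, smul_zero, add_zero, zero_add, smul_smul]
  rw [e1, e2, ← sub_eq_zero, ← h2, add_mul, mul_add]
  simp only [smul_mul_assoc, mul_smul_comm, smul_sub]
  abel

end

lemma exists_strR_mul (hq : q ≠ 0) (n : ℕ) : ∃ Y, strR q n * Y = 1 := by
  induction n with
  | zero => exact ⟨1, one_mul 1⟩
  | succ n ih =>
    obtain ⟨Y, hY⟩ := ih
    refine ⟨wt Y (-q ^ 2 • Y) 0 0 Y (-q ^ 2 • Y), ?_⟩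
    rw [strR, wt_mul_wt, ← wt_one]
    simp [hY, smul_smul, hq]

lemma eq_zero_of_mul_strR (hq : q ≠ 0) {x : Op₂ n} (h : x * strR q n = 0) : x = 0 := by
  obtain ⟨Y, hY⟩ := exists_strR_mul hq n
  rw [← mul_one x, ← hY, ← mul_assoc, h, zero_mul]

section

variable (hq : q ≠ 0) (h1q : 1 + q ^ 2 ≠ 0) (hq4 : q ^ 4 ≠ 1)
include hq h1q hq4

/-- The outer blocks satisfy the same equation on one site fewer. For the middle blocks the
finite-type row equation eliminates one block of each pair, and the other satisfies it with `u q⁻⁴`.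
On zero sites the equation excludes `u = q² v`, whence the values `q^{4k+2} v`. -/
lemma eq_zero_of_mul_vec {x : Op₂ n} (hx : IsFT q n x) {u v : ℂ}
    (huv : ∀ k ≤ n, u ≠ q ^ (4 * k + 2) * v)
    (h : (v * q ^ 2) • (x * vecB q n) = u • (x * vecBt q n)) : x = 0 := by
  induction n generalizing u with
  | zero =>
    rw [vecB, vecBt, mul_one] at h
    have h' : (v * q ^ 2 - u) • x = 0 := by rw [sub_smul, h, sub_self]
    refine (smul_eq_zero.1 h').resolve_left fun h0 => huv 0 le_rfl ?_
    linear_combination -h0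
  | succ n ih =>
    obtain ⟨a, x₁₁, x₁₂, x₂₁, x₂₂, d, rfl⟩ := hx.exists_wt hq hq4
    obtain ⟨ha, h11, h12, h21, h22, hd⟩ := hx.blocks hq
    have hr := hx.row hq h1q hq4
    rw [vecB, vecBt, wt_mul_wt, wt_mul_wt, wt_smul, wt_smul, wt_inj] at h
    obtain ⟨e1, e2, e3, e4, e5, e6⟩ := h
    have huv' : ∀ k ≤ n, u ≠ q ^ (4 * k + 2) * v := fun k hk => huv k (by omega)
    have a0 : a = 0 := ih ha huv' e1
    have hw : (q ^ 2)⁻¹ ≠ 0 := inv_ne_zero (pow_ne_zero 2 hq)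
    have d0 : d = 0 := ih hd huv' (by
      simp only [mul_smul_comm] at e6
      rw [smul_comm, smul_comm u] at e6
      exact smul_right_injective _ (neg_ne_zero.2 hw) e6)
    rw [rs_mul_wt, wt_mul_rs, rs_inj, a0, mul_zero, mul_zero] at hr
    have huv2 : ∀ k ≤ n, u * (q ^ 4)⁻¹ ≠ q ^ (4 * k + 2) * v := fun k hk h0 => by
      refine huv (k + 1) (by omega) ?_
      have hq4' : q ^ 4 ≠ 0 := pow_ne_zero 4 hq
      field_simp at h0
      rw [h0]; ring
    -- Here `x` and `y` are the two blocks of a middle row. The row equation gives `x * strR = -q y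
    -- * vecB`; inserting this leaves the original equation for `y` with `u` replaced by `u q⁻⁴`.
    have key : ∀ {x y : Op₂ n}, IsFT q n y → 0 = x * q⁻¹ • strR q n + y * vecB q n →
        (v * q ^ 2) • (x * (q - q⁻¹ ^ 3) • strR q n + y * -(q ^ 2)⁻¹ • vecB q n) =
          u • (x * 0 + y * -(q ^ 2)⁻¹ • vecBt q n) → x = 0 ∧ y = 0 := by
      intro x y hy h1 h2
      simp only [mul_smul_comm, mul_zero, zero_add] at h1 h2
      have h3 : x * strR q n = -q • (y * vecB q n) := by
        have := congrArg (q • ·) h1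
        simp only [smul_zero, smul_add, smul_smul, mul_inv_cancel₀ hq, one_smul] at this
        rw [neg_smul]
        exact eq_neg_of_add_eq_zero_left this.symm
      have hy0 : y = 0 := ih hy huv2 (by
        rw [h3] at h2
        have := congrArg ((-(q ^ 2)⁻¹) • ·) h2
        linear_combination (norm := skip) this
        match_scalars <;> (field_simp; try ring))
      refine ⟨eq_zero_of_mul_strR hq ?_, hy0⟩
      rw [h3, hy0, zero_mul, smul_zero]
    obtain ⟨r1, r2, -, -⟩ := hr
    obtain ⟨p1, p2⟩ := key h12 r1 e3
    obtain ⟨p3, p4⟩ := key h22 r2 e5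
    rw [a0, d0, p1, p2, p3, p4, wt_zero]

/-- With zero outer block, the finite-type and mixed row equations both express `x * strR` through
`y`. Eliminating it gives the equation of `eq_zero_of_mul_vec`, so `y = 0`, and `x = 0` because
`strR` is invertible. The last row equation then kills `d`. -/
lemma eq_zero_of_isFT_of_isAff {u v : ℂ} {x₁₁ x₁₂ x₂₁ x₂₂ d : Op₂ n}
    (huv : ∀ k ≤ n, u ≠ q ^ (4 * k + 2) * v)
    (h : IsFT q (n + 1) (wt 0 x₁₁ x₁₂ x₂₁ x₂₂ d))
    (h' : IsAff q (n + 1) u v (wt 0 x₁₁ x₁₂ x₂₁ x₂₂ d)) :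
    wt 0 x₁₁ x₁₂ x₂₁ x₂₂ d = 0 := by
  obtain ⟨-, h11, h12, h21, h22, hd⟩ := h.blocks hq
  have hr := h.row hq h1q hq4
  have hr' := h'.row hq h1q hq4
  rw [rs_mul_wt, wt_mul_rs, rs_inj, mul_zero, mul_zero] at hr hr'
  have key : ∀ {x y : Op₂ n}, IsFT q n y → 0 = x * q⁻¹ • strR q n + y * vecB q n →
      v • vecAt q n * 0 = x * (v * q) • strR q n + y * u • vecBt q n → x = 0 ∧ y = 0 := by
    intro x y hy h1 h2
    simp only [mul_smul_comm, mul_zero] at h1 h2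
    have h3 : x * strR q n = -q • (y * vecB q n) := by
      have := congrArg (q • ·) h1
      simp only [smul_zero, smul_add, smul_smul, mul_inv_cancel₀ hq, one_smul] at this
      rw [neg_smul]
      exact eq_neg_of_add_eq_zero_left this.symm
    have hy0 : y = 0 := eq_zero_of_mul_vec hq h1q hq4 hy huv (by
      rw [h3] at h2
      linear_combination (norm := skip) h2
      match_scalars <;> (field_simp; try ring))
    refine ⟨eq_zero_of_mul_strR hq ?_, hy0⟩
    rw [h3, hy0, zero_mul, smul_zero]
  obtain ⟨p1, p2⟩ := key h12 hr.1 (by rw [mul_zero]; exact hr'.1)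
  obtain ⟨p3, p4⟩ := key h22 hr.2.1 (by rw [mul_zero]; exact hr'.2.1)
  have hd0 : d = 0 := by
    have := hr.2.2.2
    rw [p2, p4, mul_zero, mul_zero, add_zero, mul_smul_comm] at this
    exact eq_zero_of_mul_strR hq ((smul_eq_zero.1 this.symm).resolve_left hq)
  rw [hd0, p1, p2, p3, p4, wt_zero]

omit hq h1q hq4 in
lemma dfct_sub_smul (X Y : Op₂ n) (c : ℂ) (i j : ℤ) (f g : ℤ → ℤ → Op n) :
    dfct (X - c • Y) i j f g = dfct X i j f g - c • dfct Y i j f g := by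
  simp only [dfct_apply, mul_sub, sub_mul, smul_mul_assoc, mul_smul_comm, smul_sub]
  abel

/-- The `(-1,-1)` block determines the scalar by induction; the difference from that multiple of
`Rrec` has zero `(-1,-1)` block and is again an intertwiner. -/
lemma exists_smul_Rrec {u v : ℂ} (huv : Generic q n u v) {X : Op₂ n} (h : IsFT q n X)
    (h' : IsAff q n u v X) : ∃ c : ℂ, X = c • Rrec q n u v := by
  induction n with
  | zero =>
    refine ⟨X default default, ?_⟩
    ext r s
    rw [Subsingleton.elim r default, Subsingleton.elim s default]
    simp [Rrec]
  | succ n ih =>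
    obtain ⟨a, x₁₁, x₁₂, x₂₁, x₂₂, d, rfl⟩ := h.exists_wt hq hq4
    obtain ⟨c, hc⟩ := ih ⟨huv.1, huv.2.1, fun k hk => huv.2.2 k (by omega)⟩ (h.blocks hq).1
      (h'.block hq)
    refine ⟨c, sub_eq_zero.1 ?_⟩
    have hR := (isIntertwiner_iff hq huv.1 huv.2.1 _).1 (isIntertwiner_Rrec hq h1q hq4 huv)
    have H : IsFT q (n + 1) (wt a x₁₁ x₁₂ x₂₁ x₂₂ d - c • Rrec q (n + 1) u v) :=
      fun i hi j hj => by
        rw [dfct_sub_smul, dfct_sub_smul, (h i hi j hj).1, (h i hi j hj).2,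
          (hR.1 i hi j hj).1, (hR.1 i hi j hj).2]
        simp
    have H' : IsAff q (n + 1) u v (wt a x₁₁ x₁₂ x₂₁ x₂₂ d - c • Rrec q (n + 1) u v) :=
      fun i hi j hj => by
        rw [dfct_sub_smul, dfct_sub_smul, smul_sub, smul_sub, sub_add_sub_comm,
          h' i hi j hj, smul_comm v, smul_comm u, ← smul_add, hR.2 i hi j hj]
        simp
    rw [Rrec, wt_smul, wt_sub, hc, sub_self] at H H' ⊢
    exact eq_zero_of_isFT_of_isAff hq h1q hq4 (fun k hk => huv.2.2 k (by omega)) H H'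

end

end

section

/-! ### The spinor-spinor `R`-matrix -/

variable {q : ℂ} {n : ℕ}

lemma permOp_mul_pr (f g : ℤ → ℤ → Op n) (i j : ℤ) :
    permOp n * pr f g i j = opr g f i j * permOp n := by
  rw [pr, opr, Finset.mul_sum, Finset.sum_mul]
  exact Finset.sum_congr rfl fun k _ => permOp_mul_kron _ _

lemma permOp_vacuum (n : ℕ) : (permOp n).mulVec (vacuum n) = vacuum n := by
  ext r
  rw [vacuum, Matrix.mulVec_single_one, Matrix.col_apply, Pi.single_apply]
  rfl

lemma permOp_zero : permOp 0 = 1 := by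
  ext r c
  simp [permOp, Matrix.one_apply, Subsingleton.elim r c, Subsingleton.elim c.swap c]

lemma vacuum_apply_self (n : ℕ) : vacuum n (fun _ => -1, fun _ => -1) = 1 := Pi.single_eq_same _ _

section

variable (hq : q ≠ 0) (hroot : ∀ k : ℕ, 0 < k → q ^ k ≠ 1)
include hroot

lemma one_add_sq_ne : 1 + q ^ 2 ≠ 0 := fun h => hroot 4 (by norm_num) (by
  linear_combination (q ^ 2 - 1) * h)

include hq

lemma isIntertwiner_iff_exists {u v : ℂ} (h : Generic q (n + 1) u v) (X : Op₂ (n + 1)) :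
    IsIntertwiner q (n + 1) u v X ↔ ∃ c : ℂ, X = c • Rrec q (n + 1) u v := by
  have h1q := one_add_sq_ne hroot
  have hq4 := hroot 4 (by norm_num)
  constructor
  · intro hX
    obtain ⟨h1, h2⟩ := (isIntertwiner_iff hq h.1 h.2.1 X).1 hX
    exact exists_smul_Rrec hq h1q hq4 h h1 h2
  · rintro ⟨c, rfl⟩ s i j hi hj r
    rw [mul_smul_comm, smul_mul_assoc, isIntertwiner_Rrec hq h1q hq4 h s i j hi hj r]

lemma eq_Rrec {u v : ℂ} (h : Generic q (n + 1) u v) {X : Op₂ (n + 1)}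
    (hX : IsIntertwiner q (n + 1) u v X) (hv : X.mulVec (vacuum (n + 1)) = vacuum (n + 1)) :
    X = Rrec q (n + 1) u v := by
  obtain ⟨c, rfl⟩ := (isIntertwiner_iff_exists hq hroot h X).1 hX
  rw [Matrix.smul_mulVec, Rrec_vacuum] at hv
  have := congrFun hv (fun _ => -1, fun _ => -1)
  rw [Pi.smul_apply, vacuum_apply_self, smul_eq_mul, mul_one] at this
  rw [this, one_smul]

lemma spinorR_eq {u v : ℂ} (h : Generic q (n + 1) u v) :
    spinorR q (n + 1) u v = Rrec q (n + 1) u v := by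
  have hex : ∃ X : Op₂ (n + 1), IsIntertwiner q (n + 1) u v X ∧
      X.mulVec (vacuum (n + 1)) = vacuum (n + 1) :=
    ⟨_, (isIntertwiner_iff_exists hq hroot h _).2 ⟨1, (one_smul _ _).symm⟩, Rrec_vacuum _ _ _⟩
  rw [spinorR, dif_pos hex]
  exact eq_Rrec hq hroot h hex.choose_spec.1 hex.choose_spec.2

lemma generic_self {u : ℂ} (hu : u ≠ 0) : Generic q n u u := ⟨hu, hu, fun k _ h =>
  hroot (4 * k + 2) (by omega) (mul_right_cancel₀ hu (by rw [one_mul]; exact h.symm))⟩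

/-- The permutation carries each product to the opposite product with its two matrices interchanged.
Hence the two halves of the mixed condition cancel when `u = v`, and uniqueness applies. -/
lemma Rrec_self {u : ℂ} (hu : u ≠ 0) : Rrec q n u u = permOp n := by
  rcases n with _ | n
  · exact permOp_zero.symm
  · refine (eq_Rrec hq hroot (generic_self hq hroot hu) ?_ (permOp_vacuum _)).symm
    refine (isIntertwiner_iff hq hu hu _).2 ⟨fun i _ j _ => ?_, fun i _ j _ => ?_⟩
    · simp only [dfct_apply, permOp_mul_pr, sub_self, and_self]
    · simp only [dfct_apply, permOp_mul_pr, ← smul_add, sub_add_sub_cancel, sub_self, smul_zero]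

/-- For `u = q⁴`, `v = 1` the shifted factor is `R(q⁴, q⁴) = P`, which cancels against the
permutation on the right. The coefficients become `alpha = q + q⁻¹` and `beta = -q⁻²`. -/
lemma Mrec_eq (n : ℕ) : Mrec q n = Rrec q n (q ^ 4) 1 * permOp n := by
  have hq2 : 1 - q ^ 2 ≠ 0 := fun h => hroot 2 (by norm_num) (sub_eq_zero.1 h).symm
  induction n with
  | zero => rw [Mrec, Rrec, permOp_zero, one_mul]
  | succ n ih =>
    have hD : q * 1 - q⁻¹ * q ^ 4 = q * (1 - q ^ 2) := by field_simp
    have hα : alpha q (q ^ 4) 1 = q + q⁻¹ := by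
      rw [alpha, hD]; field_simp; ring
    have hβ : beta q (q ^ 4) 1 = -(q ^ 2)⁻¹ := by
      rw [beta, hD]; field_simp; ring
    rw [Rrec, permOp_succ, wt_mul_wt, mul_one, Rrec_self hq hroot (pow_ne_zero 4 hq), hα, hβ, Mrec,
      ← ih]
    simp only [smul_mul_assoc, mul_assoc, permOp_mul_permOp, mul_zero, zero_add, add_zero, mul_one]
    congr 2
    field_simp

lemma generic_pow_four : Generic q n (q ^ 4) 1 := ⟨pow_ne_zero 4 hq, one_ne_zero, fun k _ h => by
  rcases k with _ | k
  · refine hroot 2 (by norm_num) (mul_left_cancel₀ (pow_ne_zero 2 hq) ?_)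
    linear_combination h
  · refine hroot (4 * k + 2) (by omega) (mul_left_cancel₀ (pow_ne_zero 4 hq) ?_)
    linear_combination -h⟩

end

/-! ### Parity and the graded product -/

lemma par_kron_par_succ (n : ℕ) : par (n + 1) ⊗ₖ par (n + 1) =
    wt (par n ⊗ₖ par n) (-1 • (par n ⊗ₖ par n)) 0 0 (-1 • (par n ⊗ₖ par n)) (par n ⊗ₖ par n) := by
  rw [par_succ, diag_kron_diag, ← neg_one_smul ℂ (par n)]
  simp only [Matrix.smul_kronecker, Matrix.kronecker_smul, smul_smul]
  norm_num

lemma par_kron_par_mul_self (n : ℕ) : (par n ⊗ₖ par n) * (par n ⊗ₖ par n) = 1 := by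
  rw [← Matrix.mul_kronecker_mul, par_mul_par, Matrix.one_kronecker_one]

lemma par_kron_par_mul_Mrec (n : ℕ) :
    (par n ⊗ₖ par n) * Mrec q n = Mrec q n * (par n ⊗ₖ par n) := by
  induction n with
  | zero => rw [Mrec, one_mul, mul_one]
  | succ n ih =>
    simp only [par_kron_par_succ, Mrec, wt_mul_wt, zero_mul, mul_zero, add_zero, zero_add,
      smul_mul_assoc, mul_smul_comm, ih, one_mul, mul_one, smul_zero, smul_comm (-1 : ℤ)]

lemma par_kron_par_mul_Rrec (n : ℕ) (u v : ℂ) :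
    (par n ⊗ₖ par n) * Rrec q n u v = Rrec q n u v * (par n ⊗ₖ par n) := by
  induction n generalizing u v with
  | zero => rw [Rrec, one_mul, mul_one]
  | succ n ih =>
    have hM : (par n ⊗ₖ par n) * (Mrec q n * Rrec q n u (q ^ 4 * v)) =
        Mrec q n * (Rrec q n u (q ^ 4 * v) * (par n ⊗ₖ par n)) := by
      rw [← mul_assoc, par_kron_par_mul_Mrec, mul_assoc, ih]
    simp only [par_kron_par_succ, Rrec, wt_mul_wt, zero_mul, mul_zero, add_zero, zero_add,
      smul_mul_assoc, mul_smul_comm, smul_zero, ih, hM, smul_comm (-1 : ℤ), mul_assoc]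

lemma theta_eq (c : Idx n) : theta c = (-1) ^ n * (-1) ^ idxDeg c := by
  have h : ∀ i : ℤˣ, ((i : ℤ) : ℂ) = -1 * (-1) ^ vecDeg i := fun i => by
    rcases Int.units_eq_one_or i with rfl | rfl <;> simp [vecDeg, neg_one_ne_one_units]
  simp only [theta, idxDeg, h, Finset.prod_mul_distrib, Finset.prod_pow_eq_pow_sum]
  simp

lemma theta_mul_theta (c d : Idx n) : theta c * theta d = (-1) ^ idxDeg c * (-1) ^ idxDeg d := by
  have h : ((-1 : ℂ) ^ n) * (-1) ^ n = 1 := by rw [← mul_pow]; norm_num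
  rw [theta_eq, theta_eq]
  linear_combination ((-1 : ℂ) ^ idxDeg c * (-1) ^ idxDeg d) * h

lemma par_kron_par_eq (n : ℕ) : par n ⊗ₖ par n =
    Matrix.diagonal fun c : Idx n × Idx n => (-1 : ℂ) ^ idxDeg c.1 * (-1) ^ idxDeg c.2 :=
  Matrix.diagonal_kronecker_diagonal _ _

/-- On a nonzero entry of the permutation the first row index equals the second column index, so the
sign of `γ` is the total parity of the column. -/
lemma permOp'_eq (n : ℕ) : permOp' n = permOp n * (par n ⊗ₖ par n) := by
  ext r c
  rw [par_kron_par_eq, Matrix.mul_diagonal]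
  simp only [permOp', gammaLeft, permOp, Matrix.of_apply, theta_mul_theta]
  split_ifs with h
  · rw [h, Prod.fst_swap]; ring
  · simp

lemma permOp'_eq_gammaRight (n : ℕ) : permOp' n = gammaRight (permOp n) := by
  ext r c
  simp only [permOp', gammaLeft, gammaRight, permOp, Matrix.of_apply]
  split_ifs with h
  · rw [h, Prod.fst_swap, Prod.snd_swap]; ring
  · simp

lemma gradedMul_diag (A : Op₂ n) : gradedMul A (eUnit (-1) (-1) ⊗ₖ eUnit (-1) (-1) +
    eUnit 1 1 ⊗ₖ eUnit 1 1) = wt A 0 0 0 0 A := by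
  ext ⟨r, r'⟩ ⟨s, s'⟩
  have n1 := neg_one_ne_one_units
  rcases Int.units_eq_one_or (r (Fin.last n)) with h | h <;>
    rcases Int.units_eq_one_or (r' (Fin.last n)) with h' | h' <;>
    rcases Int.units_eq_one_or (s (Fin.last n)) with k | k <;>
    rcases Int.units_eq_one_or (s' (Fin.last n)) with k' | k' <;>
    simp [gradedMul, wt, h, h', k, k', eUnit, unitDeg, Matrix.single_apply, n1, n1.symm]

lemma gradedMul_antidiag (A : Op₂ n) : gradedMul A (eUnit (-1) (-1) ⊗ₖ eUnit 1 1 +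
    eUnit 1 1 ⊗ₖ eUnit (-1) (-1)) = wt 0 A 0 0 A 0 := by
  ext ⟨r, r'⟩ ⟨s, s'⟩
  have n1 := neg_one_ne_one_units
  rcases Int.units_eq_one_or (r (Fin.last n)) with h | h <;>
    rcases Int.units_eq_one_or (r' (Fin.last n)) with h' | h' <;>
    rcases Int.units_eq_one_or (s (Fin.last n)) with k | k <;>
    rcases Int.units_eq_one_or (s' (Fin.last n)) with k' | k' <;>
    simp [gradedMul, wt, h, h', k, k', eUnit, unitDeg, Matrix.single_apply, n1, n1.symm]

/-- Both units are odd, so the Koszul signs of the two copies combine to `par ⊗ par`, acting first.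
-/
lemma gradedMul_flip (A : Op₂ n) (u v : ℂ) :
    gradedMul A (v • (eUnit (-1) 1 ⊗ₖ eUnit 1 (-1)) + u • (eUnit 1 (-1) ⊗ₖ eUnit (-1) 1)) =
      wt 0 0 (v • (A * (par n ⊗ₖ par n))) (u • (A * (par n ⊗ₖ par n))) 0 0 := by
  rw [par_kron_par_eq]
  ext ⟨r, r'⟩ ⟨s, s'⟩
  have n1 := neg_one_ne_one_units
  rcases Int.units_eq_one_or (r (Fin.last n)) with h | h <;>
    rcases Int.units_eq_one_or (r' (Fin.last n)) with h' | h' <;>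
    rcases Int.units_eq_one_or (s (Fin.last n)) with k | k <;>
    rcases Int.units_eq_one_or (s' (Fin.last n)) with k' | k' <;>
    simp [gradedMul, wt, h, h', k, k', eUnit, unitDeg, Matrix.single_apply, n1, n1.symm,
      Matrix.mul_diagonal, pow_add] <;> ring

lemma eUnitOne_eq (a b : ℤˣ) : eUnitOne a b =
    b2 (if a = -1 ∧ b = -1 then 1 else 0) (if a = -1 ∧ b = 1 then 1 else 0)
      (if a = 1 ∧ b = -1 then 1 else 0) (if a = 1 ∧ b = 1 then 1 else 0) := by
  ext r s
  have n1 := neg_one_ne_one_units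
  have hi : ∀ (r : Idx 1) (a : ℤˣ), (fun _ => a) = r ↔ a = r 0 := fun r a => by
    rw [idx_ext]; simp [Subsingleton.elim (idxInit r) (idxInit fun _ => a)]
  rcases Int.units_eq_one_or (r 0) with h | h <;>
    rcases Int.units_eq_one_or (s 0) with k | k <;>
    rcases Int.units_eq_one_or a with rfl | rfl <;>
    rcases Int.units_eq_one_or b with rfl | rfl <;>
    simp [eUnitOne, b2, Matrix.single_apply, hi, h, k, n1, n1.symm, Matrix.one_apply,
      Subsingleton.elim (idxInit r) (idxInit s)]

lemma Rrec_one (u v : ℂ) : Rrec q 1 u v =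
    eUnitOne (-1) (-1) ⊗ₖ eUnitOne (-1) (-1) + eUnitOne 1 1 ⊗ₖ eUnitOne 1 1 +
      alpha q u v • (eUnitOne (-1) (-1) ⊗ₖ eUnitOne 1 1 + eUnitOne 1 1 ⊗ₖ eUnitOne (-1) (-1)) +
      beta q u v • (v • (eUnitOne (-1) 1 ⊗ₖ eUnitOne 1 (-1)) +
        u • (eUnitOne 1 (-1) ⊗ₖ eUnitOne (-1) 1)) := by
  have n1 := neg_one_ne_one_units
  simp only [eUnitOne_eq, n1, n1.symm, and_true, and_false, if_true, if_false, diag_kron_diag,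
    upp_kron_low, low_kron_upp, wt_add, wt_smul, Matrix.kronecker_zero, Matrix.zero_kronecker,
    Matrix.one_kronecker_one, add_zero, zero_add, smul_zero, Rrec, Mrec, mul_one, smul_smul]

lemma spinorR_succ (hq : q ≠ 0) (hroot : ∀ k : ℕ, 0 < k → q ^ k ≠ 1) {u v : ℂ}
    (h : Generic q (n + 2) u v) : spinorR q (n + 2) u v =
      gradedMul (spinorR q (n + 1) u v)
        (eUnit (-1) (-1) ⊗ₖ eUnit (-1) (-1) + eUnit 1 1 ⊗ₖ eUnit 1 1) +
      alpha q u v • gradedMul (spinorR q (n + 1) u (q ^ 4 * v))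
        (eUnit (-1) (-1) ⊗ₖ eUnit 1 1 + eUnit 1 1 ⊗ₖ eUnit (-1) (-1)) +
      beta q u v • gradedMul (spinorU q (n + 1) u (q ^ 4 * v))
        (v • (eUnit (-1) 1 ⊗ₖ eUnit 1 (-1)) + u • (eUnit 1 (-1) ⊗ₖ eUnit (-1) 1)) := by
  have h1 : Generic q (n + 1) u v := ⟨h.1, h.2.1, fun k hk => h.2.2 k (by omega)⟩
  have h2 : Generic q (n + 1) u (q ^ 4 * v) :=
    ⟨h.1, mul_ne_zero (pow_ne_zero 4 hq) h.2.1, fun k hk h0 => h.2.2 (k + 1) (by omega) (by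
      rw [h0]; ring)⟩
  -- `P'` contains one factor `par ⊗ par` and the graded product supplies another. The R-matrix is
  -- even, so they meet and cancel, which leaves `R(q⁴,1) P R(u,q⁴v)`.
  have hU : spinorU q (n + 1) u (q ^ 4 * v) * (par (n + 1) ⊗ₖ par (n + 1)) =
      Mrec q (n + 1) * Rrec q (n + 1) u (q ^ 4 * v) := by
    rw [spinorU, spinorR_eq hq hroot h2, spinorR_eq hq hroot (generic_pow_four hq hroot),
      permOp'_eq, ← mul_assoc, ← Mrec_eq hq hroot, mul_assoc, mul_assoc,
      ← mul_assoc (par _ ⊗ₖ par _), par_kron_par_mul_Rrec, mul_assoc, par_kron_par_mul_self,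
      mul_one]
  rw [gradedMul_diag, gradedMul_antidiag, gradedMul_flip, hU, spinorR_eq hq hroot h,
    spinorR_eq hq hroot h1, spinorR_eq hq hroot h2, wt_smul, wt_smul, wt_add, wt_add, Rrec]
  simp only [smul_zero, add_zero, zero_add, smul_smul]

end

end SpinorR

end

theorem proposition2p9 (q : ℝ) (hq0 : q ≠ 0) (hq : ∀ k : ℕ, 0 < k → q ^ k ≠ 1) :
    -- the R-matrix is the intertwiner, unique up to a scalar and normalised on the highest vector
    (∀ (n : ℕ) (u v : ℂ), 1 ≤ n → SpinorR.Generic q n u v →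
      (SpinorR.spinorR q n u v).mulVec (SpinorR.vacuum n) = SpinorR.vacuum n ∧
      ∀ X : SpinorR.Op₂ n, SpinorR.IsIntertwiner q n u v X ↔
        ∃ c : ℂ, X = c • SpinorR.spinorR q n u v) ∧
    -- the base of the recurrence
    (∀ u v : ℂ, SpinorR.Generic q 1 u v →
      SpinorR.spinorR q 1 u v =
        SpinorR.eUnitOne (-1) (-1) ⊗ₖ SpinorR.eUnitOne (-1) (-1) +
          SpinorR.eUnitOne 1 1 ⊗ₖ SpinorR.eUnitOne 1 1 +
        SpinorR.alpha q u v •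
          (SpinorR.eUnitOne (-1) (-1) ⊗ₖ SpinorR.eUnitOne 1 1 +
            SpinorR.eUnitOne 1 1 ⊗ₖ SpinorR.eUnitOne (-1) (-1)) +
        SpinorR.beta q u v •
          (v • (SpinorR.eUnitOne (-1) 1 ⊗ₖ SpinorR.eUnitOne 1 (-1)) +
            u • (SpinorR.eUnitOne 1 (-1) ⊗ₖ SpinorR.eUnitOne (-1) 1))) ∧
    -- the operators `P` and `P'`
    (∀ (n : ℕ) (u : ℂ), 1 ≤ n → u ≠ 0 →
      SpinorR.spinorR q n u u = SpinorR.permOp n ∧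
      SpinorR.permOp' n = SpinorR.gammaLeft (SpinorR.spinorR q n u u) ∧
      SpinorR.permOp' n = SpinorR.gammaRight (SpinorR.spinorR q n u u)) ∧
    -- the recurrence, from `n ≥ 1` to `n + 1`
    (∀ (n : ℕ) (u v : ℂ), 1 ≤ n → SpinorR.Generic q (n + 1) u v →
      SpinorR.spinorR q (n + 1) u v =
        SpinorR.gradedMul (SpinorR.spinorR q n u v)
          (SpinorR.eUnit (-1) (-1) ⊗ₖ SpinorR.eUnit (-1) (-1) +
            SpinorR.eUnit 1 1 ⊗ₖ SpinorR.eUnit 1 1) +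
        SpinorR.alpha q u v • SpinorR.gradedMul (SpinorR.spinorR q n u (q ^ 4 * v))
          (SpinorR.eUnit (-1) (-1) ⊗ₖ SpinorR.eUnit 1 1 +
            SpinorR.eUnit 1 1 ⊗ₖ SpinorR.eUnit (-1) (-1)) +
        SpinorR.beta q u v • SpinorR.gradedMul (SpinorR.spinorU q n u (q ^ 4 * v))
          (v • (SpinorR.eUnit (-1) 1 ⊗ₖ SpinorR.eUnit 1 (-1)) +
            u • (SpinorR.eUnit 1 (-1) ⊗ₖ SpinorR.eUnit (-1) 1))) := by
  have hQ0 : (q : ℂ) ≠ 0 := by exact_mod_cast hq0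
  have hQ : ∀ k : ℕ, 0 < k → (q : ℂ) ^ k ≠ 1 := fun k hk => by exact_mod_cast hq k hk
  refine ⟨fun n u v hn h => ?_, fun u v h => ?_, fun n u hn hu => ?_, fun n u v hn h => ?_⟩
  · obtain ⟨n, rfl⟩ := Nat.exists_eq_add_of_le' hn
    rw [SpinorR.spinorR_eq hQ0 hQ h]
    exact ⟨SpinorR.Rrec_vacuum _ _ _, SpinorR.isIntertwiner_iff_exists hQ0 hQ h⟩
  · rw [SpinorR.spinorR_eq hQ0 hQ h, SpinorR.Rrec_one]
  · obtain ⟨n, rfl⟩ := Nat.exists_eq_add_of_le' hn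
    rw [SpinorR.spinorR_eq hQ0 hQ (SpinorR.generic_self hQ0 hQ hu),
      SpinorR.Rrec_self hQ0 hQ hu]
    exact ⟨rfl, rfl, SpinorR.permOp'_eq_gammaRight _⟩
  · obtain ⟨n, rfl⟩ := Nat.exists_eq_add_of_le' hn
    exact SpinorR.spinorR_succ hQ0 hQ h
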